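/- Let $d\in\{2,3\}$. For a measurable, a.e. nonnegative potential $U$ on $\mathbb R^d$ let $-\Delta+U$ denote the self-adjoint operator on $L^2(\mathbb R^d;\mathbb C)$ associated with the quadratic form $\int|\nabla f|^2+\int U|f|^2$. For $\tau>0$ let $$G_\tau^{U}=\frac{1}{\tau\,(e^{(-\Delta+U)/\tau}-1)},\qquad \varrho_\tau^{U}(x)=G_\tau^{U}(x;x),$$ where $G_\tau^U(x;y)$ is the continuous integral kernel of $G_\tau^U$; for a constant $\kappa>0$ the density $\varrho^\kappa_\tau(x)$ does not depend on $x$, and its value is denoted $\bar\varrho_\tau^\kappa$. Let $V\in L^\infty_{\rm loc}(\mathbb R^d)$ be real valued and satisfy: $V(x)\ge 0$ for all $x$; $(-\Delta+\kappa_1+V)^{-1}$ is Hilbert–Schmidt for some $\kappa_1>0$; and there is $C>0$ with $V(x+y)\le C\,V(x)V(y)$ for all $x,y\in\mathbb R^d$. (Then $V>0$ everywhere.) Let $w\in L^\infty(\mathbb R^d)$ be real valued and even, with $\int|w(y)|\,(1+V(y)^2)\,dy<\infty$. For $f\in L^\infty_{\rm loc}(\mathbb R^d)$ put $\|f\|_V=\sup_x|f(x)/V(x)|$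 (essential supremum), and let $B_r(V)=\{f\in L^\infty_{\rm loc}(\mathbb R^d):\|f-V\|_V\le r\}$. Then for every $r\in(0,1)$ there is $\kappa_0=\kappa_0(r)>0$ such that the following holds for every $\kappa>\kappa_0$. 1. For every $\tau>0$ the equation $$u=V+w*(\varrho_\tau^{\kappa+u}-\bar\varrho_\tau^{\kappa}),\qquad u\in B_r(V),$$ has a solution $u=v_\tau$, and it is unique (as an element of $L^\infty_{\rm loc}$, that is, up to equality almost everywhere). In particular, the densities are well defined and the convolution integral converges absolutely at almost every point. 2. There is $v\in B_r(V)$, depending on $\kappa$ but not on $\tau$, with $\lim_{\tau\to\infty}\|v_\tau-v\|_V=0$. 3. If in addition $V\in C^1(\mathbb R^d)$ and $\|\,|\nabla V|\,\|_V<\infty$, then $$\lim_{\tau\to\infty}\big\|(-\Delta+\kappa+v_\tau)^{-1}-(-\Delta+\kappa+v)^{-1}\big\|_{\rm HS}=0,$$ where $\|\cdot\|_{\rm HS}$ is the Hilbert–Schmidt norm on operators on $L^2(\mathbb R^d;\mathbb C)$. -/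

import Mathlib

open MeasureTheory Filter Topology Set
open scoped ENNReal

noncomputable section

namespace Counterterm

/-- The spatial domain `ℝ^d`, with the Euclidean norm. -/
abbrev Space (d : ℕ) := EuclideanSpace ℝ (Fin d)

/-- The one-particle space `L²(ℝ^d; ℂ)`. -/
abbrev OneParticle (d : ℕ) := Lp ℂ 2 (volume : Measure (Space d))

/-- `i`-th partial derivative of a (test) function. -/
def partialDeriv {d : ℕ} (i : Fin d) (η : Space d → ℝ) (x : Space d) : ℝ :=
  fderiv ℝ η x (EuclideanSpace.single i 1)

/-- The `L²` function `f` has the distributional gradient `F = (F₁, …, F_d)`, with components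
in `L²`. -/
def HasWeakGradient {d : ℕ} (f : OneParticle d) (F : Fin d → OneParticle d) : Prop :=
  ∀ (i : Fin d) (η : Space d → ℝ), ContDiff ℝ (⊤ : ℕ∞) η → HasCompactSupport η →
    ∫ x, partialDeriv i η x • f x = - ∫ x, η x • F i x

/-- `f` has finite potential energy: `∫ U |f|² < ∞` (used for `U ≥ 0`). -/
def FinitePotentialEnergy {d : ℕ} (U : Space d → ℝ) (f : OneParticle d) : Prop :=
  Integrable (fun x => U x * ‖f x‖ ^ 2)

/-- `f` lies in the domain of the self-adjoint operator `-Δ + U` and `(-Δ + U) f = g`.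
Here `-Δ + U`, for `U ≥ 0`, is the operator associated with the closed quadratic form
`∫ |∇f|² + ∫ U |f|²`, whose domain consists of the `f ∈ L²` with `∇f ∈ L²` and
`∫ U |f|² < ∞`. -/
def SchrodingerEq {d : ℕ} (U : Space d → ℝ) (f g : OneParticle d) : Prop :=
  ∃ F : Fin d → OneParticle d, HasWeakGradient f F ∧ FinitePotentialEnergy U f ∧
    ∀ (φ : OneParticle d) (Φ : Fin d → OneParticle d),
      HasWeakGradient φ Φ → FinitePotentialEnergy U φ →
        ∑ i, inner ℂ (Φ i) (F i) + ∫ x, (U x : ℂ) * (starRingEnd ℂ (φ x) * f x) = inner ℂ φ g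

/-- `R` is the bounded, everywhere defined inverse `(-Δ + U)⁻¹`: the graph of `R` is the
transpose of the graph of `-Δ + U`. There is at most one such `R`. -/
def IsSchrodingerInverse {d : ℕ} (U : Space d → ℝ) (R : OneParticle d →L[ℂ] OneParticle d) :
    Prop :=
  ∀ f g : OneParticle d, R g = f ↔ SchrodingerEq U f g

/-- The Hilbert–Schmidt norm `(tr T*T)^{1/2} = (∑ ‖T e_i‖²)^{1/2} ∈ [0,∞]`, the sum running over
an orthonormal basis. -/
def hsNorm {d : ℕ} (T : OneParticle d →L[ℂ] OneParticle d) : ℝ≥0∞ :=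
  (∑' e : (exists_hilbertBasis ℂ (OneParticle d)).choose,
    ‖T (e : OneParticle d)‖ₑ ^ 2) ^ (1 / 2 : ℝ)

/-- The function `s ↦ 1 / (τ (exp (s⁻¹/τ) - 1))` on `[0,∞)`, with its limit `0` at `s = 0`.
Thus `1 / (τ (exp (h/τ) - 1)) = bose τ (h⁻¹)`. -/
def bose (τ s : ℝ) : ℝ :=
  if s = 0 then 0 else 1 / (τ * (Real.exp (s⁻¹ / τ) - 1))

/-- `1 / (τ (exp (A/τ) - 1))` by continuous functional calculus, where `R = A⁻¹` is the bounded
self-adjoint inverse of a positive self-adjoint operator `A` on a complex Hilbert space. -/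
def boseOperator {𝓗 : Type*} [NormedAddCommGroup 𝓗] [InnerProductSpace ℂ 𝓗] [CompleteSpace 𝓗]
    (τ : ℝ) (R : 𝓗 →L[ℂ] 𝓗) : 𝓗 →L[ℂ] 𝓗 :=
  cfc (bose τ) R

/-- `G` is the operator `G_τ^U = 1 / (τ (exp ((-Δ + U)/τ) - 1))`, defined by functional calculus
of the self-adjoint operator `-Δ + U`, equivalently of its bounded inverse. -/
def IsGreenOperator {d : ℕ} (τ : ℝ) (U : Space d → ℝ)
    (G : OneParticle d →L[ℂ] OneParticle d) : Prop :=
  ∃ R : OneParticle d →L[ℂ] OneParticle d,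
    IsSchrodingerInverse U R ∧ IsSelfAdjoint R ∧ G = boseOperator τ R

/-- `K` is the continuous integral kernel of the operator `T`. -/
def IsContinuousKernel {d : ℕ} (T : OneParticle d →L[ℂ] OneParticle d)
    (K : Space d → Space d → ℂ) : Prop :=
  Continuous (fun p : Space d × Space d => K p.1 p.2) ∧
    ∀ f : OneParticle d, ∀ᵐ x, Integrable (fun y => K x y * f y) ∧
      T f x = ∫ y, K x y * f y

/-- `ϱ` is the quantum density `ϱ_τ^U(x) = G_τ^U(x;x)`. -/
def IsQuantumDensity {d : ℕ} (τ : ℝ) (U : Space d → ℝ) (ϱ : Space d → ℝ) : Prop :=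
  ∃ (G : OneParticle d →L[ℂ] OneParticle d) (K : Space d → Space d → ℂ),
    IsGreenOperator τ U G ∧ IsContinuousKernel G K ∧ ∀ x, K x x = (ϱ x : ℂ)

/-- `f ∈ L^∞_loc(ℝ^d)`. -/
def MemLinftyLoc {d : ℕ} (f : Space d → ℝ) : Prop :=
  ∀ K : Set (Space d), IsCompact K → MemLp f ∞ (volume.restrict K)

/-- The weighted norm `‖f‖_V = sup |f / V| ∈ [0,∞]` (for `V > 0`). -/
def weightedNorm {d : ℕ} (V f : Space d → ℝ) : ℝ≥0∞ :=
  eLpNorm (fun x => f x / V x) ∞ volume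

/-- The closed ball `B_r(V)`. -/
def MemBall {d : ℕ} (V : Space d → ℝ) (r : ℝ) (f : Space d → ℝ) : Prop :=
  MemLinftyLoc f ∧ weightedNorm V (fun x => f x - V x) ≤ ENNReal.ofReal r

/-- `u` solves the counterterm problem
`u = V + w * (ϱ_τ^{κ+u} - ϱbar_τ^κ)`, `u ∈ B_r(V)`, where `ϱbar_τ^κ` is the (constant) value of
the density `ϱ_τ^κ`. As everywhere in `L^∞_loc`, equality is almost everywhere. -/
def SolvesCounterterm {d : ℕ} (V w : Space d → ℝ) (κ r τ : ℝ) (u : Space d → ℝ) : Prop :=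
  MemBall V r u ∧ ∃ (ϱ : Space d → ℝ) (ϱbar : ℝ),
    IsQuantumDensity τ (fun x => κ + u x) ϱ ∧
    IsQuantumDensity τ (fun _ : Space d => κ) (fun _ => ϱbar) ∧
    ∀ᵐ x, Integrable (fun y => w (x - y) * (ϱ y - ϱbar)) ∧
      u x = V x + ∫ y, w (x - y) * (ϱ y - ϱbar)

end Counterterm

end

open Counterterm

/-!
The equation `u = V + w * (ϱ_τ^{κ+u} - ϱ_τ^κ)` is solved by the contraction principle in the norm
`‖·‖_V`, and everything rests on one estimate: for two potentials `U, U' ≥ κ` of at most exponential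
growth, `|ϱ_τ^U - ϱ_τ^{U'}| ≤ K(κ) ‖U - U'‖_V V` pointwise, uniformly in `τ`, with `K(κ) → 0` as
`κ → ∞` (`abs_density_sub_le`). Submultiplicativity of `V` and the weighted integrability of `w`
show that convolution with `w` preserves such bounds (`integrable_conv`), so for large `κ` the map
is a contraction of the ball (`exists_fixedPoint`, `fixedPoint_unique`).

**From the form to the densities.** The inverse `R = (-Δ + U)⁻¹` is obtained from the quadratic form
by Riesz representation (`isSchrodingerInverse_schrodingerInv`), and the semigroup
`S_t = e^{-t(-Δ+U)}` from `R` by functional calculus. For `d ≤ 3` Duhamel's formula converges in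
`L²` when applied to a delta function, which gives vectors `k_x ∈ L²`, continuous in `x`, with
`(S_t f)(x) = ⟨k_x, f⟩` (`heatOp_apply_ae_eq`). Hence operators `S_t B S_t` have continuous kernels;
the Bose operator is of this form (`boseOperator_eq`), and expanding the Bose function into a
geometric series yields `ϱ_τ^U(x) = (1/τ) ∑_{n ≥ 1} p_{n/τ}(x)`, with `p_t(x)` the diagonal of the
kernel of `S_t` (`isQuantumDensity_iff`, `hasSum_density`).

**The estimate.** The semigroup preserves positivity, since `R` does by the Beurling–Deny criterion
(`isNonneg_schrodingerInv`, `isNonneg_heatOp`), and it is therefore dominated by the heat semigroup,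
`S_t φ ≤ e^{-κ t} e^{tΔ} φ` (`norm_heatOp_apply_le`). Differentiating `s ↦ ⟨S'_{t-s} ρ, S_s ρ⟩`,
with `ρ` an approximate delta function, and using domination for both semigroups gives
`|p_t - p'_t| ≤ const · ‖U - U'‖_V V t^{1 - d/2} e^{-(κ - const) t}` (`abs_heatDiag_sub_le`). The
Riemann sums of the right-hand side are bounded by its integral over `t`, finite for `d ≤ 3` and
small for large `κ`.

**Large temperatures.** As `τ → ∞` the Riemann sums of `p_t - p'_t` converge, uniformly over the
ball and relative to `V`: small times are controlled by the estimate above, and elsewhere `p_t` and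
`p'_t` are decreasing in `t` (`exists_abs_density_sub_integral_le`). This uses that `V` is bounded
below by a positive constant: otherwise infinitely many disjoint translates of a bump would have
bounded energy, and the resolvent would not be Hilbert–Schmidt (`exists_pos_le_of_hsNorm_lt_top`).
Thus the solutions form a Cauchy family in `‖·‖_V` (`exists_abs_fixedPoint_sub_le`).

**Resolvents.** If `|u - v| ≤ ε V` in the ball, then `κ + u` and `κ + v` differ by a factor
`1 + O(ε)`, so that their inverses satisfy `-δ R ≤ R' - R ≤ δ R` as forms with `δ = O(ε)`. As the
Hilbert–Schmidt norm is monotone on positive operators, `‖R' - R‖_HS ≤ 4 δ ‖R‖_HS`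
(`hsNorm_schrodingerInv_sub_le`); no regularity of `V` is needed.
-/

noncomputable section

namespace Counterterm

variable {d : ℕ}

section

/-! ### Square-integrable functions -/

/-- The class in `L²` of a function, `0` if the function is not square integrable. -/
def toL2 (f : Space d → ℂ) : OneParticle d :=
  open Classical in if h : MemLp f 2 volume then h.toLp f else 0

theorem coeFn_toL2 {f : Space d → ℂ} (h : MemLp f 2 volume) : toL2 f =ᵐ[volume] f := by
  rw [toL2, dif_pos h]
  exact h.coeFn_toLp

/-- The class in `L²` of a real function. -/
def rL2 (f : Space d → ℝ) : OneParticle d := toL2 (fun x => (f x : ℂ))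

theorem coeFn_rL2 {f : Space d → ℝ} (h : MemLp f 2 volume) :
    rL2 f =ᵐ[volume] fun x => (f x : ℂ) :=
  coeFn_toL2 h.ofReal

theorem inner_eq_integral (f g : OneParticle d) :
    inner ℂ f g = ∫ x, starRingEnd ℂ (f x) * g x := by
  rw [L2.inner_def]
  refine integral_congr_ae (Eventually.of_forall fun x => ?_)
  simp only [RCLike.inner_apply]
  ring

theorem integrable_conj_mul (f g : OneParticle d) :
    Integrable (fun x => starRingEnd ℂ (f x) * g x) := by
  refine (L2.integrable_inner (𝕜 := ℂ) f g).congr (Eventually.of_forall fun x => ?_)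
  simp only [RCLike.inner_apply]
  ring

theorem inner_rL2 {η : Space d → ℝ} (h : MemLp η 2 volume) (f : OneParticle d) :
    inner ℂ (rL2 η) f = ∫ x, η x • f x := by
  rw [inner_eq_integral]
  refine integral_congr_ae ?_
  filter_upwards [coeFn_rL2 h] with x hx
  rw [hx]
  simp

theorem norm_sq_eq_integral (f : OneParticle d) : ‖f‖ ^ 2 = ∫ x, ‖f x‖ ^ 2 := by
  have h := inner_self_eq_norm_sq_to_K (𝕜 := ℂ) f
  rw [inner_eq_integral] at h
  have h2 : ∫ x, starRingEnd ℂ (f x) * f x = ((∫ x, ‖f x‖ ^ 2 : ℝ) : ℂ) := by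
    rw [← integral_complex_ofReal]
    refine integral_congr_ae (Eventually.of_forall fun x => ?_)
    simp only
    rw [mul_comm, Complex.mul_conj, Complex.normSq_eq_norm_sq]
  rw [h2] at h
  refine Complex.ofReal_injective ?_
  rw [h]
  push_cast
  rfl

theorem integrable_norm_sq (f : OneParticle d) : Integrable (fun x => ‖f x‖ ^ 2) :=
  (memLp_two_iff_integrable_sq_norm (Lp.memLp f).1).1 (Lp.memLp f)

theorem norm_le_of_ae_le {f g : OneParticle d} (h : ∀ᵐ x, ‖f x‖ ≤ ‖g x‖) : ‖f‖ ≤ ‖g‖ :=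
  Lp.norm_le_norm_of_ae_le h

/-- Dominated convergence in `L²`. -/
theorem tendsto_toL2 {ι : Type*} {l : Filter ι} [l.IsCountablyGenerated]
    {F : ι → Space d → ℂ} {f : Space d → ℂ} {b : Space d → ℝ}
    (hF : ∀ᶠ i in l, AEStronglyMeasurable (F i) volume) (hf : AEStronglyMeasurable f volume)
    (hb : MemLp b 2 volume)
    (hbd : ∀ᶠ i in l, ∀ᵐ x, ‖F i x‖ ≤ b x) (hfb : ∀ᵐ x, ‖f x‖ ≤ b x)
    (hlim : ∀ᵐ x, Tendsto (fun i => F i x) l (𝓝 (f x))) :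
    Tendsto (fun i => toL2 (F i)) l (𝓝 (toL2 f)) := by
  have hfm : MemLp f 2 volume := hb.mono' hf hfb
  have hFm : ∀ᶠ i in l, MemLp (F i) 2 volume := by
    filter_upwards [hF, hbd] with i h1 h2
    exact hb.mono' h1 h2
  rw [tendsto_iff_norm_sub_tendsto_zero]
  have key : Tendsto (fun i => ∫ x, ‖F i x - f x‖ ^ 2) l (𝓝 (∫ _ : Space d, (0 : ℝ))) := by
    refine tendsto_integral_filter_of_dominated_convergence (fun x => (2 * b x) ^ 2) ?_ ?_ ?_ ?_
    · filter_upwards [hF] with i hi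
      exact ((hi.sub hf).norm).pow 2
    · filter_upwards [hbd] with i hi
      filter_upwards [hi, hfb] with x h1 h2
      rw [Real.norm_of_nonneg (by positivity)]
      refine pow_le_pow_left₀ (norm_nonneg _) ?_ 2
      calc ‖F i x - f x‖ ≤ ‖F i x‖ + ‖f x‖ := norm_sub_le _ _
        _ ≤ 2 * b x := by linarith
    · have := (hb.const_mul 2).integrable_sq
      exact this
    · filter_upwards [hlim] with x hx
      have h1 := (hx.sub_const (f x)).norm.pow 2
      simpa using h1
  rw [integral_zero] at key
  have key2 := key.sqrt
  rw [Real.sqrt_zero] at key2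
  refine key2.congr' ?_
  filter_upwards [hFm] with i hi
  rw [← Real.sqrt_sq (norm_nonneg (toL2 (F i) - toL2 f)), norm_sq_eq_integral]
  congr 1
  refine integral_congr_ae ?_
  filter_upwards [coeFn_toL2 hi, coeFn_toL2 hfm, Lp.coeFn_sub (toL2 (F i)) (toL2 f)] with x h1 h2 h3
  rw [h3, Pi.sub_apply, h1, h2]

/-! ### Multiplication operators -/

theorem memLp_smul_of_bound {m : Space d → ℝ} (hm : AEStronglyMeasurable m volume) {C : ℝ}
    (hC : ∀ᵐ x, ‖m x‖ ≤ C) (f : OneParticle d) : MemLp (fun x => m x • f x) 2 volume := by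
  refine MemLp.of_le_mul (c := C) (Lp.memLp f) (hm.smul (Lp.memLp f).1) ?_
  filter_upwards [hC] with x hx
  rw [norm_smul]
  exact mul_le_mul_of_nonneg_right hx (norm_nonneg _)

/-- Multiplication by an (essentially) bounded measurable real function, as an operator on `L²`;
`0` if the function is not of this kind. -/
def mulOp (m : Space d → ℝ) : OneParticle d →L[ℂ] OneParticle d :=
  open Classical in
  if h : AEStronglyMeasurable m volume ∧ ∃ C : ℝ, ∀ᵐ x, ‖m x‖ ≤ C then
    LinearMap.mkContinuousOfExistsBound
      { toFun := fun f => toL2 (fun x => m x • f x)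
        map_add' := fun f g => by
          have hm := memLp_smul_of_bound h.1 h.2.choose_spec
          refine Lp.ext ?_
          filter_upwards [Lp.coeFn_add f g, coeFn_toL2 (hm f), coeFn_toL2 (hm g),
            coeFn_toL2 (hm (f + g)), Lp.coeFn_add (toL2 (fun x => m x • f x))
              (toL2 (fun x => m x • g x))] with x h1 h2 h3 h4 h5
          rw [h4, h5, Pi.add_apply, h1, h2, h3, Pi.add_apply, smul_add]
        map_smul' := fun c f => by
          have hm := memLp_smul_of_bound h.1 h.2.choose_spec
          refine Lp.ext ?_
          filter_upwards [Lp.coeFn_smul c f, coeFn_toL2 (hm f), coeFn_toL2 (hm (c • f)),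
            Lp.coeFn_smul c (toL2 (fun x => m x • f x))] with x h1 h2 h3 h4
          rw [RingHom.id_apply, h3, h4, Pi.smul_apply, h1, h2, Pi.smul_apply, smul_comm] }
      ⟨h.2.choose, fun f => by
        refine Lp.norm_le_mul_norm_of_ae_le_mul ?_
        filter_upwards [h.2.choose_spec,
          coeFn_toL2 (memLp_smul_of_bound h.1 h.2.choose_spec f)] with x hx h2
        change ‖toL2 (fun x => m x • f x) x‖ ≤ _
        rw [h2, norm_smul]
        exact mul_le_mul_of_nonneg_right hx (norm_nonneg _)⟩
  else 0

theorem coeFn_mulOp {m : Space d → ℝ} (hm : AEStronglyMeasurable m volume) {C : ℝ}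
    (hC : ∀ᵐ x, ‖m x‖ ≤ C) (f : OneParticle d) :
    mulOp m f =ᵐ[volume] fun x => m x • f x := by
  have h : AEStronglyMeasurable m volume ∧ ∃ C : ℝ, ∀ᵐ x, ‖m x‖ ≤ C := ⟨hm, C, hC⟩
  rw [mulOp, dif_pos h]
  exact coeFn_toL2 (memLp_smul_of_bound hm hC f)

/-! ### Test functions -/

/-- Smooth compactly supported real functions. -/
def IsTest (η : Space d → ℝ) : Prop := ContDiff ℝ (⊤ : ℕ∞) η ∧ HasCompactSupport η

theorem IsTest.continuous {η : Space d → ℝ} (h : IsTest η) : Continuous η := h.1.continuous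

theorem IsTest.differentiable {η : Space d → ℝ} (h : IsTest η) : Differentiable ℝ η :=
  h.1.differentiable (by simp)

theorem IsTest.memLp {η : Space d → ℝ} (h : IsTest η) (p : ℝ≥0∞) : MemLp η p volume :=
  h.continuous.memLp_of_hasCompactSupport h.2

theorem IsTest.integrable {η : Space d → ℝ} (h : IsTest η) : Integrable η :=
  h.continuous.integrable_of_hasCompactSupport h.2

theorem IsTest.exists_bound {η : Space d → ℝ} (h : IsTest η) : ∃ C : ℝ, ∀ x, |η x| ≤ C := by
  obtain ⟨C, hC⟩ := h.2.exists_bound_of_continuous h.continuous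
  exact ⟨C, hC⟩

theorem IsTest.partialDeriv {η : Space d → ℝ} (h : IsTest η) (i : Fin d) :
    IsTest (partialDeriv i η) := by
  refine ⟨?_, ?_⟩
  · have h1 : ContDiff ℝ (⊤ : ℕ∞) (fderiv ℝ η) := h.1.fderiv_right (by simp)
    exact h1.clm_apply contDiff_const
  · exact h.2.fderiv_apply (𝕜 := ℝ) _

theorem IsTest.comp_add {η : Space d → ℝ} (h : IsTest η) (a : Space d) :
    IsTest (fun x => η (x + a)) := by
  refine ⟨h.1.comp (contDiff_id.add contDiff_const), ?_⟩
  exact h.2.comp_homeomorph (Homeomorph.addRight a)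

theorem partialDeriv_comp_add (η : Space d → ℝ) (a : Space d) (i : Fin d) (x : Space d) :
    partialDeriv i (fun x => η (x + a)) x = partialDeriv i η (x + a) := by
  rw [Counterterm.partialDeriv, Counterterm.partialDeriv, fderiv_comp_add_right]

theorem eq_of_forall_inner_test {f g : OneParticle d}
    (h : ∀ η : Space d → ℝ, IsTest η → inner ℂ (rL2 η) f = inner ℂ (rL2 η) g) : f = g := by
  refine Lp.ext (ae_eq_of_integral_contDiff_smul_eq ((Lp.memLp f).locallyIntegrable (by norm_num))
    ((Lp.memLp g).locallyIntegrable (by norm_num)) fun η h1 h2 => ?_)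
  have hη : IsTest η := ⟨h1, h2⟩
  rw [← inner_rL2 (hη.memLp 2), ← inner_rL2 (hη.memLp 2)]
  exact h η hη

theorem hasWeakGradient_iff {f : OneParticle d} {F : Fin d → OneParticle d} :
    HasWeakGradient f F ↔ ∀ (i : Fin d) (η : Space d → ℝ), IsTest η →
      inner ℂ (rL2 (partialDeriv i η)) f = - inner ℂ (rL2 η) (F i) := by
  constructor
  · intro h i η hη
    rw [inner_rL2 ((hη.partialDeriv i).memLp 2), inner_rL2 (hη.memLp 2)]
    exact h i η hη.1 hη.2
  · intro h i η h1 h2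
    have hη : IsTest η := ⟨h1, h2⟩
    have := h i η hη
    rwa [inner_rL2 ((hη.partialDeriv i).memLp 2), inner_rL2 (hη.memLp 2)] at this

end

section

/-! ### The Schrödinger operator by its quadratic form -/

/-- A measurable potential bounded below by a positive constant. -/
structure IsCoercive (κ : ℝ) (U : Space d → ℝ) : Prop where
  pos : 0 < κ
  meas : AEStronglyMeasurable U volume
  le : ∀ᵐ x, κ ≤ U x

/-- Pairs of a gradient (components `some i`) and a square-integrable function
(component `none`, standing for `√U f`). -/
abbrev EnergySpace (d : ℕ) := PiLp 2 (fun _ : Option (Fin d) => OneParticle d)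

/-- The form domain of `-Δ + U`, as the closed subspace of the pairs `(√U f, ∇f)`; its inner
product is the quadratic form. The function `f` is recovered by multiplication with the bounded
function `1 / √U`, for `U` bounded below by a positive constant. -/
def formSpace (U : Space d → ℝ) : Submodule ℂ (EnergySpace d) where
  carrier := {z | HasWeakGradient (mulOp (fun x => (√(U x))⁻¹) (z none)) (fun i => z (some i))}
  add_mem' {a b} ha hb := by
    simp only [mem_ofPred_eq, hasWeakGradient_iff] at *
    intro i η hη
    rw [PiLp.add_apply, PiLp.add_apply, map_add, inner_add_right, inner_add_right, ha i η hη,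
      hb i η hη]
    ring
  zero_mem' := by
    simp only [mem_ofPred_eq, hasWeakGradient_iff]
    intro i η hη
    simp
  smul_mem' c a ha := by
    simp only [mem_ofPred_eq, hasWeakGradient_iff] at *
    intro i η hη
    rw [PiLp.smul_apply, PiLp.smul_apply, map_smul, inner_smul_right, inner_smul_right, ha i η hη]
    ring

theorem mem_formSpace {U : Space d → ℝ} {z : EnergySpace d} : z ∈ formSpace U ↔
    HasWeakGradient (mulOp (fun x => (√(U x))⁻¹) (z none)) (fun i => z (some i)) := Iff.rfl

theorem isClosed_formSpace (U : Space d → ℝ) : IsClosed (formSpace U : Set (EnergySpace d)) := by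
  have h : (formSpace U : Set (EnergySpace d)) = ⋂ (i : Fin d), ⋂ (η : Space d → ℝ),
      ⋂ (_ : IsTest η), {z | inner ℂ (rL2 (partialDeriv i η)) (mulOp (fun x => (√(U x))⁻¹) (z none))
        = - inner ℂ (rL2 η) (z (some i))} := by
    ext z
    simp only [SetLike.mem_coe, mem_formSpace, hasWeakGradient_iff, mem_iInter, mem_ofPred_eq]
  rw [h]
  refine isClosed_iInter fun i => isClosed_iInter fun η => isClosed_iInter fun _ => ?_
  refine isClosed_eq ?_ ?_ <;> fun_prop

/-- The form domain as a Hilbert space in its own right. -/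
def FormDomain (U : Space d → ℝ) : Type := formSpace U

instance (U : Space d → ℝ) : NormedAddCommGroup (FormDomain U) :=
  inferInstanceAs (NormedAddCommGroup (formSpace U))

instance (U : Space d → ℝ) : InnerProductSpace ℂ (FormDomain U) :=
  inferInstanceAs (InnerProductSpace ℂ (formSpace U))

instance (U : Space d → ℝ) : CompleteSpace (FormDomain U) :=
  (isClosed_formSpace U).completeSpace_coe

/-- The component `√U f` of an element of the form domain. -/
def potPart {U : Space d → ℝ} (z : FormDomain U) : OneParticle d := (z.1 : EnergySpace d) none

/-- The gradient of an element of the form domain. -/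
def gradPart {U : Space d → ℝ} (z : FormDomain U) (i : Fin d) : OneParticle d :=
  (z.1 : EnergySpace d) (some i)

/-- The embedding of the form domain into `L²`. -/
def formEmbed (U : Space d → ℝ) : FormDomain U →L[ℂ] OneParticle d :=
  (mulOp (fun x => (√(U x))⁻¹)).comp
    ((PiLp.proj 2 (fun _ : Option (Fin d) => OneParticle d) none).comp (formSpace U).subtypeL)

theorem formEmbed_apply (U : Space d → ℝ) (z : FormDomain U) :
    formEmbed U z = mulOp (fun x => (√(U x))⁻¹) (potPart z) := rfl

theorem inner_formDomain {U : Space d → ℝ} (z y : FormDomain U) : inner ℂ z y =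
    ∑ i, inner ℂ (gradPart z i) (gradPart y i) + inner ℂ (potPart z) (potPart y) := by
  have h : inner ℂ z y = inner ℂ (z.1 : EnergySpace d) (y.1 : EnergySpace d) := rfl
  rw [h, PiLp.inner_apply, Fintype.sum_option, add_comm]
  rfl

theorem norm_sq_formDomain {U : Space d → ℝ} (z : FormDomain U) : ‖z‖ ^ 2 =
    ∑ i, ‖gradPart z i‖ ^ 2 + ‖potPart z‖ ^ 2 := by
  have h : ‖z‖ = ‖(z.1 : EnergySpace d)‖ := rfl
  rw [h, PiLp.norm_sq_eq_of_L2, Fintype.sum_option, add_comm]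
  rfl

/-- The bounded inverse of `-Δ + U`: by Riesz representation, it is the embedding of the
form domain composed with its adjoint. -/
def schrodingerInv (U : Space d → ℝ) : OneParticle d →L[ℂ] OneParticle d :=
  (formEmbed U).comp (ContinuousLinearMap.adjoint (formEmbed U))

theorem schrodingerInv_apply (U : Space d → ℝ) (g : OneParticle d) :
    schrodingerInv U g = formEmbed U (ContinuousLinearMap.adjoint (formEmbed U) g) := rfl

theorem inner_schrodingerInv (U : Space d → ℝ) (f g : OneParticle d) :
    inner ℂ f (schrodingerInv U g) = inner ℂ (ContinuousLinearMap.adjoint (formEmbed U) f)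
      (ContinuousLinearMap.adjoint (formEmbed U) g) := by
  rw [schrodingerInv_apply, ← ContinuousLinearMap.adjoint_inner_left]

theorem isPositive_schrodingerInv (U : Space d → ℝ) : (schrodingerInv U).IsPositive :=
  ContinuousLinearMap.isPositive_self_comp_adjoint (formEmbed U)

theorem isSelfAdjoint_schrodingerInv (U : Space d → ℝ) : IsSelfAdjoint (schrodingerInv U) :=
  (isPositive_schrodingerInv U).isSelfAdjoint

section Coercive

variable {κ : ℝ} {U : Space d → ℝ}

theorem IsCoercive.aemeas_sqrt (hU : IsCoercive κ U) :
    AEStronglyMeasurable (fun x => √(U x)) volume :=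
  Real.continuous_sqrt.comp_aestronglyMeasurable hU.meas

theorem IsCoercive.sqrt_pos (hU : IsCoercive κ U) : ∀ᵐ x, 0 < √(U x) := by
  filter_upwards [hU.le] with x hx
  exact Real.sqrt_pos.2 (hU.pos.trans_le hx)

theorem IsCoercive.coeFn_mulOp (hU : IsCoercive κ U) (f : OneParticle d) :
    mulOp (fun x => (√(U x))⁻¹) f =ᵐ[volume] fun x => (√(U x))⁻¹ • f x := by
  refine Counterterm.coeFn_mulOp (C := (√κ)⁻¹) (hU.aemeas_sqrt.inv₀) ?_ f
  filter_upwards [hU.le] with x hx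
  rw [Pi.inv_apply, Real.norm_of_nonneg (inv_nonneg.2 (Real.sqrt_nonneg _))]
  exact inv_anti₀ (Real.sqrt_pos.2 hU.pos) (Real.sqrt_le_sqrt hx)

theorem IsCoercive.coeFn_none (hU : IsCoercive κ U) (z : FormDomain U) :
    potPart z =ᵐ[volume] fun x => √(U x) • formEmbed U z x := by
  filter_upwards [hU.coeFn_mulOp (potPart z), hU.sqrt_pos] with x hx h0
  rw [formEmbed_apply, hx, smul_inv_smul₀ h0.ne']

theorem finitePotentialEnergy_formEmbed (hU : IsCoercive κ U) (z : FormDomain U) :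
    FinitePotentialEnergy U (formEmbed U z) := by
  refine (integrable_norm_sq (potPart z)).congr ?_
  filter_upwards [hU.coeFn_none z, hU.le] with x hx h0
  rw [hx, norm_smul, mul_pow, Real.norm_of_nonneg (Real.sqrt_nonneg _),
    Real.sq_sqrt (hU.pos.le.trans h0)]

theorem hasWeakGradient_formEmbed (z : FormDomain U) :
    HasWeakGradient (formEmbed U z) (fun i => gradPart z i) := z.2

theorem exists_formDomain (hU : IsCoercive κ U) {f : OneParticle d} {F : Fin d → OneParticle d}
    (hF : HasWeakGradient f F) (hf : FinitePotentialEnergy U f) :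
    ∃ z : FormDomain U, formEmbed U z = f ∧ ∀ i, gradPart z i = F i := by
  have hm : MemLp (fun x => √(U x) • f x) 2 volume := by
    refine (memLp_two_iff_integrable_sq_norm (hU.aemeas_sqrt.smul (Lp.memLp f).1)).2 ?_
    refine hf.congr ?_
    filter_upwards [hU.le] with x h0
    rw [Pi.smul_apply', norm_smul, mul_pow, Real.norm_of_nonneg (Real.sqrt_nonneg _),
      Real.sq_sqrt (hU.pos.le.trans h0)]
  have hfe : mulOp (fun x => (√(U x))⁻¹) (toL2 (fun x => √(U x) • f x)) = f := by
    refine Lp.ext ?_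
    filter_upwards [hU.coeFn_mulOp (toL2 (fun x => √(U x) • f x)), coeFn_toL2 hm,
      hU.sqrt_pos] with x h1 h2 h3
    rw [h1, h2, inv_smul_smul₀ h3.ne']
  let z : EnergySpace d := WithLp.toLp 2 (fun o => o.elim (toL2 (fun x => √(U x) • f x)) F)
  have hz : z ∈ formSpace U := by
    rw [mem_formSpace]
    change HasWeakGradient (mulOp (fun x => (√(U x))⁻¹) (toL2 (fun x => √(U x) • f x))) F
    rwa [hfe]
  exact ⟨⟨z, hz⟩, hfe, fun i => rfl⟩

theorem inner_form_eq (hU : IsCoercive κ U) (z y : FormDomain U) :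
    inner ℂ z y = ∑ i, inner ℂ (gradPart z i) (gradPart y i) +
      ∫ x, (U x : ℂ) * (starRingEnd ℂ (formEmbed U z x) * formEmbed U y x) := by
  rw [inner_formDomain]
  congr 1
  rw [inner_eq_integral]
  refine integral_congr_ae ?_
  filter_upwards [hU.coeFn_none z, hU.coeFn_none y, hU.le] with x h1 h2 h3
  rw [h1, h2]
  have h4 : ((√(U x) : ℝ) : ℂ) * ((√(U x) : ℝ) : ℂ) = (U x : ℂ) := by
    rw [← Complex.ofReal_mul, Real.mul_self_sqrt (hU.pos.le.trans h3)]
  simp only [Complex.real_smul, map_mul, Complex.conj_ofReal]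
  rw [← h4]
  ring

theorem norm_sq_form_eq (hU : IsCoercive κ U) (z : FormDomain U) :
    ‖z‖ ^ 2 = ∑ i, ‖gradPart z i‖ ^ 2 + ∫ x, U x * ‖formEmbed U z x‖ ^ 2 := by
  rw [norm_sq_formDomain]
  congr 1
  rw [norm_sq_eq_integral]
  refine integral_congr_ae ?_
  filter_upwards [hU.coeFn_none z, hU.le] with x h1 h3
  rw [h1, norm_smul, mul_pow, Real.norm_of_nonneg (Real.sqrt_nonneg _),
    Real.sq_sqrt (hU.pos.le.trans h3)]

/-- Both directions are the weak form of the equation, read in the form domain. -/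
theorem isSchrodingerInverse_schrodingerInv (hU : IsCoercive κ U) :
    IsSchrodingerInverse U (schrodingerInv U) := by
  intro f g
  constructor
  · rintro rfl
    set z := ContinuousLinearMap.adjoint (formEmbed U) g with hz
    refine ⟨fun i => gradPart z i, hasWeakGradient_formEmbed z,
      finitePotentialEnergy_formEmbed hU z, fun φ Φ hΦ hφ => ?_⟩
    obtain ⟨y, hy, hyF⟩ := exists_formDomain hU hΦ hφ
    have h := inner_form_eq hU y z
    simp only [hyF, hy] at h
    rw [schrodingerInv_apply, ← hz, ← h, hz, ContinuousLinearMap.adjoint_inner_right, hy]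
  · rintro ⟨F, hF, hf, h⟩
    obtain ⟨z, hz, hzF⟩ := exists_formDomain hU hF hf
    have h2 : z = ContinuousLinearMap.adjoint (formEmbed U) g := by
      refine ext_inner_left ℂ fun y => ?_
      rw [ContinuousLinearMap.adjoint_inner_right,
        ← h _ _ (hasWeakGradient_formEmbed y) (finitePotentialEnergy_formEmbed hU y),
        inner_form_eq hU]
      simp only [hz, hzF]
    rw [schrodingerInv_apply, ← h2, hz]

theorem IsSchrodingerInverse.eq {R : OneParticle d →L[ℂ] OneParticle d} (hU : IsCoercive κ U)
    (h : IsSchrodingerInverse U R) : R = schrodingerInv U := by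
  ext1 g
  exact (h _ g).2 ((isSchrodingerInverse_schrodingerInv hU _ g).1 rfl)

theorem schrodingerEq_schrodingerInv (hU : IsCoercive κ U) (g : OneParticle d) :
    SchrodingerEq U (schrodingerInv U g) g :=
  (isSchrodingerInverse_schrodingerInv hU _ g).1 rfl

theorem norm_formEmbed_le (hU : IsCoercive κ U) (z : FormDomain U) :
    κ * ‖formEmbed U z‖ ^ 2 ≤ ‖z‖ ^ 2 := by
  rw [norm_sq_form_eq hU, norm_sq_eq_integral, ← integral_const_mul]
  have h : ∫ x, κ * ‖formEmbed U z x‖ ^ 2 ≤ ∫ x, U x * ‖formEmbed U z x‖ ^ 2 := by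
    refine integral_mono_ae ((integrable_norm_sq _).const_mul _)
      (finitePotentialEnergy_formEmbed hU z) ?_
    filter_upwards [hU.le] with x hx
    exact mul_le_mul_of_nonneg_right hx (by positivity)
  have h2 : 0 ≤ ∑ i, ‖gradPart z i‖ ^ 2 :=
    Finset.sum_nonneg fun i _ => by positivity
  linarith

theorem norm_schrodingerInv_le (hU : IsCoercive κ U) : ‖schrodingerInv U‖ ≤ κ⁻¹ := by
  refine ContinuousLinearMap.opNorm_le_bound _ (inv_nonneg.2 hU.pos.le) fun g => ?_
  set z := ContinuousLinearMap.adjoint (formEmbed U) g with hz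
  have h1 := norm_formEmbed_le hU z
  have h2 : ‖z‖ ^ 2 ≤ ‖formEmbed U z‖ * ‖g‖ := by
    have h3 : (inner ℂ z z : ℂ) = inner ℂ (formEmbed U z) g := by
      conv_lhs => rw [hz, ContinuousLinearMap.adjoint_inner_right, ← hz]
    have h4 := norm_inner_le_norm (𝕜 := ℂ) (formEmbed U z) g
    rwa [← h3, inner_self_eq_norm_sq_to_K, norm_pow, RCLike.norm_ofReal, abs_norm] at h4
  rw [schrodingerInv_apply, ← hz]
  have h5 : κ * ‖formEmbed U z‖ ^ 2 ≤ ‖formEmbed U z‖ * ‖g‖ := h1.trans h2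
  rcases (norm_nonneg (formEmbed U z)).eq_or_lt with h0 | h0
  · rw [← h0]
    exact mul_nonneg (inv_nonneg.2 hU.pos.le) (norm_nonneg _)
  · rw [inv_mul_eq_div, le_div_iff₀ hU.pos]
    have : ‖formEmbed U z‖ * (κ * ‖formEmbed U z‖) ≤ ‖formEmbed U z‖ * ‖g‖ := by
      calc _ = κ * ‖formEmbed U z‖ ^ 2 := by ring
        _ ≤ _ := h5
    have := le_of_mul_le_mul_left this h0
    linarith

theorem sq_le_mul_sq_of_sq_le_mul {a b e c : ℝ} (hc : 0 ≤ c) (h3 : a ^ 2 ≤ e * b)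
    (hb : b ^ 2 ≤ c * a ^ 2) : a ^ 2 ≤ c * e ^ 2 := by
  have h6 : a ^ 2 * a ^ 2 ≤ a ^ 2 * (c * e ^ 2) := by
    calc a ^ 2 * a ^ 2 = (a ^ 2) ^ 2 := by ring
      _ ≤ (e * b) ^ 2 := pow_le_pow_left₀ (by positivity) h3 2
      _ = e ^ 2 * b ^ 2 := by ring
      _ ≤ e ^ 2 * (c * a ^ 2) := mul_le_mul_of_nonneg_left hb (by positivity)
      _ = _ := by ring
  rcases (sq_nonneg a).eq_or_lt with h0 | h0
  · rw [← h0]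
    positivity
  · exact le_of_mul_le_mul_left h6 h0

/-- A larger potential (up to a constant `c ≥ 1`) has a smaller inverse, in the form sense. -/
theorem inner_schrodingerInv_le {κ' c : ℝ} {U' : Space d → ℝ} (hU : IsCoercive κ U)
    (hU' : IsCoercive κ' U') (hc : 1 ≤ c) (hle : ∀ᵐ x, U x ≤ c * U' x) (g : OneParticle d) :
    (inner ℂ g (schrodingerInv U' g)).re ≤ c * (inner ℂ g (schrodingerInv U g)).re := by
  set z' := ContinuousLinearMap.adjoint (formEmbed U') g with hz'
  set z := ContinuousLinearMap.adjoint (formEmbed U) g with hz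
  have e1 : (inner ℂ g (schrodingerInv U' g)).re = ‖z'‖ ^ 2 := by
    rw [inner_schrodingerInv, ← hz', inner_self_eq_norm_sq_to_K]
    norm_cast
  have e2 : (inner ℂ g (schrodingerInv U g)).re = ‖z‖ ^ 2 := by
    rw [inner_schrodingerInv, ← hz, inner_self_eq_norm_sq_to_K]
    norm_cast
  rw [e1, e2]
  have hpot : FinitePotentialEnergy U (formEmbed U' z') := by
    refine ((finitePotentialEnergy_formEmbed hU' z').const_mul c).mono'
      (hU.meas.mul ((Lp.memLp _).1.norm.pow 2)) ?_
    filter_upwards [hle, hU.le] with x h1 h2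
    rw [Real.norm_of_nonneg (mul_nonneg (hU.pos.le.trans h2) (by positivity)), ← mul_assoc]
    exact mul_le_mul_of_nonneg_right h1 (by positivity)
  obtain ⟨y, hy, hyF⟩ := exists_formDomain hU (hasWeakGradient_formEmbed z') hpot
  have hyn : ‖y‖ ^ 2 ≤ c * ‖z'‖ ^ 2 := by
    rw [norm_sq_form_eq hU, norm_sq_form_eq hU', mul_add, ← integral_const_mul, hy]
    simp only [hyF]
    refine add_le_add (le_mul_of_one_le_left (Finset.sum_nonneg fun i _ => by positivity) hc) ?_
    refine integral_mono_ae hpot ((finitePotentialEnergy_formEmbed hU' z').const_mul c) ?_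
    filter_upwards [hle] with x h1
    rw [← mul_assoc]
    exact mul_le_mul_of_nonneg_right h1 (by positivity)
  have h3 : (‖z'‖ ^ 2 : ℝ) ≤ ‖z‖ * ‖y‖ := by
    have h4 : (inner ℂ z' z' : ℂ) = inner ℂ z y := by
      conv_lhs => rw [hz', ContinuousLinearMap.adjoint_inner_left]
      rw [hz, ContinuousLinearMap.adjoint_inner_left, hy]
    have h5 := norm_inner_le_norm (𝕜 := ℂ) z y
    rwa [← h4, inner_self_eq_norm_sq_to_K, norm_pow, RCLike.norm_ofReal, abs_norm] at h5
  exact sq_le_mul_sq_of_sq_le_mul (by linarith) h3 hyn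

theorem IsCoercive.add_const (hU : IsCoercive κ U) {l : ℝ} (hl : 0 ≤ l) :
    IsCoercive (κ + l) (fun x => U x + l) where
  pos := by linarith [hU.pos]
  meas := hU.meas.add aestronglyMeasurable_const
  le := by
    filter_upwards [hU.le] with x hx
    linarith

/-- Resolvent identity. -/
theorem schrodingerInv_add_const (hU : IsCoercive κ U) {l : ℝ} (hl : 0 ≤ l) :
    (schrodingerInv (fun x => U x + l)).comp (1 + (l : ℂ) • schrodingerInv U) =
      schrodingerInv U := by
  ext1 g
  have hUl := hU.add_const hl
  change schrodingerInv (fun x => U x + l) (g + (l : ℂ) • schrodingerInv U g) = _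
  refine (isSchrodingerInverse_schrodingerInv hUl _ _).2 ?_
  obtain ⟨F, hF, hf, h⟩ := schrodingerEq_schrodingerInv hU g
  set f := schrodingerInv U g with hfdef
  have hint : ∀ φ : OneParticle d, FinitePotentialEnergy (fun x => U x + l) φ →
      FinitePotentialEnergy U φ := by
    intro φ hφ
    refine (hφ.sub ((integrable_norm_sq φ).const_mul l)).congr (Eventually.of_forall fun x => ?_)
    simp only [Pi.sub_apply]
    ring
  refine ⟨F, hF, ?_, fun φ Φ hΦ hφ => ?_⟩
  · refine (hf.add ((integrable_norm_sq f).const_mul l)).congr (Eventually.of_forall fun x => ?_)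
    simp only [Pi.add_apply]
    ring
  · rw [inner_add_right, inner_smul_right, ← h φ Φ hΦ (hint φ hφ), inner_eq_integral φ f,
      ← integral_const_mul, add_assoc, ← integral_add]
    · congr 1
      refine integral_congr_ae (Eventually.of_forall fun x => ?_)
      simp only
      push_cast
      ring
    · have hm : AEStronglyMeasurable (fun x => (U x : ℂ) * (starRingEnd ℂ (φ x) * f x)) volume :=
        (Complex.continuous_ofReal.comp_aestronglyMeasurable hU.meas).mul
          (integrable_conj_mul φ f).1
      refine ((hint φ hφ).add hf).mono' hm ?_
      filter_upwards [hU.le] with x hx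
      have h0 : 0 ≤ U x := hU.pos.le.trans hx
      rw [norm_mul, norm_mul, Complex.norm_real, Real.norm_of_nonneg h0, RCLike.norm_conj,
        Pi.add_apply, ← mul_add]
      refine mul_le_mul_of_nonneg_left ?_ h0
      nlinarith [sq_nonneg (‖φ x‖ - ‖f x‖), sq_nonneg (‖φ x‖), sq_nonneg (‖f x‖)]
    · exact (integrable_conj_mul φ f).const_mul _

end Coercive

end

section

/-! ### The semigroup generated by a positive operator, from its inverse -/

section Semigroup

variable {𝓗 : Type*} [NormedAddCommGroup 𝓗] [InnerProductSpace ℂ 𝓗] [CompleteSpace 𝓗]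

/-- `exp (-t / s)`, extended by `0` to `s = 0`. -/
def heatFn (t s : ℝ) : ℝ := if s = 0 then 0 else Real.exp (-(t / s))

/-- `exp (-t / s) / s`, extended by `0` to `s = 0`. -/
def genFn (t s : ℝ) : ℝ := if s = 0 then 0 else s⁻¹ * Real.exp (-(t / s))

/-- The semigroup `exp (-t A)`, where `R = A⁻¹`; the identity for `t ≤ 0`. -/
def heatOp (R : 𝓗 →L[ℂ] 𝓗) (t : ℝ) : 𝓗 →L[ℂ] 𝓗 := if t ≤ 0 then 1 else cfc (heatFn t) R

/-- The operator `A exp (-t A)`, where `R = A⁻¹`. -/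
def genOp (R : 𝓗 →L[ℂ] 𝓗) (t : ℝ) : 𝓗 →L[ℂ] 𝓗 := cfc (genFn t) R

theorem heatOp_of_pos (R : 𝓗 →L[ℂ] 𝓗) {t : ℝ} (ht : 0 < t) : heatOp R t = cfc (heatFn t) R :=
  if_neg (not_le.2 ht)

theorem heatOp_zero (R : 𝓗 →L[ℂ] 𝓗) : heatOp R 0 = 1 := if_pos le_rfl

theorem genFn_le {t s : ℝ} (ht : 0 < t) (hs : 0 ≤ s) : genFn t s ≤ 2 * s / t ^ 2 := by
  rw [genFn]
  split_ifs with h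
  · positivity
  · have hs' : 0 < s := lt_of_le_of_ne hs (Ne.symm h)
    have h1 : (t / s) ^ 2 / 2 ≤ Real.exp (t / s) := by
      have := Real.quadratic_le_exp_of_nonneg (x := t / s) (by positivity)
      have h2 : 0 ≤ t / s := by positivity
      linarith
    rw [Real.exp_neg, ← mul_inv, inv_le_comm₀ (by positivity) (by positivity)]
    calc (2 * s / t ^ 2)⁻¹ = s * ((t / s) ^ 2 / 2) := by field_simp
      _ ≤ s * Real.exp (t / s) := by gcongr

theorem genFn_nonneg {t s : ℝ} (hs : 0 ≤ s) : 0 ≤ genFn t s := by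
  rw [genFn]
  split_ifs
  · exact le_rfl
  · positivity

theorem continuousOn_genFn {t : ℝ} (ht : 0 < t) : ContinuousOn (genFn t) (Ici 0) := by
  intro s hs
  by_cases h : s = 0
  · subst h
    have h0 : genFn t 0 = 0 := if_pos rfl
    rw [ContinuousWithinAt, h0]
    refine squeeze_zero' (g := fun s => 2 * s / t ^ 2) ?_ ?_ ?_
    · filter_upwards [self_mem_nhdsWithin] with s hs using genFn_nonneg hs
    · filter_upwards [self_mem_nhdsWithin] with s hs using genFn_le ht hs
    · have : ContinuousWithinAt (fun s : ℝ => 2 * s / t ^ 2) (Ici 0) 0 := by fun_prop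
      simpa [ContinuousWithinAt] using this
  · have h1 : ContinuousAt (fun s : ℝ => s⁻¹ * Real.exp (-(t / s))) s := by
      fun_prop (disch := assumption)
    refine (h1.congr ?_).continuousWithinAt
    filter_upwards [isOpen_ne.mem_nhds h] with s' hs'
    exact (if_neg hs').symm

theorem heatFn_eq_mul (t s : ℝ) : heatFn t s = s * genFn t s := by
  rw [heatFn, genFn]
  split_ifs with h
  · simp
  · rw [mul_inv_cancel_left₀ h]

theorem continuousOn_heatFn {t : ℝ} (ht : 0 < t) : ContinuousOn (heatFn t) (Ici 0) := by
  have : heatFn t = fun s => s * genFn t s := funext fun s => heatFn_eq_mul t s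
  rw [this]
  exact continuousOn_id.mul (continuousOn_genFn ht)

variable {R : 𝓗 →L[ℂ] 𝓗}

theorem spectrum_subset_Ici (hR : R.IsPositive) : spectrum ℝ R ⊆ Ici 0 := fun _ hx =>
  spectrum_nonneg_of_nonneg ((ContinuousLinearMap.nonneg_iff_isPositive R).2 hR) hx

theorem le_of_mem_spectrum {M : ℝ} (hM : ‖R‖ ≤ M) {x : ℝ} (hx : x ∈ spectrum ℝ R) : x ≤ M := by
  have h := spectrum.norm_le_norm_mul_of_mem hx
  have h1 : ‖(1 : 𝓗 →L[ℂ] 𝓗)‖ ≤ 1 := ContinuousLinearMap.norm_id_le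
  calc x ≤ ‖x‖ := Real.le_norm_self x
    _ ≤ ‖R‖ * ‖(1 : 𝓗 →L[ℂ] 𝓗)‖ := h
    _ ≤ ‖R‖ * 1 := by gcongr
    _ ≤ M := by linarith

theorem continuousOn_heatFn_spectrum (hR : R.IsPositive) {t : ℝ} (ht : 0 < t) :
    ContinuousOn (heatFn t) (spectrum ℝ R) :=
  (continuousOn_heatFn ht).mono (spectrum_subset_Ici hR)

theorem continuousOn_genFn_spectrum (hR : R.IsPositive) {t : ℝ} (ht : 0 < t) :
    ContinuousOn (genFn t) (spectrum ℝ R) :=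
  (continuousOn_genFn ht).mono (spectrum_subset_Ici hR)

theorem isSelfAdjoint_heatOp (R : 𝓗 →L[ℂ] 𝓗) (t : ℝ) : IsSelfAdjoint (heatOp R t) := by
  rw [heatOp]
  split_ifs
  · exact IsSelfAdjoint.one _
  · exact cfc_predicate _ _

theorem inner_comm_of_isSelfAdjoint {T : 𝓗 →L[ℂ] 𝓗} (hT : IsSelfAdjoint T) (f g : 𝓗) :
    inner ℂ (T f) g = inner ℂ f (T g) := by
  conv_rhs => rw [← hT.adjoint_eq]
  rw [ContinuousLinearMap.adjoint_inner_right]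

theorem heatOp_eq_mul_genOp (hR : R.IsPositive) {t : ℝ} (ht : 0 < t) :
    heatOp R t = R * genOp R t := by
  rw [heatOp_of_pos R ht, genOp]
  conv_rhs => rw [← cfc_id' ℝ R hR.isSelfAdjoint]
  rw [cfc_id' ℝ R hR.isSelfAdjoint]
  conv_rhs => arg 1; rw [← cfc_id' ℝ R hR.isSelfAdjoint]
  rw [← cfc_mul (fun x => x) (genFn t) R continuousOn_id (continuousOn_genFn_spectrum hR ht)]
  exact congrArg (fun f => cfc f R) (funext fun s => heatFn_eq_mul t s)

theorem heatOp_add (hR : R.IsPositive) {t s : ℝ} (ht : 0 ≤ t) (hs : 0 ≤ s) :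
    heatOp R (t + s) = heatOp R t * heatOp R s := by
  rcases ht.eq_or_lt with rfl | ht
  · rw [heatOp_zero, zero_add, one_mul]
  rcases hs.eq_or_lt with rfl | hs
  · rw [heatOp_zero, add_zero, mul_one]
  rw [heatOp_of_pos R ht, heatOp_of_pos R hs, heatOp_of_pos R (add_pos ht hs),
    ← cfc_mul (heatFn t) (heatFn s) R (continuousOn_heatFn_spectrum hR ht)
      (continuousOn_heatFn_spectrum hR hs)]
  refine congrArg (fun f => cfc f R) (funext fun x => ?_)
  simp only [heatFn]
  split_ifs with h
  · simp
  · rw [← Real.exp_add]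
    congr 1
    ring

theorem norm_heatOp_le (hR : R.IsPositive) {κ : ℝ} (hκ : 0 < κ) (hn : ‖R‖ ≤ κ⁻¹) {t : ℝ}
    (ht : 0 ≤ t) : ‖heatOp R t‖ ≤ Real.exp (-(κ * t)) := by
  rcases ht.eq_or_lt with rfl | ht
  · rw [heatOp_zero]
    simp only [mul_zero, neg_zero, Real.exp_zero]
    exact ContinuousLinearMap.norm_id_le
  rw [heatOp_of_pos R ht]
  refine norm_cfc_le (Real.exp_nonneg _) fun x hx => ?_
  have h0 : 0 ≤ x := spectrum_subset_Ici hR hx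
  have h1 : x ≤ κ⁻¹ := le_of_mem_spectrum hn hx
  rw [heatFn]
  split_ifs with h
  · simpa using Real.exp_nonneg _
  · rw [Real.norm_of_nonneg (Real.exp_nonneg _), Real.exp_le_exp, neg_le_neg_iff]
    have hx0 : 0 < x := lt_of_le_of_ne h0 (Ne.symm h)
    rw [le_div_iff₀ hx0]
    calc κ * t * x ≤ κ * t * κ⁻¹ := by gcongr
      _ = t := by field_simp

theorem norm_heatOp_le_one (hR : R.IsPositive) {t : ℝ} (ht : 0 ≤ t) : ‖heatOp R t‖ ≤ 1 := by
  rcases ht.eq_or_lt with rfl | ht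
  · rw [heatOp_zero]
    exact ContinuousLinearMap.norm_id_le
  rw [heatOp_of_pos R ht]
  refine norm_cfc_le zero_le_one fun x hx => ?_
  have h0 : 0 ≤ x := spectrum_subset_Ici hR hx
  rw [heatFn]
  split_ifs with h
  · simp
  · rw [Real.norm_of_nonneg (Real.exp_nonneg _), Real.exp_le_one_iff, neg_nonpos]
    positivity

theorem abs_heatFn_add_sub_le {t h s : ℝ} (ht : 0 < t) (hh : |h| ≤ t / 2) (hs : 0 ≤ s) :
    |heatFn (t + h) s - heatFn t s + h * genFn t s| ≤ 8 / t ^ 2 * h ^ 2 := by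
  simp only [heatFn, genFn]
  split_ifs with h0
  · simp only [sub_self, mul_zero, add_zero, abs_zero]
    positivity
  · have hs' : 0 < s := lt_of_le_of_ne hs (Ne.symm h0)
    have e1 : Real.exp (-((t + h) / s)) - Real.exp (-(t / s)) + h * (s⁻¹ * Real.exp (-(t / s))) =
        Real.exp (-(t / s)) * (Real.exp (-(h / s)) - 1 - (-(h / s))) := by
      have : Real.exp (-((t + h) / s)) = Real.exp (-(t / s)) * Real.exp (-(h / s)) := by
        rw [← Real.exp_add]
        congr 1
        ring
      rw [this]
      ring
    have e2 : |Real.exp (-(h / s)) - 1 - (-(h / s))| ≤ (h / s) ^ 2 * Real.exp (t / 2 / s) := by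
      have h2 := Complex.norm_exp_sub_sum_le_norm_mul_exp ((-(h / s) : ℝ) : ℂ) 2
      rw [Finset.sum_range_succ, Finset.sum_range_one] at h2
      simp only [pow_zero, Nat.factorial_zero, Nat.cast_one, div_one, pow_one,
        Nat.factorial_one] at h2
      rw [← Complex.ofReal_exp, ← Complex.ofReal_one, ← Complex.ofReal_add, ← Complex.ofReal_sub,
        Complex.norm_real, Complex.norm_real, Real.norm_eq_abs, Real.norm_eq_abs, sq_abs,
        neg_sq, abs_neg, abs_div, abs_of_pos hs'] at h2
      rw [sub_sub]
      refine h2.trans ?_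
      gcongr
    have e3 : (t / 2 / s) ^ 2 / 2 ≤ Real.exp (t / 2 / s) := by
      have := Real.quadratic_le_exp_of_nonneg (x := t / 2 / s) (by positivity)
      have h2 : 0 ≤ t / 2 / s := by positivity
      linarith
    rw [e1, abs_mul, abs_of_pos (Real.exp_pos _)]
    have e4 : Real.exp (-(t / s)) * Real.exp (t / 2 / s) = (Real.exp (t / 2 / s))⁻¹ := by
      rw [← Real.exp_neg, ← Real.exp_add]
      congr 1
      ring
    calc Real.exp (-(t / s)) * |Real.exp (-(h / s)) - 1 - (-(h / s))|
        ≤ Real.exp (-(t / s)) * ((h / s) ^ 2 * Real.exp (t / 2 / s)) := by gcongr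
      _ = (h / s) ^ 2 * (Real.exp (t / 2 / s))⁻¹ := by rw [← e4]; ring
      _ ≤ (h / s) ^ 2 * ((t / 2 / s) ^ 2 / 2)⁻¹ := by gcongr
      _ = 8 / t ^ 2 * h ^ 2 := by field_simp; ring

/-- In operator norm, because of the uniform second order estimate `abs_heatFn_add_sub_le` on the
spectrum. -/
theorem hasDerivAt_heatOp (hR : R.IsPositive) {t : ℝ} (ht : 0 < t) :
    HasDerivAt (heatOp R) (-genOp R t) t := by
  rw [hasDerivAt_iff_isLittleO_nhds_zero]
  have hbig : (fun h : ℝ => heatOp R (t + h) - heatOp R t - h • -genOp R t) =O[𝓝 0]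
      fun h : ℝ => h ^ 2 := by
    refine Asymptotics.IsBigO.of_bound (8 / t ^ 2) ?_
    have hev : ∀ᶠ h : ℝ in 𝓝 0, |h| < t / 2 := by
      have : Tendsto (fun h : ℝ => |h|) (𝓝 0) (𝓝 0) := by
        simpa using (continuous_abs.tendsto (0 : ℝ))
      exact this.eventually (gt_mem_nhds (by positivity))
    filter_upwards [hev] with h hh
    have hth : 0 < t + h := by
      have := (abs_lt.1 hh).1
      linarith
    rw [smul_neg, sub_neg_eq_add, heatOp_of_pos R ht, heatOp_of_pos R hth, genOp,
      ← cfc_sub (heatFn (t + h)) (heatFn t) R (continuousOn_heatFn_spectrum hR hth)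
        (continuousOn_heatFn_spectrum hR ht),
      ← cfc_smul h (genFn t) R (continuousOn_genFn_spectrum hR ht),
      ← cfc_add R (fun x => heatFn (t + h) x - heatFn t x) (fun x => h • genFn t x)
        ((continuousOn_heatFn_spectrum hR hth).sub (continuousOn_heatFn_spectrum hR ht))
        ((continuousOn_genFn_spectrum hR ht).const_smul h)]
    rw [Real.norm_of_nonneg (sq_nonneg h)]
    refine norm_cfc_le (by positivity) fun x hx => ?_
    exact abs_heatFn_add_sub_le ht hh.le (spectrum_subset_Ici hR hx)
  refine hbig.trans_isLittleO ?_
  simpa using Asymptotics.isLittleO_pow_id (𝕜 := ℝ) (n := 2) (by norm_num)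

theorem norm_heatOp_mul_sub_le (hR : R.IsPositive) {t : ℝ} (ht : 0 ≤ t) :
    ‖heatOp R t * R - R‖ ≤ t := by
  rcases ht.eq_or_lt with rfl | ht
  · rw [heatOp_zero, one_mul, sub_self, norm_zero]
  have h1 : heatOp R t * R - R = cfc (fun x => heatFn t x * x - x) R := by
    rw [cfc_sub (fun x => heatFn t x * x) (fun x => x) R
      ((continuousOn_heatFn_spectrum hR ht).mul continuousOn_id) continuousOn_id,
      cfc_mul (heatFn t) (fun x => x) R (continuousOn_heatFn_spectrum hR ht) continuousOn_id,
      cfc_id' ℝ R hR.isSelfAdjoint, heatOp_of_pos R ht]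
  rw [h1]
  refine norm_cfc_le ht.le fun x hx => ?_
  have h0 : 0 ≤ x := spectrum_subset_Ici hR hx
  simp only [heatFn]
  split_ifs with h
  · subst h
    simpa using ht.le
  · have hx0 : 0 < x := lt_of_le_of_ne h0 (Ne.symm h)
    have h2 : 1 - t / x ≤ Real.exp (-(t / x)) := by
      have := Real.add_one_le_exp (-(t / x))
      linarith
    have h3 : Real.exp (-(t / x)) ≤ 1 := by
      rw [Real.exp_le_one_iff, neg_nonpos]
      positivity
    rw [Real.norm_eq_abs, abs_le]
    constructor
    · have : (1 - t / x) * x ≤ Real.exp (-(t / x)) * x := by gcongr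
      have e : (1 - t / x) * x = x - t := by field_simp
      linarith
    · nlinarith

/-- Strong continuity at time `0` is clear on the range of `R`, and this range is dense. -/
theorem tendsto_heatOp_zero (hR : R.IsPositive) (hd : DenseRange R) (f : 𝓗) :
    Tendsto (fun t => heatOp R t f) (𝓝[≥] 0) (𝓝 f) := by
  rw [Metric.tendsto_nhdsWithin_nhds]
  intro ε hε
  obtain ⟨g, hg⟩ := hd.exists_dist_lt f (show (0 : ℝ) < ε / 3 by positivity)
  refine ⟨ε / 3 / (‖g‖ + 1), by positivity, fun t ht htd => ?_⟩
  have ht0 : 0 ≤ t := ht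
  rw [Real.dist_eq, sub_zero, abs_of_nonneg ht0] at htd
  rw [dist_eq_norm] at hg ⊢
  have e : heatOp R t f - f = heatOp R t (f - R g) + (heatOp R t * R - R) g + -(f - R g) := by
    rw [map_sub]
    simp only [_root_.sub_apply, mul_apply_eq_comp]
    abel
  rw [e]
  have h1 : ‖heatOp R t (f - R g)‖ ≤ ‖f - R g‖ := by
    calc _ ≤ ‖heatOp R t‖ * ‖f - R g‖ := ContinuousLinearMap.le_opNorm _ _
      _ ≤ 1 * ‖f - R g‖ := by gcongr; exact norm_heatOp_le_one hR ht0
      _ = _ := one_mul _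
  have h2 : ‖(heatOp R t * R - R) g‖ ≤ t * ‖g‖ := by
    calc _ ≤ ‖heatOp R t * R - R‖ * ‖g‖ := ContinuousLinearMap.le_opNorm _ _
      _ ≤ t * ‖g‖ := by gcongr; exact norm_heatOp_mul_sub_le hR ht0
  have h3 : t * ‖g‖ < ε / 3 := by
    have h4 : t * (‖g‖ + 1) < ε / 3 := by rwa [lt_div_iff₀ (by positivity)] at htd
    nlinarith
  calc _ ≤ ‖heatOp R t (f - R g) + (heatOp R t * R - R) g‖ + ‖-(f - R g)‖ := norm_add_le _ _
    _ ≤ ‖heatOp R t (f - R g)‖ + ‖(heatOp R t * R - R) g‖ + ‖f - R g‖ := by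
      rw [norm_neg]
      gcongr
      exact norm_add_le _ _
    _ < ε := by linarith

theorem hasDerivAt_heatOp_apply (hR : R.IsPositive) {t : ℝ} (ht : 0 < t) (f : 𝓗) :
    HasDerivAt (fun s => heatOp R s f) (-genOp R t f) t :=
  ((ContinuousLinearMap.apply ℂ 𝓗 f).restrictScalars ℝ).hasFDerivAt.comp_hasDerivAt t
    (hasDerivAt_heatOp hR ht)

theorem continuousOn_heatOp_apply (hR : R.IsPositive) (hd : DenseRange R) (f : 𝓗) :
    ContinuousOn (fun t => heatOp R t f) (Ici 0) := by
  intro t ht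
  rcases (show (0 : ℝ) ≤ t from ht).eq_or_lt with rfl | ht
  · rw [ContinuousWithinAt, heatOp_zero]
    exact tendsto_heatOp_zero hR hd f
  · exact (hasDerivAt_heatOp_apply hR ht f).continuousAt.continuousWithinAt

theorem heatOp_nat_mul (hR : R.IsPositive) {t : ℝ} (ht : 0 ≤ t) (n : ℕ) :
    heatOp R (n * t) = heatOp R t ^ n := by
  induction n with
  | zero => simp [heatOp_zero]
  | succ n ih =>
    rw [pow_succ, ← ih, ← heatOp_add hR (by positivity) ht]
    congr 1
    push_cast
    ring

/-- The operator `(1 / τ) (1 - exp (-A / τ))⁻¹` as a geometric series, where `R = A⁻¹`. It is the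
factor by which the Bose operator differs from `exp (-A / τ)`. -/
def boseFactor (τ : ℝ) (R : 𝓗 →L[ℂ] 𝓗) : 𝓗 →L[ℂ] 𝓗 := τ⁻¹ • ∑' n : ℕ, heatOp R τ⁻¹ ^ n

theorem norm_heatOp_lt_one (hR : R.IsPositive) {κ : ℝ} (hκ : 0 < κ) (hn : ‖R‖ ≤ κ⁻¹) {t : ℝ}
    (ht : 0 < t) : ‖heatOp R t‖ < 1 := by
  refine (norm_heatOp_le hR hκ hn ht.le).trans_lt ?_
  rw [Real.exp_lt_one_iff, neg_lt_zero]
  positivity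

theorem hasSum_boseFactor (hR : R.IsPositive) {κ : ℝ} (hκ : 0 < κ) (hn : ‖R‖ ≤ κ⁻¹) {τ : ℝ}
    (hτ : 0 < τ) : HasSum (fun n : ℕ => τ⁻¹ • heatOp R (n * τ⁻¹)) (boseFactor τ R) := by
  have h1 : Summable (fun n : ℕ => heatOp R τ⁻¹ ^ n) :=
    summable_geometric_of_norm_lt_one (norm_heatOp_lt_one hR hκ hn (inv_pos.2 hτ))
  have h2 := h1.hasSum.const_smul τ⁻¹
  simp only [heatOp_nat_mul hR (inv_nonneg.2 hτ.le)]
  exact h2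

theorem isSelfAdjoint_boseFactor (hR : R.IsPositive) {κ : ℝ} (hκ : 0 < κ) (hn : ‖R‖ ≤ κ⁻¹) {τ : ℝ}
    (hτ : 0 < τ) : IsSelfAdjoint (boseFactor τ R) := by
  have h := hasSum_boseFactor hR hκ hn hτ
  have h2 := h.star
  have e : (fun n : ℕ => star (τ⁻¹ • heatOp R (n * τ⁻¹))) =
      fun n : ℕ => τ⁻¹ • heatOp R (n * τ⁻¹) := by
    funext n
    rw [star_smul, (isSelfAdjoint_heatOp R _).star_eq, star_trivial]
  rw [e] at h2
  exact h2.unique h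

theorem bose_mul {τ s : ℝ} (hτ : 0 < τ) (hs : 0 ≤ s) :
    bose τ s * (1 - heatFn τ⁻¹ s) = τ⁻¹ * heatFn τ⁻¹ s := by
  simp only [bose, heatFn]
  split_ifs with h
  · simp
  · have hs' : 0 < s := lt_of_le_of_ne hs (Ne.symm h)
    have e : s⁻¹ / τ = τ⁻¹ / s := by field_simp
    rw [e, Real.exp_neg]
    have h1 : 1 < Real.exp (τ⁻¹ / s) := by
      rw [Real.one_lt_exp_iff]
      positivity
    generalize Real.exp (τ⁻¹ / s) = E at h1 ⊢
    have h2 : E - 1 ≠ 0 := by linarith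
    have h3 : E ≠ 0 := by linarith
    field_simp

/-- Continuity at `0` holds because `0 ≤ bose τ s ≤ s`, by `eˣ - 1 ≥ x`. -/
theorem continuousOn_bose {τ : ℝ} (hτ : 0 < τ) : ContinuousOn (bose τ) (Ici 0) := by
  intro s hs
  by_cases h : s = 0
  · subst h
    have h0 : bose τ 0 = 0 := if_pos rfl
    rw [ContinuousWithinAt, h0]
    refine squeeze_zero' (g := fun s => s) ?_ ?_ ?_
    · filter_upwards [self_mem_nhdsWithin] with s hs
      have hs0 : 0 ≤ s := hs
      rw [bose]
      split_ifs
      · exact le_rfl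
      · have : 1 ≤ Real.exp (s⁻¹ / τ) := by
          rw [Real.one_le_exp_iff]
          positivity
        have : 0 ≤ Real.exp (s⁻¹ / τ) - 1 := by linarith
        positivity
    · filter_upwards [self_mem_nhdsWithin] with s hs
      have hs0 : 0 ≤ s := hs
      rw [bose]
      split_ifs with h
      · exact hs
      · have hs' : 0 < s := lt_of_le_of_ne hs (Ne.symm h)
        have h1 : s⁻¹ / τ ≤ Real.exp (s⁻¹ / τ) - 1 := by
          have := Real.add_one_le_exp (s⁻¹ / τ)
          linarith
        rw [one_div, inv_le_comm₀ (by
          have : 0 < s⁻¹ / τ := by positivity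
          have : 0 < Real.exp (s⁻¹ / τ) - 1 := by linarith
          positivity) hs']
        calc s⁻¹ = τ * (s⁻¹ / τ) := by field_simp
          _ ≤ _ := by gcongr
    · exact tendsto_id.mono_left nhdsWithin_le_nhds
  · have hs' : 0 < s := lt_of_le_of_ne hs (Ne.symm h)
    have h1 : ContinuousAt (fun s : ℝ => 1 / (τ * (Real.exp (s⁻¹ / τ) - 1))) s := by
      have hne : τ * (Real.exp (s⁻¹ / τ) - 1) ≠ 0 := by
        have : 1 < Real.exp (s⁻¹ / τ) := by
          rw [Real.one_lt_exp_iff]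
          positivity
        have : 0 < Real.exp (s⁻¹ / τ) - 1 := by linarith
        positivity
      have h2 : ContinuousAt (fun s : ℝ => s⁻¹) s := continuousAt_inv₀ h
      exact ContinuousAt.div continuousAt_const (continuousAt_const.mul
        ((Real.continuous_exp.continuousAt.comp (h2.div_const τ)).sub continuousAt_const)) hne
    refine (h1.congr ?_).continuousWithinAt
    filter_upwards [isOpen_ne.mem_nhds h] with s' hs'
    exact (if_neg hs').symm

/-- Half of a time step of the semigroup can be split off on each side of the Bose operator. Since
the semigroup maps to continuous functions, the Bose operator thus has a continuous kernel. -/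
theorem boseOperator_eq (hR : R.IsPositive) {κ : ℝ} (hκ : 0 < κ) (hn : ‖R‖ ≤ κ⁻¹) {τ : ℝ}
    (hτ : 0 < τ) : boseOperator τ R =
      heatOp R (τ⁻¹ / 2) * boseFactor τ R * heatOp R (τ⁻¹ / 2) := by
  have hτ' : 0 < τ⁻¹ := inv_pos.2 hτ
  set T := heatOp R τ⁻¹ with hT
  have hT1 : ‖T‖ < 1 := norm_heatOp_lt_one hR hκ hn hτ'
  have hc := (continuousOn_bose hτ).mono (spectrum_subset_Ici hR)
  have hh := continuousOn_heatFn_spectrum hR hτ'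
  have h1 : boseOperator τ R * (1 - T) = τ⁻¹ • T := by
    have e1 : (1 : 𝓗 →L[ℂ] 𝓗) - T = cfc (fun x => 1 - heatFn τ⁻¹ x) R := by
      rw [cfc_sub (fun _ => (1 : ℝ)) (heatFn τ⁻¹) R continuousOn_const hh,
        cfc_const_one ℝ R hR.isSelfAdjoint, hT, heatOp_of_pos R hτ']
    rw [e1, boseOperator, ← cfc_mul (bose τ) (fun x => 1 - heatFn τ⁻¹ x) R hc
      (continuousOn_const.sub hh), hT, heatOp_of_pos R hτ', ← cfc_smul τ⁻¹ (heatFn τ⁻¹) R hh]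
    exact cfc_congr fun x hx => bose_mul hτ (spectrum_subset_Ici hR hx)
  have h2 : boseOperator τ R = T * boseFactor τ R := by
    calc boseOperator τ R = boseOperator τ R * ((1 - T) * ∑' n : ℕ, T ^ n) := by
          rw [mul_neg_geom_series _ hT1, mul_one]
      _ = (τ⁻¹ • T) * ∑' n : ℕ, T ^ n := by rw [← mul_assoc, h1]
      _ = T * boseFactor τ R := by rw [boseFactor, smul_mul_assoc, mul_smul_comm]
  have hcomm : Commute (heatOp R (τ⁻¹ / 2)) (boseFactor τ R) := by
    have hc1 : Commute (heatOp R (τ⁻¹ / 2)) (∑' n : ℕ, T ^ n) := by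
      refine (Commute.tsum_right _ fun n => ?_)
      refine Commute.pow_right ?_ n
      rw [hT, heatOp_of_pos R hτ', heatOp_of_pos R (half_pos hτ')]
      exact cfc_commute_cfc _ _ R
    exact hc1.smul_right _
  have h3 : T = heatOp R (τ⁻¹ / 2) * heatOp R (τ⁻¹ / 2) := by
    rw [← heatOp_add hR (half_pos hτ').le (half_pos hτ').le, add_halves]
  rw [h2, h3]
  exact (mul_assoc _ _ _).trans
    ((congrArg (heatOp R (τ⁻¹ / 2) * ·) hcomm.eq).trans (mul_assoc _ _ _).symm)

end Semigroup

end

section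

/-! ### Translations and weak derivatives -/

/-- `z ↦ ∫ η (x - z) f x dx`, the correlation of a test function with an `L²` function. -/
def corr (η : Space d → ℝ) (f : OneParticle d) (z : Space d) : ℂ := ∫ x, η (x - z) • f x

theorem IsTest.comp_sub {η : Space d → ℝ} (h : IsTest η) (a : Space d) :
    IsTest (fun x => η (x - a)) := by
  simpa only [sub_eq_add_neg] using h.comp_add (-a)

theorem corr_eq_inner {η : Space d → ℝ} (h : IsTest η) (f : OneParticle d) (z : Space d) :
    corr η f z = inner ℂ (rL2 (fun x => η (x - z))) f :=
  (inner_rL2 ((h.comp_sub z).memLp 2) f).symm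

theorem corr_zero {η : Space d → ℝ} (h : IsTest η) (f : OneParticle d) :
    corr η f 0 = inner ℂ (rL2 η) f := by
  rw [corr_eq_inner h]
  simp only [sub_zero]

theorem hasFDerivAt_corr {η : Space d → ℝ} (h : IsTest η) (f : OneParticle d) (z : Space d) :
    ∃ T : Space d →L[ℝ] ℂ, HasFDerivAt (corr η f) T z ∧
      ∀ i, T (EuclideanSpace.single i 1) = - corr (partialDeriv i η) f z := by
  set η' : Space d → ℝ := fun u => η (-u) with hη'
  have hs : HasCompactSupport η' := h.2.comp_homeomorph (Homeomorph.neg (Space d))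
  have hc : ContDiff ℝ 1 η' := (h.1.of_le (by simp)).comp contDiff_neg
  have hf : LocallyIntegrable (f : Space d → ℂ) volume :=
    (Lp.memLp f).locallyIntegrable (by norm_num)
  set L : ℂ →L[ℝ] ℝ →L[ℝ] ℂ := (ContinuousLinearMap.lsmul ℝ ℝ).flip with hL
  have h1 := hs.hasFDerivAt_convolution_right L hf hc z
  have e : corr η f = convolution (f : Space d → ℂ) η' L volume := by
    funext y
    rw [corr, MeasureTheory.convolution_def]
    refine integral_congr_ae (Eventually.of_forall fun x => ?_)
    simp only [hL, hη', ContinuousLinearMap.flip_apply, ContinuousLinearMap.lsmul_apply, neg_sub]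
  rw [← e] at h1
  refine ⟨_, h1, fun i => ?_⟩
  rw [convolution_precompR_apply L hf (hs.fderiv ℝ) (hc.continuous_fderiv one_ne_zero),
    MeasureTheory.convolution_def, corr, ← integral_neg]
  refine integral_congr_ae (Eventually.of_forall fun x => ?_)
  have h2 : fderiv ℝ η' (z - x) (EuclideanSpace.single i 1) = - partialDeriv i η (x - z) := by
    have h3 : HasFDerivAt η' ((fderiv ℝ η (-(z - x))).comp (-ContinuousLinearMap.id ℝ (Space d)))
        (z - x) :=
      HasFDerivAt.comp (z - x) (h.differentiable _).hasFDerivAt (hasFDerivAt_id (z - x)).neg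
    rw [h3.fderiv, partialDeriv]
    simp
  simp only [hL, ContinuousLinearMap.flip_apply, ContinuousLinearMap.lsmul_apply, h2, neg_smul]

theorem differentiable_corr {η : Space d → ℝ} (h : IsTest η) (f : OneParticle d) :
    Differentiable ℝ (corr η f) := fun z =>
  let ⟨_, hT, _⟩ := hasFDerivAt_corr h f z
  hT.differentiableAt

theorem fderiv_corr {η : Space d → ℝ} (h : IsTest η) (f : OneParticle d) (z : Space d) (i : Fin d) :
    fderiv ℝ (corr η f) z (EuclideanSpace.single i 1) = - corr (partialDeriv i η) f z := by
  obtain ⟨T, hT, hTi⟩ := hasFDerivAt_corr h f z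
  rw [hT.fderiv, hTi]

theorem norm_rL2_comp_sub {η : Space d → ℝ} (h : IsTest η) (z : Space d) :
    ‖rL2 (fun x => η (x - z))‖ = ‖rL2 η‖ := by
  rw [← sq_eq_sq₀ (norm_nonneg _) (norm_nonneg _), norm_sq_eq_integral, norm_sq_eq_integral,
    ← integral_sub_right_eq_self (fun x => ‖rL2 η x‖ ^ 2) z]
  refine integral_congr_ae ?_
  have hq : Measure.QuasiMeasurePreserving (fun x : Space d => x - z) volume volume :=
    (measurePreserving_sub_right volume z).quasiMeasurePreserving
  filter_upwards [coeFn_rL2 ((h.comp_sub z).memLp 2), hq.ae (coeFn_rL2 (h.memLp 2))] with x h1 h2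
  rw [h1, h2]

theorem norm_corr_le {η : Space d → ℝ} (h : IsTest η) (f : OneParticle d) (z : Space d) :
    ‖corr η f z‖ ≤ ‖rL2 η‖ * ‖f‖ := by
  rw [corr_eq_inner h, ← norm_rL2_comp_sub h z]
  exact norm_inner_le_norm _ _

/-- Translation `f ↦ f (· + a)`. -/
def transl (a : Space d) : OneParticle d →ₗᵢ[ℂ] OneParticle d :=
  Lp.compMeasurePreservingₗᵢ ℂ (fun x => x + a) (measurePreserving_add_right volume a)

theorem coeFn_transl (a : Space d) (f : OneParticle d) :
    transl a f =ᵐ[volume] fun x => f (x + a) :=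
  Lp.coeFn_compMeasurePreserving f (measurePreserving_add_right volume a)

theorem continuous_transl (f : OneParticle d) : Continuous (fun a : Space d => transl a f) := by
  have hg : Continuous (fun a : Space d => (⟨fun x => x + a, by fun_prop⟩ : C(Space d, Space d))) :=
    by
    refine ContinuousMap.continuous_of_continuous_uncurry _ ?_
    change Continuous (fun p : Space d × Space d => p.2 + p.1)
    fun_prop
  exact Continuous.compMeasurePreservingLp (p := 2) (μ := volume) (ν := volume)
    (continuous_const (y := f)) hg (fun a => measurePreserving_add_right volume a) (by norm_num)

theorem inner_transl {η : Space d → ℝ} (h : IsTest η) (f : OneParticle d) (a : Space d) :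
    inner ℂ (rL2 η) (transl a f) = corr η f a := by
  rw [inner_rL2 (h.memLp 2), corr, ← integral_add_right_eq_self (fun x => η (x - a) • f x) a]
  refine integral_congr_ae ?_
  filter_upwards [coeFn_transl a f] with x hx
  rw [hx, add_sub_cancel_right]

/-- `i`-th basis vector. -/
abbrev basisVec (i : Fin d) : Space d := EuclideanSpace.single i (1 : ℝ)

theorem hasDerivAt_corr_line {η : Space d → ℝ} (h : IsTest η) (f : OneParticle d) (i : Fin d)
    (s : ℝ) : HasDerivAt (fun s : ℝ => corr η f (s • basisVec i))
      (- corr (partialDeriv i η) f (s • basisVec i)) s := by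
  have h1 := (differentiable_corr h f (s • basisVec i)).hasFDerivAt
  have h2 : HasDerivAt (fun s : ℝ => s • basisVec i) (basisVec i) s := by
    simpa using (hasDerivAt_id s).smul_const (basisVec i)
  have h3 := h1.comp_hasDerivAt s h2
  rwa [fderiv_corr h] at h3

theorem HasWeakGradient.inner_comp_sub {f : OneParticle d} {F : Fin d → OneParticle d}
    (hF : HasWeakGradient f F) {η : Space d → ℝ} (h : IsTest η) (i : Fin d) (z : Space d) :
    corr (partialDeriv i η) f z = - corr η (F i) z := by
  rw [corr_eq_inner (h.partialDeriv i), corr_eq_inner h,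
    ← hasWeakGradient_iff.1 hF i _ (h.comp_sub z)]
  congr 2
  funext x
  simp only [sub_eq_add_neg]
  exact (partialDeriv_comp_add η (-z) i x).symm

/-- The difference quotients of a function with a weak derivative in `L²` are bounded by the norm of
that derivative. -/
theorem norm_transl_sub_le {f : OneParticle d} {F : Fin d → OneParticle d}
    (hF : HasWeakGradient f F) (i : Fin d) (h : ℝ) :
    ‖transl (h • basisVec i) f - f‖ ≤ |h| * ‖F i‖ := by
  have hcont : Continuous (fun s : ℝ => transl (s • basisVec i) (F i)) :=
    (continuous_transl (F i)).comp (by fun_prop)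
  have key : transl (h • basisVec i) f - f = ∫ s in (0 : ℝ)..h, transl (s • basisVec i) (F i) := by
    refine eq_of_forall_inner_test fun η hη => ?_
    have hint : IntervalIntegrable (fun s : ℝ => transl (s • basisVec i) (F i)) volume 0 h :=
      hcont.intervalIntegrable _ _
    have e1 := ((innerSL ℂ (rL2 η)).restrictScalars ℝ).intervalIntegral_comp_comm hint
    change ∫ s in (0 : ℝ)..h, inner ℂ (rL2 η) (transl (s • basisVec i) (F i)) =
      inner ℂ (rL2 η) (∫ s in (0 : ℝ)..h, transl (s • basisVec i) (F i)) at e1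
    rw [← e1, inner_sub_right, inner_transl hη]
    have e2 : ∀ s : ℝ, HasDerivAt (fun s : ℝ => corr η f (s • basisVec i))
        (inner ℂ (rL2 η) (transl (s • basisVec i) (F i))) s := by
      intro s
      have := hasDerivAt_corr_line hη f i s
      rwa [hF.inner_comp_sub hη, neg_neg, ← inner_transl hη] at this
    rw [intervalIntegral.integral_eq_sub_of_hasDerivAt (fun s _ => e2 s)
      ((continuous_const.inner hcont).intervalIntegrable _ _), zero_smul, corr_zero hη]
  rw [key]
  have h2 := intervalIntegral.norm_integral_le_of_norm_le_const (a := 0) (b := h) (C := ‖F i‖)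
    (f := fun s => transl (s • basisVec i) (F i)) (fun s _ => by rw [LinearIsometry.norm_map])
  rw [sub_zero] at h2
  linarith

/-- A function whose difference quotients are bounded in `L²` has a weak derivative in `L²`, by weak
compactness. -/
theorem exists_weakDeriv {f : OneParticle d} {M : ℝ} (i : Fin d)
    (hM : ∀ h : ℝ, ‖transl (h • basisVec i) f - f‖ ≤ |h| * M) :
    ∃ G : OneParticle d, ‖G‖ ≤ M ∧ ∀ η : Space d → ℝ, IsTest η →
      inner ℂ (rL2 (partialDeriv i η)) f = - inner ℂ (rL2 η) G := by
  set h : ℕ → ℝ := fun n => ((n : ℝ) + 1)⁻¹ with hh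
  have hpos : ∀ n, 0 < h n := fun n => by positivity
  set D : ℕ → OneParticle d := fun n => ((h n)⁻¹ : ℂ) • (transl (h n • basisVec i) f - f) with hD
  have hDn : ∀ n, ‖D n‖ ≤ M := by
    intro n
    have h1 := hM (h n)
    have e : ‖((h n : ℂ))⁻¹‖ = (h n)⁻¹ := by
      rw [norm_inv, Complex.norm_real, Real.norm_of_nonneg (hpos n).le]
    rw [hD]
    simp only
    rw [norm_smul, e, inv_mul_le_iff₀ (hpos n)]
    rwa [abs_of_pos (hpos n)] at h1
  -- `G` is a weak limit of the bounded sequence of difference quotients, along an ultrafilter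
  set E : ℕ → WeakDual ℂ (OneParticle d) := fun n =>
    StrongDual.toWeakDual (InnerProductSpace.toDual ℂ (OneParticle d) (D n)) with hE
  have hcomp := WeakDual.isCompact_closedBall (𝕜 := ℂ) (0 : StrongDual ℂ (OneParticle d)) M
  set 𝒰 : Ultrafilter ℕ := hyperfilter ℕ with h𝒰
  have hmem : ∀ n, E n ∈ WeakDual.toStrongDual ⁻¹' Metric.closedBall
      (0 : StrongDual ℂ (OneParticle d)) M := by
    intro n
    rw [mem_preimage, mem_closedBall_zero_iff]
    change ‖InnerProductSpace.toDual ℂ (OneParticle d) (D n)‖ ≤ M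
    rw [LinearIsometryEquiv.norm_map]
    exact hDn n
  obtain ⟨φ, hφM, hφ⟩ := isCompact_iff_ultrafilter_le_nhds'.1 hcomp (𝒰.map E)
    (Ultrafilter.mem_map.2 (Filter.Eventually.of_forall hmem))
  have hlim : ∀ g : OneParticle d, Tendsto (fun n => inner ℂ (D n) g) 𝒰 (𝓝 (φ g)) := by
    intro g
    have h1 : Tendsto E 𝒰 (𝓝 φ) := hφ
    exact ((WeakDual.eval_continuous g).tendsto φ).comp h1
  set G : OneParticle d := (InnerProductSpace.toDual ℂ (OneParticle d)).symm
    (WeakDual.toStrongDual φ) with hG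
  have hGφ : ∀ g, inner ℂ G g = φ g := fun g => InnerProductSpace.toDual_symm_apply
  refine ⟨G, ?_, fun η hη => ?_⟩
  · rw [hG, LinearIsometryEquiv.norm_map]
    rw [mem_preimage, mem_closedBall_zero_iff] at hφM
    exact hφM
  · have hη' := hη.partialDeriv i
    have h1 : Tendsto (fun n => inner ℂ (rL2 η) (D n)) 𝒰 (𝓝 (inner ℂ (rL2 η) G)) := by
      have h2 := (Complex.continuous_conj.tendsto _).comp (hlim (rL2 η))
      rw [← hGφ] at h2
      simp only [Function.comp_def, inner_conj_symm] at h2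
      exact h2
    -- tested against `η`, the difference quotients converge to the derivative of the correlation
    have h3 : Tendsto (fun n => inner ℂ (rL2 η) (D n)) 𝒰
        (𝓝 (- inner ℂ (rL2 (partialDeriv i η)) f)) := by
      have hd := hasDerivAt_corr_line hη f i 0
      rw [zero_smul, corr_zero hη'] at hd
      have hh0 : Tendsto h 𝒰 (𝓝[≠] 0) := by
        refine tendsto_nhdsWithin_iff.2 ⟨?_, Eventually.of_forall fun n => (hpos n).ne'⟩
        have h4 : Tendsto h atTop (𝓝 0) := tendsto_one_div_add_atTop_nhds_zero_nat.congr
          fun n => by simp [hh]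
        exact h4.mono_left Nat.hyperfilter_le_atTop
      have h5 := (hasDerivAt_iff_tendsto_slope_zero.1 hd).comp hh0
      refine h5.congr fun n => ?_
      simp only [Function.comp_def, hD, inner_smul_right, inner_sub_right, inner_transl hη,
        zero_smul, zero_add, corr_zero hη, Complex.real_smul, Complex.ofReal_inv]
    have h4 := tendsto_nhds_unique h1 h3
    rw [h4, neg_neg]

/-! ### Positivity -/

open scoped ComplexOrder in
/-- Functions that are nonnegative almost everywhere. -/
def IsNonneg (f : OneParticle d) : Prop := ∀ᵐ x, 0 ≤ f x

/-- The pointwise absolute value. -/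
def absL2 (f : OneParticle d) : OneParticle d := rL2 (fun x => ‖f x‖)

theorem coeFn_absL2 (f : OneParticle d) : absL2 f =ᵐ[volume] fun x => (‖f x‖ : ℂ) :=
  coeFn_rL2 (Lp.memLp f).norm

open scoped ComplexOrder in
theorem complex_nonneg_iff {z : ℂ} : 0 ≤ z ↔ (‖z‖ : ℂ) = z := by
  constructor
  · intro h
    have := Complex.norm_of_nonneg' h
    exact_mod_cast this
  · intro h
    rw [← h]
    exact_mod_cast norm_nonneg z

theorem isNonneg_iff {f : OneParticle d} : IsNonneg f ↔ absL2 f = f := by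
  constructor
  · intro h
    refine Lp.ext ?_
    filter_upwards [coeFn_absL2 f, h] with x h1 h2
    rw [h1, complex_nonneg_iff.1 h2]
  · intro h
    have h1 := coeFn_absL2 f
    rw [h] at h1
    filter_upwards [h1] with x hx
    exact complex_nonneg_iff.2 hx.symm

theorem norm_absL2 (f : OneParticle d) : ‖absL2 f‖ = ‖f‖ := by
  rw [← sq_eq_sq₀ (norm_nonneg _) (norm_nonneg _), norm_sq_eq_integral, norm_sq_eq_integral]
  refine integral_congr_ae ?_
  filter_upwards [coeFn_absL2 f] with x h1
  rw [h1, Complex.norm_real, norm_norm]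

theorem norm_absL2_sub_le (f g : OneParticle d) : ‖absL2 f - absL2 g‖ ≤ ‖f - g‖ := by
  refine norm_le_of_ae_le ?_
  filter_upwards [coeFn_absL2 f, coeFn_absL2 g, Lp.coeFn_sub (absL2 f) (absL2 g),
    Lp.coeFn_sub f g] with x h1 h2 h3 h4
  rw [h3, h4, Pi.sub_apply, Pi.sub_apply, h1, h2, ← Complex.ofReal_sub, Complex.norm_real]
  exact abs_norm_sub_norm_le _ _

theorem isClosed_isNonneg : IsClosed {f : OneParticle d | IsNonneg f} := by
  have h : Continuous (absL2 : OneParticle d → OneParticle d) := by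
    refine LipschitzWith.continuous (K := 1) (LipschitzWith.of_dist_le_mul fun f g => ?_)
    rw [dist_eq_norm, dist_eq_norm, NNReal.coe_one, one_mul]
    exact norm_absL2_sub_le f g
  simp only [isNonneg_iff]
  exact isClosed_eq h continuous_id

theorem transl_absL2 (a : Space d) (f : OneParticle d) :
    transl a (absL2 f) = absL2 (transl a f) := by
  refine Lp.ext ?_
  have hq : Measure.QuasiMeasurePreserving (fun x : Space d => x + a) volume volume :=
    (measurePreserving_add_right volume a).quasiMeasurePreserving
  filter_upwards [coeFn_transl a (absL2 f), coeFn_transl a f, coeFn_absL2 (transl a f),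
    hq.ae (coeFn_absL2 f)] with x h1 h2 h3 h4
  rw [h1, h3, h4, h2]

/-- The absolute value does not increase difference quotients. -/
theorem exists_weakGradient_absL2 {f : OneParticle d} {F : Fin d → OneParticle d}
    (hF : HasWeakGradient f F) : ∃ G : Fin d → OneParticle d, HasWeakGradient (absL2 f) G ∧
      ∀ i, ‖G i‖ ≤ ‖F i‖ := by
  have h : ∀ i, ∃ G : OneParticle d, ‖G‖ ≤ ‖F i‖ ∧ ∀ η : Space d → ℝ, IsTest η →
      inner ℂ (rL2 (partialDeriv i η)) (absL2 f) = - inner ℂ (rL2 η) G := by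
    intro i
    refine exists_weakDeriv i fun h => ?_
    rw [transl_absL2]
    exact (norm_absL2_sub_le _ _).trans (norm_transl_sub_le hF i h)
  choose G hG using h
  exact ⟨G, hasWeakGradient_iff.2 fun i η hη => (hG i).2 η hη, fun i => (hG i).1⟩

/-- First Beurling–Deny criterion: passing to the absolute value does not increase the energy, so
the minimiser that defines `(-Δ + U)⁻¹ g` is nonnegative for `g ≥ 0`. -/
theorem isNonneg_schrodingerInv {κ : ℝ} {U : Space d → ℝ} (hU : IsCoercive κ U)
    {g : OneParticle d} (hg : IsNonneg g) : IsNonneg (schrodingerInv U g) := by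
  set z := ContinuousLinearMap.adjoint (formEmbed U) g with hz
  set φ := formEmbed U z with hφ
  obtain ⟨G, hG, hGn⟩ := exists_weakGradient_absL2 (hasWeakGradient_formEmbed z)
  have hpot : FinitePotentialEnergy U (absL2 φ) := by
    refine (finitePotentialEnergy_formEmbed hU z).congr ?_
    filter_upwards [coeFn_absL2 φ] with x hx
    rw [hx, Complex.norm_real, norm_norm]
  obtain ⟨y, hy, hyG⟩ := exists_formDomain hU hG hpot
  -- `y` is the element of the form domain over `|φ|`; as `‖y‖ ≤ ‖z‖` and `‖z‖² ≤ Re ⟨y, z⟩`, it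
  -- coincides with `z`
  have h1 : ‖y‖ ^ 2 ≤ ‖z‖ ^ 2 := by
    rw [norm_sq_form_eq hU, norm_sq_form_eq hU]
    refine add_le_add (Finset.sum_le_sum fun i _ => ?_) (le_of_eq ?_)
    · rw [hyG]
      exact pow_le_pow_left₀ (norm_nonneg _) (hGn i) 2
    · refine integral_congr_ae ?_
      rw [hy]
      filter_upwards [coeFn_absL2 φ] with x hx
      rw [hx, Complex.norm_real, norm_norm]
  have h2 : ‖z‖ ^ 2 ≤ (inner ℂ y z).re := by
    have e1 : ‖z‖ ^ 2 = (inner ℂ φ g).re := by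
      rw [hφ, ← ContinuousLinearMap.adjoint_inner_right, ← hz, inner_self_eq_norm_sq_to_K]
      norm_cast
    have e2 : inner ℂ y z = inner ℂ (absL2 φ) g := by
      rw [hz, ContinuousLinearMap.adjoint_inner_right, hy]
    rw [e1, e2, inner_eq_integral, inner_eq_integral]
    have r1 := integral_re (𝕜 := ℂ) (integrable_conj_mul φ g)
    have r2 := integral_re (𝕜 := ℂ) (integrable_conj_mul (absL2 φ) g)
    simp only [RCLike.re_to_complex] at r1 r2
    rw [← r1, ← r2]
    refine integral_mono_ae (integrable_conj_mul φ g).re (integrable_conj_mul (absL2 φ) g).re ?_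
    filter_upwards [coeFn_absL2 φ, hg] with x hx hgx
    have hgx' := complex_nonneg_iff.1 hgx
    change (starRingEnd ℂ (φ x) * g x).re ≤ (starRingEnd ℂ (absL2 φ x) * g x).re
    rw [hx, Complex.conj_ofReal]
    calc (starRingEnd ℂ (φ x) * g x).re ≤ ‖starRingEnd ℂ (φ x) * g x‖ := Complex.re_le_norm _
      _ = ‖φ x‖ * ‖g x‖ := by rw [norm_mul, RCLike.norm_conj]
      _ = ((‖φ x‖ : ℂ) * g x).re := by
        rw [← hgx', ← Complex.ofReal_mul, Complex.ofReal_re, Complex.norm_real, norm_norm]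
  have h3 : ‖y - z‖ ^ 2 ≤ 0 := by
    have h5 := norm_sub_sq (𝕜 := ℂ) y z
    change ‖y - z‖ ^ 2 = ‖y‖ ^ 2 - 2 * (inner ℂ y z).re + ‖z‖ ^ 2 at h5
    linarith
  have h4 : y = z := by
    have : ‖y - z‖ = 0 := by nlinarith [norm_nonneg (y - z)]
    exact sub_eq_zero.1 (norm_eq_zero.1 this)
  rw [isNonneg_iff, schrodingerInv_apply, ← hz, ← hφ, ← hy, h4]

end

section

/-! ### Euler's approximation of the semigroup -/

/-- The functions `(1 + t / (2 ^ k s)) ^ (-2 ^ k)` of Euler's approximation of `exp (-t / s)`. Only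
powers of two are used as exponents, since monotonicity in `k` then is elementary. -/
def eulerFn (t : ℝ) (k : ℕ) (s : ℝ) : ℝ := (2 ^ k * s / (t + 2 ^ k * s)) ^ 2 ^ k

theorem antitone_eulerFn {t s : ℝ} (ht : 0 < t) (hs : 0 ≤ s) :
    Antitone (fun k => eulerFn t k s) := by
  refine antitone_nat_of_succ_le fun k => ?_
  rw [eulerFn, eulerFn, pow_succ (2 : ℕ) k, pow_mul', pow_succ (2 : ℝ) k]
  set a := 2 ^ k * s with ha
  have ha0 : 0 ≤ a := by positivity
  have e : (2 : ℝ) ^ k * 2 * s = 2 * a := by rw [ha]; ring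
  rw [e]
  refine pow_le_pow_left₀ (by positivity) ?_ _
  rw [div_pow, div_le_div_iff₀ (by positivity) (by positivity)]
  nlinarith [mul_nonneg ha0 (sq_nonneg t)]

theorem tendsto_eulerFn {t s : ℝ} (ht : 0 < t) (hs : 0 ≤ s) :
    Tendsto (fun k => eulerFn t k s) atTop (𝓝 (heatFn t s)) := by
  rw [heatFn]
  split_ifs with h
  · subst h
    refine tendsto_const_nhds.congr fun k => ?_
    simp [eulerFn]
  · have hs' : 0 < s := lt_of_le_of_ne hs (Ne.symm h)
    have h1 := (Real.tendsto_one_add_div_pow_exp (t / s)).comp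
      (tendsto_pow_atTop_atTop_of_one_lt (r := 2) (by norm_num))
    rw [Real.exp_neg]
    refine (h1.inv₀ (Real.exp_ne_zero _)).congr fun k => ?_
    simp only [Function.comp_apply, eulerFn]
    rw [← inv_pow]
    congr 1
    push_cast
    field_simp
    ring

theorem continuousOn_eulerFn {t : ℝ} (ht : 0 < t) (k : ℕ) : ContinuousOn (eulerFn t k) (Ici 0) := by
  refine ContinuousOn.pow (ContinuousOn.div (by fun_prop) (by fun_prop) fun s hs => ?_) _
  have : 0 ≤ s := hs
  positivity

/-- The monotone pointwise convergence is uniform on the compact spectrum, by Dini's theorem. -/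
theorem tendsto_cfc_eulerFn {𝓗 : Type*} [NormedAddCommGroup 𝓗] [InnerProductSpace ℂ 𝓗]
    [CompleteSpace 𝓗] {R : 𝓗 →L[ℂ] 𝓗} (hR : R.IsPositive) {t : ℝ} (ht : 0 < t) :
    Tendsto (fun k => cfc (eulerFn t k) R) atTop (𝓝 (heatOp R t)) := by
  have hsub := spectrum_subset_Ici hR
  rw [heatOp_of_pos R ht]
  refine tendsto_cfc_fun ?_ (Eventually.of_forall fun k => (continuousOn_eulerFn ht k).mono hsub)
  exact Antitone.tendstoUniformlyOn_of_forall_tendsto (spectrum.isCompact R)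
    (fun k => (continuousOn_eulerFn ht k).mono hsub) (fun x hx => antitone_eulerFn ht (hsub hx))
    (continuousOn_heatFn_spectrum hR ht) (fun x hx => tendsto_eulerFn ht (hsub hx))

theorem eq_cfc_of_resolvent {𝓗 : Type*} [NormedAddCommGroup 𝓗] [InnerProductSpace ℂ 𝓗]
    [CompleteSpace 𝓗] {R R' : 𝓗 →L[ℂ] 𝓗} (hR : R.IsPositive) {l : ℝ} (hl : 0 ≤ l)
    (h1 : R' * (1 + (l : ℂ) • R) = R) : R' = cfc (fun s => s / (1 + l * s)) R := by
  have hsub := spectrum_subset_Ici hR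
  have hne : ∀ x ∈ spectrum ℝ R, 1 + l * x ≠ 0 := by
    intro x hx
    have : 0 ≤ x := hsub hx
    positivity
  have hc1 : ContinuousOn (fun s : ℝ => 1 + l * s) (spectrum ℝ R) := by fun_prop
  have hc2 : ContinuousOn (fun s : ℝ => (1 + l * s)⁻¹) (spectrum ℝ R) := hc1.inv₀ hne
  have e1 : cfc (fun s : ℝ => 1 + l * s) R = 1 + (l : ℂ) • R := by
    rw [cfc_add R (fun _ => (1 : ℝ)) (fun s => l * s) continuousOn_const (by fun_prop),
      cfc_const_one ℝ R hR.isSelfAdjoint, cfc_const_mul_id l R hR.isSelfAdjoint]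
    congr 1
  have e2 : cfc (fun s : ℝ => 1 + l * s) R * cfc (fun s : ℝ => (1 + l * s)⁻¹) R = 1 := by
    rw [← cfc_mul _ _ R hc1 hc2, ← cfc_const_one ℝ R hR.isSelfAdjoint]
    exact cfc_congr fun x hx => mul_inv_cancel₀ (hne x hx)
  calc R' = R' * (cfc (fun s : ℝ => 1 + l * s) R *
        cfc (fun s : ℝ => (1 + l * s)⁻¹) R) := by rw [e2, mul_one]
    _ = R * cfc (fun s : ℝ => (1 + l * s)⁻¹) R := by
      rw [← mul_assoc, e1, h1]
    _ = cfc (fun s : ℝ => s) R * cfc (fun s : ℝ => (1 + l * s)⁻¹) R := by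
      rw [cfc_id' ℝ R hR.isSelfAdjoint]
    _ = cfc (fun s => s / (1 + l * s)) R := by
      rw [← cfc_mul (fun s => s) _ R continuousOn_id hc2]
      rfl

theorem cfc_eulerFn_eq {𝓗 : Type*} [NormedAddCommGroup 𝓗] [InnerProductSpace ℂ 𝓗]
    [CompleteSpace 𝓗] {R R' : 𝓗 →L[ℂ] 𝓗} (hR : R.IsPositive) {t : ℝ} (ht : 0 < t) (k : ℕ)
    (h1 : R' * (1 + ((2 ^ k / t : ℝ) : ℂ) • R) = R) :
    cfc (eulerFn t k) R = ((2 ^ k / t : ℝ) • R') ^ 2 ^ k := by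
  have hsub := spectrum_subset_Ici hR
  have hc : ContinuousOn (fun s : ℝ => s / (1 + 2 ^ k / t * s)) (spectrum ℝ R) := by
    refine ContinuousOn.div (by fun_prop) (by fun_prop) fun x hx => ?_
    have : 0 ≤ x := hsub hx
    positivity
  rw [eq_cfc_of_resolvent hR (by positivity) h1, ← cfc_smul _ _ _ hc,
    ← cfc_pow (fun s => (2 ^ k / t) • (s / (1 + 2 ^ k / t * s))) _ _ (hc.const_smul (2 ^ k / t))
      hR.isSelfAdjoint]
  refine cfc_congr fun x hx => ?_
  have : 0 ≤ x := hsub hx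
  simp only [eulerFn, smul_eq_mul]
  congr 1
  field_simp

/-- Euler's approximation of the semigroup by powers of resolvents. -/
theorem tendsto_pow_resolvent {𝓗 : Type*} [NormedAddCommGroup 𝓗] [InnerProductSpace ℂ 𝓗]
    [CompleteSpace 𝓗] {R : 𝓗 →L[ℂ] 𝓗} {R' : ℕ → 𝓗 →L[ℂ] 𝓗} (hR : R.IsPositive) {t : ℝ} (ht : 0 < t)
    (h1 : ∀ k, R' k * (1 + ((2 ^ k / t : ℝ) : ℂ) • R) = R) (g : 𝓗) :
    Tendsto (fun k => (((2 ^ k / t : ℝ) • R' k) ^ 2 ^ k) g) atTop (𝓝 (heatOp R t g)) := by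
  have hlim := tendsto_cfc_eulerFn hR ht
  simp only [fun k => cfc_eulerFn_eq hR ht k (h1 k)] at hlim
  exact ((ContinuousLinearMap.apply ℂ 𝓗 g).continuous.tendsto _).comp hlim

theorem IsNonneg.real_smul {f : OneParticle d} (hf : IsNonneg f) {c : ℝ} (hc : 0 ≤ c) :
    IsNonneg (c • f) := by
  filter_upwards [hf, Lp.coeFn_smul c f] with x h1 h2
  rw [h2, Pi.smul_apply]
  open scoped ComplexOrder in exact smul_nonneg hc h1

/-- The heat semigroup of `-Δ + U` preserves positivity, as a limit of powers of resolvents. -/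
theorem isNonneg_heatOp {κ : ℝ} {U : Space d → ℝ} (hU : IsCoercive κ U)
    {g : OneParticle d} (hg : IsNonneg g) {t : ℝ} (ht : 0 ≤ t) :
    IsNonneg (heatOp (schrodingerInv U) t g) := by
  rcases ht.eq_or_lt with rfl | ht
  · rwa [heatOp_zero]
  have hlim := tendsto_pow_resolvent (isPositive_schrodingerInv U) ht
    (fun k => schrodingerInv_add_const hU (l := 2 ^ k / t) (by positivity)) g
  refine isClosed_isNonneg.mem_of_tendsto hlim (Eventually.of_forall fun k => ?_)
  have hk : (0 : ℝ) ≤ 2 ^ k / t := by positivity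
  rw [mem_ofPred_eq]
  generalize 2 ^ k = n
  induction n with
  | zero => simpa using hg
  | succ n ih =>
    rw [pow_succ']
    exact IsNonneg.real_smul (isNonneg_schrodingerInv (hU.add_const hk) ih) hk

end

section

/-! ### The Gaussian heat kernel -/

/-- The heat kernel `(4 π t)^(-d/2) exp (-|x|² / (4 t))` of `-Δ`. -/
def gaussK (t : ℝ) (x : Space d) : ℝ :=
  (4 * Real.pi * t) ^ (-(d / 2 : ℝ)) * Real.exp (-‖x‖ ^ 2 / (4 * t))

theorem gaussK_pos {t : ℝ} (ht : 0 < t) (x : Space d) : 0 < gaussK t x := by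
  rw [gaussK]
  positivity

theorem gaussK_nonneg {t : ℝ} (ht : 0 < t) (x : Space d) : 0 ≤ gaussK t x := (gaussK_pos ht x).le

theorem gaussK_le {t : ℝ} (ht : 0 < t) (x : Space d) :
    gaussK t x ≤ (4 * Real.pi * t) ^ (-(d / 2 : ℝ)) := by
  rw [gaussK]
  refine mul_le_of_le_one_right (by positivity) ?_
  rw [Real.exp_le_one_iff, neg_div]
  have : 0 ≤ ‖x‖ ^ 2 / (4 * t) := by positivity
  linarith

theorem continuous_gaussK (t : ℝ) : Continuous (gaussK t : Space d → ℝ) := by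
  unfold gaussK
  fun_prop

theorem integral_gaussK {t : ℝ} (ht : 0 < t) : ∫ x : Space d, gaussK t x = 1 := by
  have h := GaussianFourier.integral_rexp_neg_mul_sq_norm (V := Space d)
    (b := (4 * t)⁻¹) (by positivity)
  have e : ∀ x : Space d, gaussK t x =
      (4 * Real.pi * t) ^ (-(d / 2 : ℝ)) * Real.exp (-(4 * t)⁻¹ * ‖x‖ ^ 2) := by
    intro x
    rw [gaussK]
    congr 2
    ring
  simp only [e]
  rw [integral_const_mul, h, finrank_euclideanSpace_fin,
    show Real.pi / (4 * t)⁻¹ = 4 * Real.pi * t by field_simp, Real.rpow_neg (by positivity)]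
  exact inv_mul_cancel₀ (by positivity)

theorem integrable_gaussK {t : ℝ} (ht : 0 < t) : Integrable (gaussK t : Space d → ℝ) := by
  by_contra h
  have := integral_undef h
  rw [integral_gaussK ht] at this
  exact one_ne_zero this

/-- An exponential weight costs a factor and a doubling of the time, by completing the square. -/
theorem gaussK_mul_exp_le {t c : ℝ} (ht : 0 < t) (x : Space d) :
    gaussK t x * Real.exp (c * ‖x‖) ≤
      2 ^ (d / 2 : ℝ) * Real.exp (2 * c ^ 2 * t) * gaussK (2 * t) x := by
  have e1 : (4 * Real.pi * (2 * t)) ^ (-(d / 2 : ℝ)) =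
      (2 : ℝ) ^ (-(d / 2 : ℝ)) * (4 * Real.pi * t) ^ (-(d / 2 : ℝ)) := by
    rw [← Real.mul_rpow (by norm_num) (by positivity)]
    congr 1
    ring
  have e2 : (2 : ℝ) ^ (d / 2 : ℝ) * (2 : ℝ) ^ (-(d / 2 : ℝ)) = 1 := by
    rw [← Real.rpow_add (by norm_num), add_neg_cancel, Real.rpow_zero]
  rw [gaussK, gaussK, e1]
  have e3 : 2 ^ (d / 2 : ℝ) * Real.exp (2 * c ^ 2 * t) * ((2 : ℝ) ^ (-(d / 2 : ℝ)) *
      (4 * Real.pi * t) ^ (-(d / 2 : ℝ)) * Real.exp (-‖x‖ ^ 2 / (4 * (2 * t)))) =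
      (4 * Real.pi * t) ^ (-(d / 2 : ℝ)) *
        Real.exp (2 * c ^ 2 * t + -‖x‖ ^ 2 / (4 * (2 * t))) := by
    rw [Real.exp_add]
    linear_combination ((4 * Real.pi * t) ^ (-(d / 2 : ℝ)) * Real.exp (2 * c ^ 2 * t) *
      Real.exp (-‖x‖ ^ 2 / (4 * (2 * t)))) * e2
  rw [e3, mul_assoc, ← Real.exp_add]
  refine mul_le_mul_of_nonneg_left (Real.exp_le_exp.2 ?_) (by positivity)
  have h : 0 ≤ (‖x‖ / (4 * t) - c) ^ 2 * (2 * t) := by positivity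
  have e4 : 2 * c ^ 2 * t + -‖x‖ ^ 2 / (4 * (2 * t)) - (-‖x‖ ^ 2 / (4 * t) + c * ‖x‖) =
      (‖x‖ / (4 * t) - c) ^ 2 * (2 * t) := by
    field_simp
    ring
  linarith

theorem integrable_gaussK_mul_exp {t : ℝ} (ht : 0 < t) (c : ℝ) :
    Integrable (fun x : Space d => gaussK t x * Real.exp (c * ‖x‖)) := by
  refine ((integrable_gaussK (d := d) (t := 2 * t) (by positivity)).const_mul
    (2 ^ (d / 2 : ℝ) * Real.exp (2 * c ^ 2 * t))).mono'
    ((continuous_gaussK t).mul (by fun_prop)).aestronglyMeasurable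
    (Eventually.of_forall fun x => ?_)
  rw [Real.norm_of_nonneg (mul_nonneg (gaussK_nonneg ht x) (Real.exp_nonneg _))]
  exact gaussK_mul_exp_le ht x

/-- Exponential moments of the heat kernel. -/
theorem integral_gaussK_mul_exp_le {t : ℝ} (ht : 0 < t) (c : ℝ) :
    ∫ x : Space d, gaussK t x * Real.exp (c * ‖x‖) ≤
      2 ^ (d / 2 : ℝ) * Real.exp (2 * c ^ 2 * t) := by
  calc ∫ x : Space d, gaussK t x * Real.exp (c * ‖x‖)
      ≤ ∫ x : Space d, 2 ^ (d / 2 : ℝ) * Real.exp (2 * c ^ 2 * t) * gaussK (2 * t) x :=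
        integral_mono (integrable_gaussK_mul_exp ht c)
          ((integrable_gaussK (by positivity)).const_mul _) fun x => gaussK_mul_exp_le ht x
    _ = _ := by rw [integral_const_mul, integral_gaussK (by positivity), mul_one]

theorem gaussK_smul {t : ℝ} (ht : 0 < t) (y : Space d) :
    gaussK 1 y = (√t) ^ d * gaussK t (√t • y) := by
  have h0 : 0 < √t := Real.sqrt_pos.2 ht
  have e1 : ((√t) ^ d : ℝ) = t ^ (d / 2 : ℝ) := by
    rw [Real.sqrt_eq_rpow, ← Real.rpow_natCast, ← Real.rpow_mul ht.le]
    congr 1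
    ring
  rw [gaussK, gaussK, norm_smul, mul_pow, Real.norm_of_nonneg h0.le, Real.sq_sqrt ht.le, e1,
    mul_one, Real.mul_rpow (by positivity) ht.le, Real.rpow_neg ht.le]
  have : t ^ (d / 2 : ℝ) ≠ 0 := by positivity
  field_simp

/-! ### The heat flow of test functions -/

/-- The heat flow `exp (t Δ) φ`, written through the standard kernel so that `t = 0` gives `φ`. -/
def heat (t : ℝ) (φ : Space d → ℝ) (x : Space d) : ℝ := ∫ y, gaussK 1 y * φ (x - √t • y)

theorem heat_zero (φ : Space d → ℝ) : heat 0 φ = φ := by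
  funext x
  rw [heat]
  simp only [Real.sqrt_zero, zero_smul, sub_zero]
  rw [integral_mul_const, integral_gaussK one_pos, one_mul]

theorem heat_eq_conv {t : ℝ} (ht : 0 < t) (φ : Space d → ℝ) (x : Space d) :
    heat t φ x = ∫ y, gaussK t (x - y) * φ y := by
  have h0 : 0 < √t := Real.sqrt_pos.2 ht
  have h1 : ∫ y, gaussK t (x - y) * φ y = ∫ y, gaussK t y * φ (x - y) := by
    rw [← integral_sub_left_eq_self (fun y => gaussK t (x - y) * φ y) volume x]
    simp only [sub_sub_cancel]
  have h2 := Measure.integral_comp_smul volume (fun y : Space d => gaussK t y * φ (x - y)) (√t)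
  rw [finrank_euclideanSpace_fin] at h2
  rw [h1, heat]
  have h3 : ∀ y : Space d, gaussK 1 y * φ (x - √t • y) =
      (√t) ^ d * (gaussK t (√t • y) * φ (x - √t • y)) := by
    intro y
    rw [gaussK_smul ht]
    ring
  simp only [h3]
  rw [integral_const_mul, h2, abs_of_pos (by positivity), smul_eq_mul, ← mul_assoc,
    mul_inv_cancel₀ (by positivity), one_mul]

theorem continuous_heat {φ : Space d → ℝ} (h : IsTest φ) :
    Continuous (fun p : ℝ × Space d => heat p.1 φ p.2) := by
  obtain ⟨M, hM⟩ := h.exists_bound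
  refine continuous_of_dominated (bound := fun y => gaussK 1 y * M) ?_ ?_ ?_ ?_
  · intro p
    exact ((continuous_gaussK 1).mul (h.continuous.comp (by fun_prop))).aestronglyMeasurable
  · intro p
    refine Eventually.of_forall fun y => ?_
    rw [norm_mul, Real.norm_of_nonneg (gaussK_nonneg one_pos y)]
    exact mul_le_mul_of_nonneg_left (hM _) (gaussK_nonneg one_pos y)
  · exact (integrable_gaussK one_pos).mul_const M
  · refine Eventually.of_forall fun y => ?_
    refine continuous_const.mul (h.continuous.comp ?_)
    have : Continuous (fun p : ℝ × Space d => √p.1) := Real.continuous_sqrt.comp continuous_fst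
    fun_prop

theorem heat_nonneg {φ : Space d → ℝ} (h : ∀ x, 0 ≤ φ x) (t : ℝ) (x : Space d) :
    0 ≤ heat t φ x :=
  integral_nonneg fun y => mul_nonneg (gaussK_nonneg one_pos y) (h _)

theorem abs_heat_le {t : ℝ} (ht : 0 < t) {φ : Space d → ℝ} (h : Integrable φ) (x : Space d) :
    |heat t φ x| ≤ (4 * Real.pi * t) ^ (-(d / 2 : ℝ)) * ∫ y, |φ y| := by
  rw [heat_eq_conv ht, ← integral_const_mul, ← Real.norm_eq_abs]
  refine norm_integral_le_of_norm_le (h.abs.const_mul _) (Eventually.of_forall fun y => ?_)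
  rw [norm_mul, Real.norm_of_nonneg (gaussK_nonneg ht _)]
  exact mul_le_mul_of_nonneg_right (gaussK_le ht _) (norm_nonneg _)

/-- Exponential decay of the heat flow of a function supported in a ball. -/
theorem abs_heat_mul_exp_le {φ : Space d → ℝ} {M ρ b : ℝ} {x₀ : Space d}
    (hM : ∀ x, |φ x| ≤ M) (hρ : ∀ x, φ x ≠ 0 → ‖x - x₀‖ ≤ ρ) (hb : 0 ≤ b) {t : ℝ} (ht : 0 ≤ t)
    (x : Space d) : |heat t φ x| * Real.exp (b * ‖x - x₀‖) ≤
      M * Real.exp (b * ρ) * (2 ^ (d / 2 : ℝ) * Real.exp (2 * b ^ 2 * t)) := by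
  have hM0 : 0 ≤ M := (abs_nonneg _).trans (hM x₀)
  have h1 := integral_gaussK_mul_exp_le (d := d) one_pos (b * √t)
  rw [mul_pow, Real.sq_sqrt ht, mul_one, ← mul_assoc] at h1
  refine le_trans ?_ (mul_le_mul_of_nonneg_left h1 (by positivity))
  rw [← Real.norm_eq_abs, heat, ← Real.norm_of_nonneg (Real.exp_nonneg (b * ‖x - x₀‖)), ← norm_mul,
    ← integral_mul_const, ← integral_const_mul]
  refine norm_integral_le_of_norm_le ((integrable_gaussK_mul_exp one_pos _).const_mul _)
    (Eventually.of_forall fun y => ?_)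
  rw [norm_mul, norm_mul, Real.norm_of_nonneg (gaussK_nonneg one_pos _),
    Real.norm_of_nonneg (Real.exp_nonneg _), Real.norm_eq_abs]
  have hg := gaussK_nonneg (d := d) one_pos y
  by_cases h : φ (x - √t • y) = 0
  · rw [h, abs_zero, mul_zero, zero_mul]
    positivity
  · have h2 := hρ _ h
    have h3 : ‖x - x₀‖ ≤ ρ + √t * ‖y‖ := by
      have e : x - x₀ = (x - √t • y - x₀) + √t • y := by abel
      calc ‖x - x₀‖ ≤ ‖x - √t • y - x₀‖ + ‖√t • y‖ := by
            conv_lhs => rw [e]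
            exact norm_add_le _ _
        _ ≤ ρ + √t * ‖y‖ := by
          rw [norm_smul, Real.norm_of_nonneg (Real.sqrt_nonneg _)]
          gcongr
    have h4 : Real.exp (b * ‖x - x₀‖) ≤ Real.exp (b * ρ) * Real.exp (b * √t * ‖y‖) := by
      rw [← Real.exp_add]
      refine Real.exp_le_exp.2 ?_
      calc b * ‖x - x₀‖ ≤ b * (ρ + √t * ‖y‖) := by gcongr
        _ = _ := by ring
    calc gaussK 1 y * |φ (x - √t • y)| * Real.exp (b * ‖x - x₀‖)
        ≤ gaussK 1 y * M * (Real.exp (b * ρ) * Real.exp (b * √t * ‖y‖)) := by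
          gcongr
          exact hM _
      _ = _ := by ring

theorem IsTest.exists_radius {φ : Space d → ℝ} (h : IsTest φ) (x₀ : Space d) :
    ∃ ρ : ℝ, ∀ x, φ x ≠ 0 → ‖x - x₀‖ ≤ ρ := by
  obtain ⟨ρ, hρ⟩ := h.2.isCompact.isBounded.subset_closedBall x₀
  refine ⟨ρ, fun x hx => ?_⟩
  have := hρ (subset_tsupport φ hx)
  rwa [Metric.mem_closedBall, dist_eq_norm] at this

/-- On bounded time intervals, the heat flow of a test function decays faster than any
exponential. -/
theorem IsTest.exists_heat_bound {φ : Space d → ℝ} (h : IsTest φ) {b : ℝ} (hb : 0 ≤ b) (T : ℝ) :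
    ∃ C : ℝ, 0 ≤ C ∧ ∀ t, t ≤ T → ∀ x, |heat t φ x| ≤ C * Real.exp (-(b * ‖x‖)) := by
  obtain ⟨M, hM⟩ := h.exists_bound
  obtain ⟨ρ, hρ⟩ := h.exists_radius 0
  have hM0 : 0 ≤ M := (abs_nonneg _).trans (hM 0)
  refine ⟨M * Real.exp (b * ρ) * (2 ^ (d / 2 : ℝ) * Real.exp (2 * b ^ 2 * max T 0)),
    by positivity, fun t ht x => ?_⟩
  rw [Real.exp_neg, ← div_eq_mul_inv, le_div_iff₀ (Real.exp_pos _)]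
  have hmax : heat t φ x = heat (max t 0) φ x := by
    rcases le_total t 0 with h0 | h0
    · rw [max_eq_right h0, heat, heat, Real.sqrt_eq_zero_of_nonpos h0, Real.sqrt_zero]
    · rw [max_eq_left h0]
  rw [hmax]
  have h1 := abs_heat_mul_exp_le (x₀ := 0) hM hρ hb (le_max_right t 0) x
  rw [sub_zero] at h1
  refine h1.trans ?_
  gcongr

theorem integrable_exp_neg_norm : Integrable (fun x : Space d => Real.exp (-‖x‖)) := by
  have h := (integrable_one_add_norm (E := Space d) (μ := volume) (r := (d + 1 : ℝ)) (by
    rw [finrank_euclideanSpace_fin]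
    linarith)).const_mul (Real.exp 1 * (d + 1).factorial)
  refine h.mono' (by fun_prop) (Eventually.of_forall fun x => ?_)
  rw [Real.norm_of_nonneg (Real.exp_nonneg _)]
  have h1 := Real.pow_div_factorial_le_exp (x := 1 + ‖x‖) (by positivity) (d + 1)
  rw [Real.exp_add, div_le_iff₀ (by positivity)] at h1
  rw [Real.exp_neg, Real.rpow_neg (by positivity), ← div_eq_mul_inv, inv_eq_one_div,
    div_le_div_iff₀ (Real.exp_pos _) (by positivity), one_mul]
  have e : (1 + ‖x‖) ^ (d + 1 : ℝ) = (1 + ‖x‖) ^ (d + 1) := by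
    rw [← Real.rpow_natCast]
    push_cast
    rfl
  rw [e]
  linarith

theorem memLp_exp_neg_norm : MemLp (fun x : Space d => Real.exp (-‖x‖)) 2 volume := by
  rw [memLp_two_iff_integrable_sq (by fun_prop)]
  refine integrable_exp_neg_norm.mono' (by fun_prop) (Eventually.of_forall fun x => ?_)
  rw [Real.norm_of_nonneg (by positivity), sq, ← Real.exp_add, Real.exp_le_exp]
  linarith [norm_nonneg x]

/-- A potential of at most exponential growth. -/
structure HasExpGrowth (A a : ℝ) (U : Space d → ℝ) : Prop where
  nonneg : 0 ≤ a
  meas : AEStronglyMeasurable U volume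
  le : ∀ᵐ x, |U x| ≤ A * Real.exp (a * ‖x‖)

theorem hasExpGrowth_one : HasExpGrowth 1 0 (fun _ : Space d => (1 : ℝ)) :=
  ⟨le_rfl, aestronglyMeasurable_const, Eventually.of_forall fun x => by simp⟩

theorem HasExpGrowth.coeff_nonneg {A a : ℝ} {U : Space d → ℝ} (hU : HasExpGrowth A a U) :
    0 ≤ A := by
  obtain ⟨x, hx⟩ := hU.le.exists
  by_contra! h
  have : A * Real.exp (a * ‖x‖) < 0 := mul_neg_of_neg_of_pos h (Real.exp_pos _)
  linarith [abs_nonneg (U x)]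

theorem exists_mul_heat_bound {A a : ℝ} {U : Space d → ℝ} (hU : HasExpGrowth A a U)
    {φ : Space d → ℝ} (h : IsTest φ) (T : ℝ) :
    ∃ C : ℝ, 0 ≤ C ∧ ∀ t, t ≤ T → ∀ᵐ x, |U x * heat t φ x| ≤ C * Real.exp (-‖x‖) := by
  obtain ⟨C, hC0, hC⟩ := h.exists_heat_bound (b := a + 1) (by linarith [hU.nonneg]) T
  refine ⟨A * C, mul_nonneg hU.coeff_nonneg hC0, fun t ht => ?_⟩
  filter_upwards [hU.le] with x hx
  rw [abs_mul]
  calc |U x| * |heat t φ x| ≤ (A * Real.exp (a * ‖x‖)) * (C * Real.exp (-((a + 1) * ‖x‖))) :=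
        mul_le_mul hx (hC t ht x) (abs_nonneg _) ((abs_nonneg _).trans hx)
    _ = A * C * (Real.exp (a * ‖x‖) * Real.exp (-((a + 1) * ‖x‖))) := by ring
    _ = _ := by
      rw [← Real.exp_add]
      congr 2
      ring

theorem memLp_mul_heat {A a : ℝ} {U : Space d → ℝ} (hU : HasExpGrowth A a U)
    {φ : Space d → ℝ} (h : IsTest φ) (t : ℝ) : MemLp (fun x => U x * heat t φ x) 2 volume := by
  obtain ⟨C, hC0, hC⟩ := exists_mul_heat_bound hU h t
  refine (memLp_exp_neg_norm.const_mul C).mono' (hU.meas.mul ?_) (hC t le_rfl)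
  exact ((continuous_heat h).comp (by fun_prop : Continuous fun x : Space d => (t, x))
    ).aestronglyMeasurable

theorem memLp_heat {φ : Space d → ℝ} (h : IsTest φ) (t : ℝ) : MemLp (heat t φ) 2 volume := by
  simpa only [one_mul] using memLp_mul_heat hasExpGrowth_one h t

theorem continuous_rL2_mul_heat {A a : ℝ} {U : Space d → ℝ} (hU : HasExpGrowth A a U)
    {φ : Space d → ℝ} (h : IsTest φ) : Continuous (fun t => rL2 (fun x => U x * heat t φ x)) := by
  refine continuous_iff_continuousAt.2 fun t => ?_
  obtain ⟨C, hC0, hC⟩ := exists_mul_heat_bound hU h (t + 1)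
  refine tendsto_toL2 (b := fun x => C * Real.exp (-‖x‖)) ?_ ?_ (memLp_exp_neg_norm.const_mul C)
    ?_ ?_ ?_
  · exact Eventually.of_forall fun s => (memLp_mul_heat hU h s).ofReal.1
  · exact (memLp_mul_heat hU h t).ofReal.1
  · filter_upwards [gt_mem_nhds (show t < t + 1 by linarith)] with s hs
    filter_upwards [hC s hs.le] with x hx
    rwa [Complex.norm_real]
  · filter_upwards [hC t (by linarith)] with x hx
    rwa [Complex.norm_real]
  · refine Eventually.of_forall fun x => ?_
    have h1 : Continuous (fun s : ℝ => ((U x * heat s φ x : ℝ) : ℂ)) :=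
      Complex.continuous_ofReal.comp (continuous_const.mul
        ((continuous_heat h).comp (by fun_prop : Continuous fun s : ℝ => (s, x))))
    exact h1.tendsto t

theorem continuous_rL2_heat {φ : Space d → ℝ} (h : IsTest φ) :
    Continuous (fun t => rL2 (heat t φ)) := by
  simpa only [one_mul] using continuous_rL2_mul_heat hasExpGrowth_one h

end

section

theorem IsTest.integrable_smul {η : Space d → ℝ} (h : IsTest η) (f : OneParticle d) :
    Integrable (fun x => η x • f x) :=
  ((Lp.memLp f).locallyIntegrable (by norm_num)).integrable_smul_left_of_hasCompactSupport
    h.continuous h.2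

theorem continuous_corr {η : Space d → ℝ} (h : IsTest η) (f : OneParticle d) :
    Continuous (corr η f) := (differentiable_corr h f).continuous

theorem integrable_gaussK_smul_corr {η : Space d → ℝ} (h : IsTest η) (f : OneParticle d) (s : ℝ) :
    Integrable (fun y : Space d => gaussK 1 y • corr η f (s • y)) := by
  refine ((integrable_gaussK (d := d) one_pos).mul_const (‖rL2 η‖ * ‖f‖)).mono'
    ((continuous_gaussK 1).smul ((continuous_corr h f).comp (by fun_prop))).aestronglyMeasurable
    (Eventually.of_forall fun y => ?_)
  rw [norm_smul, Real.norm_of_nonneg (gaussK_nonneg one_pos y)]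
  exact mul_le_mul_of_nonneg_left (norm_corr_le h f _) (gaussK_nonneg one_pos y)

/-- Pairing the heat flow of a test function with an `L²` function, by Fubini. -/
theorem inner_heat {φ : Space d → ℝ} (h : IsTest φ) (f : OneParticle d) (t : ℝ) :
    inner ℂ (rL2 (heat t φ)) f = ∫ y, gaussK 1 y • corr φ f (√t • y) := by
  rw [inner_rL2 (memLp_heat h t)]
  have hmeas : AEStronglyMeasurable (fun p : Space d × Space d =>
      (gaussK 1 p.2 * φ (p.1 - √t • p.2)) • f p.1) (volume.prod volume) := by
    have hc : Continuous (fun p : Space d × Space d => gaussK 1 p.2 * φ (p.1 - √t • p.2)) :=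
      ((continuous_gaussK 1).comp continuous_snd).mul (h.continuous.comp (by fun_prop))
    exact hc.aestronglyMeasurable.smul (Lp.memLp f).1.comp_fst
  have hint : Integrable (fun p : Space d × Space d =>
      (gaussK 1 p.2 * φ (p.1 - √t • p.2)) • f p.1) (volume.prod volume) := by
    rw [integrable_prod_iff' hmeas]
    constructor
    · refine Eventually.of_forall fun y => ?_
      simp only [mul_smul]
      have h1 : IsTest (fun x => φ (x - √t • y)) := h.comp_sub _
      have h2 : Integrable (fun x => φ (x - √t • y) • f x) :=
        h1.integrable_smul f
      exact h2.smul (gaussK 1 y)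
    · have hb : ∀ y : Space d, ∫ x, ‖(gaussK 1 y * φ (x - √t • y)) • f x‖ ≤
          gaussK 1 y * (‖rL2 φ‖ * ‖f‖) := by
        intro y
        have h1 : IsTest (fun x => φ (x - √t • y)) := h.comp_sub _
        have e : ∀ x, ‖(gaussK 1 y * φ (x - √t • y)) • f x‖ =
            gaussK 1 y * (‖φ (x - √t • y)‖ * ‖f x‖) := by
          intro x
          rw [norm_smul, norm_mul, Real.norm_of_nonneg (gaussK_nonneg one_pos y), mul_assoc]
        simp only [e]
        rw [integral_const_mul]
        refine mul_le_mul_of_nonneg_left ?_ (gaussK_nonneg one_pos y)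
        rw [← norm_rL2_comp_sub h (√t • y)]
        have h2 := norm_inner_le_norm (𝕜 := ℂ) (absL2 (rL2 (fun x => φ (x - √t • y)))) (absL2 f)
        rw [norm_absL2, norm_absL2] at h2
        refine le_trans (le_of_eq ?_) h2
        rw [inner_eq_integral]
        have e2 : ∫ x, starRingEnd ℂ (absL2 (rL2 (fun x => φ (x - √t • y))) x) * absL2 f x =
            ((∫ x, ‖φ (x - √t • y)‖ * ‖f x‖ : ℝ) : ℂ) := by
          rw [← integral_complex_ofReal]
          refine integral_congr_ae ?_
          filter_upwards [coeFn_absL2 f, coeFn_absL2 (rL2 (fun x => φ (x - √t • y))),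
            coeFn_rL2 (h1.memLp 2)] with x h3 h4 h5
          rw [h3, h4, h5, Complex.conj_ofReal, Complex.norm_real]
          push_cast
          rfl
        rw [e2, Complex.norm_real, Real.norm_of_nonneg]
        exact integral_nonneg fun x => by positivity
      refine ((integrable_gaussK (d := d) one_pos).mul_const (‖rL2 φ‖ * ‖f‖)).mono'
        hmeas.norm.prod_swap.integral_prod_right' (Eventually.of_forall fun y => ?_)
      rw [Real.norm_of_nonneg (integral_nonneg fun x => norm_nonneg _)]
      exact hb y
  have e1 : ∀ x, heat t φ x • f x = ∫ y, (gaussK 1 y * φ (x - √t • y)) • f x := by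
    intro x
    rw [integral_smul_const]
    rfl
  simp only [e1]
  rw [integral_integral_swap hint]
  refine integral_congr_ae (Eventually.of_forall fun y => ?_)
  simp only [mul_smul]
  rw [integral_smul]
  rfl

theorem IsTest.hasWeakGradient {η : Space d → ℝ} (h : IsTest η) :
    HasWeakGradient (rL2 η) (fun i => rL2 (Counterterm.partialDeriv i η)) := by
  intro i φ hφ1 hφ2
  have hφ : IsTest φ := ⟨hφ1, hφ2⟩
  have e1 : ∫ x, Counterterm.partialDeriv i φ x • rL2 η x =
      ((∫ x, η x * Counterterm.partialDeriv i φ x : ℝ) : ℂ) := by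
    rw [← integral_complex_ofReal]
    refine integral_congr_ae ?_
    filter_upwards [coeFn_rL2 (h.memLp 2)] with x hx
    rw [hx, Complex.real_smul]
    push_cast
    ring
  have e2 : ∫ x, φ x • rL2 (Counterterm.partialDeriv i η) x =
      ((∫ x, Counterterm.partialDeriv i η x * φ x : ℝ) : ℂ) := by
    rw [← integral_complex_ofReal]
    refine integral_congr_ae ?_
    filter_upwards [coeFn_rL2 ((h.partialDeriv i).memLp 2)] with x hx
    rw [hx, Complex.real_smul]
    push_cast
    ring
  have hmul : ∀ {α β : Space d → ℝ}, IsTest α → IsTest β → Integrable (fun x => α x * β x) :=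
    fun ha hb => (ha.memLp 2).integrable_mul (hb.memLp 2)
  rw [e1, e2, ← Complex.ofReal_neg]
  congr 1
  exact integral_mul_fderiv_eq_neg_fderiv_mul_of_integrable (hmul (h.partialDeriv i) hφ)
    (hmul h (hφ.partialDeriv i)) (hmul h hφ) (fun x _ => h.differentiable x)
    (fun x _ => hφ.differentiable x)

theorem HasWeakGradient.inner_heat {f : OneParticle d} {F : Fin d → OneParticle d}
    (hF : HasWeakGradient f F) {φ : Space d → ℝ} (h : IsTest φ) (t : ℝ) (i : Fin d) :
    inner ℂ (rL2 (heat t (partialDeriv i φ))) f = - inner ℂ (rL2 (heat t φ)) (F i) := by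
  rw [Counterterm.inner_heat (h.partialDeriv i), Counterterm.inner_heat h, ← integral_neg]
  refine integral_congr_ae (Eventually.of_forall fun y => ?_)
  simp only
  rw [hF.inner_comp_sub h, smul_neg]

theorem hasWeakGradient_heat {φ : Space d → ℝ} (h : IsTest φ) (t : ℝ) :
    HasWeakGradient (rL2 (heat t φ)) (fun i => rL2 (heat t (partialDeriv i φ))) := by
  rw [hasWeakGradient_iff]
  intro i η hη
  have h1 := hη.hasWeakGradient.inner_heat h t i
  rw [← inner_conj_symm, ← inner_conj_symm (rL2 η), h1, map_neg, neg_neg]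

theorem isTest_finset_sum {ι : Type*} (s : Finset ι) {φ : ι → Space d → ℝ}
    (h : ∀ i, IsTest (φ i)) : IsTest (fun x => ∑ i ∈ s, φ i x) := by
  classical
  refine ⟨ContDiff.sum fun i _ => (h i).1, ?_⟩
  induction s using Finset.induction_on with
  | empty => simpa using! HasCompactSupport.zero (α := Space d) (β := ℝ)
  | insert a s ha ih =>
    simp only [Finset.sum_insert ha]
    exact (h a).2.add ih

/-- The Laplacian of a test function. -/
def lapl (φ : Space d → ℝ) (x : Space d) : ℝ := ∑ i, partialDeriv i (partialDeriv i φ) x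

theorem IsTest.lapl {φ : Space d → ℝ} (h : IsTest φ) : IsTest (lapl φ) :=
  isTest_finset_sum _ fun i => (h.partialDeriv i).partialDeriv i

theorem corr_lapl {φ : Space d → ℝ} (h : IsTest φ) (f : OneParticle d) (z : Space d) :
    corr (lapl φ) f z = ∑ i, corr (partialDeriv i (partialDeriv i φ)) f z := by
  simp only [corr, lapl]
  rw [← integral_finsetSum]
  · refine integral_congr_ae (Eventually.of_forall fun x => ?_)
    simp only
    rw [Finset.sum_smul]
  · intro i _
    exact (((h.partialDeriv i).partialDeriv i).comp_sub z).integrable_smul f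

theorem inner_heat_lapl {φ : Space d → ℝ} (h : IsTest φ) (f : OneParticle d) (t : ℝ) :
    inner ℂ (rL2 (heat t (lapl φ))) f =
      ∑ i, inner ℂ (rL2 (heat t (partialDeriv i (partialDeriv i φ)))) f := by
  have hi := fun i => (h.partialDeriv i).partialDeriv i
  simp only [inner_heat h.lapl, fun i => inner_heat (hi i) f t]
  rw [← integral_finsetSum _ fun i _ => integrable_gaussK_smul_corr (hi i) f (√t)]
  refine integral_congr_ae (Eventually.of_forall fun y => ?_)
  simp only
  rw [corr_lapl h, Finset.smul_sum]

theorem euclidean_eq_sum (y : Space d) : y = ∑ i, y i • basisVec i := by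
  ext j
  simp [Finset.sum_apply, Pi.single_apply]

theorem fderiv_apply_eq_sum {c : Space d → ℂ} (z y : Space d) :
    fderiv ℝ c z y = ∑ i, y i • fderiv ℝ c z (basisVec i) := by
  conv_lhs => rw [euclidean_eq_sum y]
  rw [map_sum]
  simp only [map_smul]

theorem abs_apply_le_norm (y : Space d) (i : Fin d) : |y i| ≤ ‖y‖ := by
  have := PiLp.norm_apply_le y i
  rwa [Real.norm_eq_abs] at this

theorem fderiv_gaussK (y : Space d) (i : Fin d) :
    fderiv ℝ (gaussK 1) y (basisVec i) = -(y i / 2) * gaussK 1 y := by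
  have h1 : HasFDerivAt (fun x : Space d => ‖x‖ ^ 2) (2 • (innerSL ℝ y)) y := by
    simpa using! (hasStrictFDerivAt_norm_sq y).hasFDerivAt
  have h2 : HasFDerivAt (fun x : Space d => -‖x‖ ^ 2 / (4 * 1))
      ((-(1 / 4 : ℝ)) • (2 • (innerSL ℝ y)))
      y := by
    have := h1.const_mul (-(1 / 4 : ℝ))
    refine this.congr_of_eventuallyEq (Eventually.of_forall fun x => ?_)
    simp only
    ring
  have h3 := (h2.exp).const_mul ((4 * Real.pi * 1) ^ (-(d / 2 : ℝ)))
  have h4 : HasFDerivAt (gaussK 1 : Space d → ℝ) _ y := h3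
  rw [h4.fderiv]
  simp only [gaussK, smul_apply, innerSL_apply_apply, smul_eq_mul, nsmul_eq_mul]
  rw [EuclideanSpace.inner_single_right]
  simp
  ring

theorem differentiable_gaussK : Differentiable ℝ (gaussK 1 : Space d → ℝ) := by
  have : Differentiable ℝ (fun x : Space d => ‖x‖ ^ 2) := fun x =>
    (hasStrictFDerivAt_norm_sq x).hasFDerivAt.differentiableAt
  unfold gaussK
  have h2 : Differentiable ℝ (fun x : Space d => -‖x‖ ^ 2 / (4 * 1)) := by
    simpa only [div_eq_mul_inv] using this.fun_neg.mul_const _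
  exact h2.exp.const_mul _

theorem integrable_norm_mul_gaussK : Integrable (fun y : Space d => ‖y‖ * gaussK 1 y) := by
  refine (integrable_gaussK_mul_exp (d := d) one_pos 1).mono'
    (continuous_norm.mul (continuous_gaussK 1)).aestronglyMeasurable
    (Eventually.of_forall fun y => ?_)
  have hg := gaussK_nonneg (d := d) one_pos y
  rw [Real.norm_of_nonneg (mul_nonneg (norm_nonneg _) hg), mul_comm]
  refine mul_le_mul_of_nonneg_left ?_ hg
  have := Real.add_one_le_exp (1 * ‖y‖)
  linarith

/-- The heat equation, tested against an `L²` function. -/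
theorem hasDerivAt_inner_heat {φ : Space d → ℝ} (h : IsTest φ) (f : OneParticle d) {t : ℝ}
    (ht : 0 < t) : HasDerivAt (fun s => inner ℂ (rL2 (heat s φ)) f)
      (inner ℂ (rL2 (heat t (lapl φ))) f) t := by
  simp only [inner_heat h]
  set c := corr φ f with hc
  set M : ℝ := ∑ i, ‖rL2 (partialDeriv i φ)‖ * ‖f‖ with hM
  have hM0 : 0 ≤ M := Finset.sum_nonneg fun i _ => by positivity
  have hfd : ∀ z y : Space d, ‖fderiv ℝ c z y‖ ≤ M * ‖y‖ := by
    intro z y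
    rw [fderiv_apply_eq_sum, hM, Finset.sum_mul]
    refine (norm_sum_le _ _).trans (Finset.sum_le_sum fun i _ => ?_)
    rw [norm_smul, hc, fderiv_corr h, norm_neg, Real.norm_eq_abs, mul_comm]
    exact mul_le_mul (norm_corr_le (h.partialDeriv i) f z) (abs_apply_le_norm y i) (abs_nonneg _)
      (by positivity)
  have hcurve : ∀ s : ℝ, 0 < s → ∀ y : Space d,
      HasDerivAt (fun s : ℝ => √s • y) ((1 / (2 * √s)) • y) s := fun s hs y =>
    (Real.hasDerivAt_sqrt hs.ne').smul_const y
  have hcfd : Continuous (fun y : Space d => fderiv ℝ c (√t • y) ((1 / (2 * √t)) • y)) := by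
    have : (fun y : Space d => fderiv ℝ c (√t • y) ((1 / (2 * √t)) • y)) = fun y : Space d =>
        ∑ i, ((1 / (2 * √t)) * y i) • -corr (partialDeriv i φ) f (√t • y) := by
      funext y
      rw [fderiv_apply_eq_sum]
      refine Finset.sum_congr rfl fun i _ => ?_
      rw [hc, fderiv_corr h]
      rfl
    rw [this]
    refine continuous_finsetSum _ fun i _ => ?_
    have h1 := continuous_corr (h.partialDeriv i) f
    have h2 : Continuous fun y : Space d => corr (partialDeriv i φ) f (√t • y) :=
      h1.comp (by fun_prop)
    exact Continuous.smul (by fun_prop : Continuous fun y : Space d => (1 / (2 * √t)) * y i) h2.neg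
  -- time enters through the argument of the smooth function `c` only, so that one can differentiate
  -- under the integral sign
  have key := hasDerivAt_integral_of_dominated_loc_of_deriv_le (μ := (volume : Measure (Space d)))
    (F := fun s y => gaussK 1 y • c (√s • y)) (x₀ := t) (s := Ioi (t / 2))
    (F' := fun s y => gaussK 1 y • fderiv ℝ c (√s • y) ((1 / (2 * √s)) • y))
    (bound := fun y => (M * (1 / (2 * √(t / 2)))) * (‖y‖ * gaussK 1 y))
    (Ioi_mem_nhds (by linarith)) ?_ (integrable_gaussK_smul_corr h f _) ?_ ?_
    (integrable_norm_mul_gaussK.const_mul _) ?_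
  rotate_left
  · refine Eventually.of_forall fun s => ?_
    exact (integrable_gaussK_smul_corr h f _).1
  · exact ((continuous_gaussK 1).smul hcfd).aestronglyMeasurable
  · refine Eventually.of_forall fun y s hs => ?_
    have hs' : t / 2 < s := hs
    have hg := gaussK_nonneg (d := d) one_pos y
    rw [norm_smul, Real.norm_of_nonneg hg]
    have h1 := hfd (√s • y) ((1 / (2 * √s)) • y)
    rw [norm_smul, Real.norm_of_nonneg (by positivity)] at h1
    have h2 : 1 / (2 * √s) ≤ 1 / (2 * √(t / 2)) := by
      have : 0 < √(t / 2) := Real.sqrt_pos.2 (by linarith)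
      gcongr
    calc gaussK 1 y * ‖fderiv ℝ c (√s • y) ((1 / (2 * √s)) • y)‖
        ≤ gaussK 1 y * (M * ((1 / (2 * √(t / 2))) * ‖y‖)) := by
          refine mul_le_mul_of_nonneg_left (h1.trans ?_) hg
          gcongr
      _ = _ := by ring
  · refine Eventually.of_forall fun y s hs => ?_
    have hs' : t / 2 < s := hs
    have h1 := (differentiable_corr h f (√s • y)).hasFDerivAt.comp_hasDerivAt s
      (hcurve s (by linarith) y)
    exact h1.const_smul (gaussK 1 y)
  -- an integration by parts, with `∂ᵢ g₁ = -(yᵢ / 2) g₁`, turns the result into a Laplacian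
  have hval : ∫ y : Space d, gaussK 1 y • fderiv ℝ c (√t • y) ((1 / (2 * √t)) • y) =
      inner ℂ (rL2 (heat t (lapl φ))) f := by
    have hst : 0 < √t := Real.sqrt_pos.2 ht
    rw [inner_heat_lapl h]
    have e1 : ∀ y : Space d, gaussK 1 y • fderiv ℝ c (√t • y) ((1 / (2 * √t)) • y) =
        ∑ i, (1 / √t) • (fderiv ℝ (gaussK 1) y (basisVec i) •
          corr (partialDeriv i φ) f (√t • y)) := by
      intro y
      rw [fderiv_apply_eq_sum, Finset.smul_sum]
      refine Finset.sum_congr rfl fun i _ => ?_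
      rw [hc, fderiv_corr h, fderiv_gaussK, PiLp.smul_apply, smul_neg, smul_neg, smul_smul,
        smul_smul, ← neg_smul]
      congr 1
      simp only [smul_eq_mul]
      field_simp
    simp only [e1]
    have hint1 : ∀ i, Integrable (fun y : Space d => fderiv ℝ (gaussK 1) y (basisVec i) •
        corr (partialDeriv i φ) f (√t • y)) := by
      intro i
      simp only [fderiv_gaussK]
      have hcc := continuous_corr (h.partialDeriv i) f
      have hcg := continuous_gaussK (d := d) 1
      refine (integrable_norm_mul_gaussK.mul_const (‖rL2 (partialDeriv i φ)‖ * ‖f‖)).mono' ?_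
        (Eventually.of_forall fun y => ?_)
      · refine Continuous.aestronglyMeasurable ?_
        exact Continuous.smul ((by fun_prop : Continuous fun y : Space d => -(y i / 2)).mul hcg)
          (hcc.comp (by fun_prop))
      · have hg := gaussK_nonneg (d := d) one_pos y
        rw [norm_smul, norm_mul, norm_neg, Real.norm_of_nonneg hg]
        have h1 : ‖y i / 2‖ ≤ ‖y‖ := by
          rw [Real.norm_eq_abs, abs_div, abs_two]
          have := abs_apply_le_norm y i
          have := abs_nonneg (y i)
          linarith
        exact mul_le_mul (mul_le_mul_of_nonneg_right h1 hg)
          (norm_corr_le (h.partialDeriv i) f _) (norm_nonneg _) (by positivity)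
    have hint2 : ∀ i ∈ (Finset.univ : Finset (Fin d)), Integrable (fun y : Space d =>
        (1 / √t) • (fderiv ℝ (gaussK 1) y (basisVec i) •
          corr (partialDeriv i φ) f (√t • y))) := fun i _ => (hint1 i).smul (1 / √t)
    rw [integral_finsetSum _ hint2]
    refine Finset.sum_congr rfl fun i _ => ?_
    rw [integral_smul, inner_heat ((h.partialDeriv i).partialDeriv i)]
    have hi := h.partialDeriv i
    have hdf : Differentiable ℝ (fun y : Space d => corr (partialDeriv i φ) f (√t • y)) :=
      (differentiable_corr hi f).comp (by fun_prop)
    have hfd2 : ∀ y : Space d, fderiv ℝ (fun y : Space d => corr (partialDeriv i φ) f (√t • y)) y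
        (basisVec i) = -(√t • corr (partialDeriv i (partialDeriv i φ)) f (√t • y)) := by
      intro y
      have h1 : HasFDerivAt (fun y : Space d => √t • y)
          (√t • ContinuousLinearMap.id ℝ (Space d)) y :=
        (hasFDerivAt_id y).const_smul (√t)
      have h2 := (differentiable_corr hi f (√t • y)).hasFDerivAt.comp y h1
      have h3 : HasFDerivAt (fun y : Space d => corr (partialDeriv i φ) f (√t • y)) _ y := h2
      rw [h3.fderiv]
      simp only [ContinuousLinearMap.comp_apply, smul_apply, ContinuousLinearMap.id_apply, map_smul]
      rw [fderiv_corr hi, smul_neg]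
    have hparts := integral_bilinear_fderiv_right_eq_neg_left_of_integrable
      (μ := (volume : Measure (Space d))) (B := ContinuousLinearMap.lsmul ℝ ℝ)
      (f := (gaussK 1 : Space d → ℝ))
      (g := fun y : Space d => corr (partialDeriv i φ) f (√t • y)) (v := basisVec i)
      (hint1 i) ?_ (integrable_gaussK_smul_corr hi f _)
      (fun x _ => differentiable_gaussK x) (fun x _ => hdf x)
    · simp only [ContinuousLinearMap.lsmul_apply, hfd2] at hparts
      rw [← neg_eq_iff_eq_neg] at hparts
      rw [← hparts, ← integral_neg, ← integral_smul]
      refine integral_congr_ae (Eventually.of_forall fun y => ?_)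
      simp only
      generalize corr (partialDeriv i (partialDeriv i φ)) f (√t • y) = ζ
      match_scalars
      field_simp
    · simp only [ContinuousLinearMap.lsmul_apply, hfd2]
      have h1 := ((integrable_gaussK_smul_corr (hi.partialDeriv i) f (√t)).smul (-√t))
      refine h1.congr (Eventually.of_forall fun y => ?_)
      simp only [Pi.smul_apply]
      rw [smul_neg, smul_comm (gaussK 1 y), neg_smul]
  rw [← hval]
  exact key.2

/-- The heat equation in `L²`, by integrating its tested version. -/
theorem hasDerivAt_rL2_heat {φ : Space d → ℝ} (h : IsTest φ) {t : ℝ} (ht : 0 < t) :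
    HasDerivAt (fun s => rL2 (heat s φ)) (rL2 (heat t (lapl φ))) t := by
  have hcont := continuous_rL2_heat h.lapl
  have hev : ∀ᶠ s in 𝓝 t, rL2 (heat s φ) =
      rL2 (heat t φ) + ∫ r in t..s, rL2 (heat r (lapl φ)) := by
    filter_upwards [lt_mem_nhds ht] with s hs
    rw [← sub_eq_iff_eq_add']
    refine ext_inner_left ℂ fun g => ?_
    have e1 := ((innerSL ℂ g).restrictScalars ℝ).intervalIntegral_comp_comm
      (hcont.intervalIntegrable (μ := volume) t s)
    change ∫ r in t..s, inner ℂ g (rL2 (heat r (lapl φ))) =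
      inner ℂ g (∫ r in t..s, rL2 (heat r (lapl φ))) at e1
    rw [← e1, inner_sub_right]
    have hd : ∀ r ∈ uIcc t s, HasDerivAt (fun r => inner ℂ g (rL2 (heat r φ)))
        (inner ℂ g (rL2 (heat r (lapl φ)))) r := by
      intro r hr
      have hr0 : 0 < r := (lt_min ht hs).trans_le hr.1
      have h1 := (hasDerivAt_inner_heat h g hr0).star
      simpa only [← starRingEnd_apply, inner_conj_symm] using h1
    rw [intervalIntegral.integral_eq_sub_of_hasDerivAt hd
      ((continuous_const.inner hcont).intervalIntegrable _ _)]
  have h2 : HasDerivAt (fun s => ∫ r in t..s, rL2 (heat r (lapl φ))) (rL2 (heat t (lapl φ))) t :=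
    intervalIntegral.integral_hasDerivAt_right (hcont.intervalIntegrable _ _)
      hcont.stronglyMeasurable.stronglyMeasurableAtFilter hcont.continuousAt
  exact (h2.const_add (rL2 (heat t φ))).congr_of_eventuallyEq hev

end

section

/-! ### Domination of the Schrödinger semigroup by the heat semigroup -/

variable {κ A a : ℝ} {U : Space d → ℝ}

theorem finitePotentialEnergy_heat (hg : HasExpGrowth A a U) {φ : Space d → ℝ} (h : IsTest φ)
    (t : ℝ) : FinitePotentialEnergy U (rL2 (heat t φ)) := by
  have h1 := (memLp_mul_heat hg h t).integrable_mul (memLp_heat h t)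
  refine h1.congr ?_
  filter_upwards [coeFn_rL2 (memLp_heat h t)] with x hx
  rw [hx, Complex.norm_real, Real.norm_eq_abs, sq_abs, Pi.mul_apply]
  ring

/-- The Schrödinger equation tested against the heat flow of a test function. -/
theorem inner_heat_lapl_schrodingerInv (hU : IsCoercive κ U) (hg : HasExpGrowth A a U)
    {φ : Space d → ℝ} (h : IsTest φ) (t : ℝ) (g : OneParticle d) :
    inner ℂ (rL2 (heat t (lapl φ))) (schrodingerInv U g) =
      inner ℂ (rL2 (fun x => U x * heat t φ x)) (schrodingerInv U g) -
        inner ℂ (rL2 (heat t φ)) g := by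
  obtain ⟨F, hF, -, hS⟩ := schrodingerEq_schrodingerInv hU g
  have h1 := hS _ _ (hasWeakGradient_heat h t) (finitePotentialEnergy_heat hg h t)
  have h2 : ∫ x, (U x : ℂ) * (starRingEnd ℂ (rL2 (heat t φ) x) * schrodingerInv U g x) =
      inner ℂ (rL2 (fun x => U x * heat t φ x)) (schrodingerInv U g) := by
    rw [inner_rL2 (memLp_mul_heat hg h t)]
    refine integral_congr_ae ?_
    filter_upwards [coeFn_rL2 (memLp_heat h t)] with x hx
    rw [hx, Complex.conj_ofReal, Complex.real_smul]
    push_cast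
    ring
  rw [inner_heat_lapl h]
  simp only [fun i => hF.inner_heat (h.partialDeriv i) t i]
  rw [Finset.sum_neg_distrib, ← h1, h2]
  ring

/-- A vector orthogonal to the range is orthogonal to the form domain, which contains the test
functions. -/
theorem denseRange_schrodingerInv (hU : IsCoercive κ U) (hg : HasExpGrowth A a U) :
    DenseRange (schrodingerInv U) := by
  have key : (schrodingerInv U).range.topologicalClosure = ⊤ := by
    rw [Submodule.topologicalClosure_eq_top_iff, Submodule.eq_bot_iff]
    intro g hgo
    have h0 : inner ℂ (schrodingerInv U g) g = 0 :=
      (Submodule.mem_orthogonal _ _).1 hgo _ ⟨g, rfl⟩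
    rw [← inner_conj_symm, inner_schrodingerInv, map_eq_zero, inner_self_eq_zero] at h0
    refine eq_of_forall_inner_test fun η hη => ?_
    have hE := finitePotentialEnergy_heat hg hη 0
    rw [heat_zero] at hE
    obtain ⟨z, hz, -⟩ := exists_formDomain hU hη.hasWeakGradient hE
    rw [← hz, inner_zero_right, ← ContinuousLinearMap.adjoint_inner_right, h0, inner_zero_right]
  have := Submodule.dense_iff_topologicalClosure_eq_top.2 key
  exact this

theorem re_inner_eq_integral (f g : OneParticle d) :
    (inner ℂ f g).re = ∫ x, (starRingEnd ℂ (f x) * g x).re := by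
  rw [inner_eq_integral]
  exact (integral_re (𝕜 := ℂ) (integrable_conj_mul f g)).symm

theorem inner_nonneg_of_isNonneg {f g : OneParticle d} (hf : IsNonneg f) (hg : IsNonneg g) :
    0 ≤ (inner ℂ f g).re := by
  rw [re_inner_eq_integral]
  refine integral_nonneg_of_ae ?_
  filter_upwards [hf, hg] with x hx hy
  rw [complex_nonneg_iff] at hx hy
  rw [← hx, ← hy, Complex.conj_ofReal]
  rw [Pi.zero_apply, ← Complex.ofReal_mul, Complex.ofReal_re]
  positivity

theorem isNonneg_rL2 {φ : Space d → ℝ} (h : MemLp φ 2 volume) (h0 : ∀ᵐ x, 0 ≤ φ x) :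
    IsNonneg (rL2 φ) := by
  filter_upwards [coeFn_rL2 h, h0] with x hx hx0
  rw [hx]
  exact Complex.zero_le_real.2 hx0

/-- The derivative of `⟨heat (t - s) φ, S_s f⟩` in `s`. -/
theorem hasDerivAt_inner_heat_heatOp (hU : IsCoercive κ U) (hg : HasExpGrowth A a U)
    {φ : Space d → ℝ} (h : IsTest φ) (f : OneParticle d) {s t : ℝ} (hs : 0 < s) (hst : s < t) :
    HasDerivAt (fun s => inner ℂ (rL2 (heat (t - s) φ)) (heatOp (schrodingerInv U) s f))
      (-inner ℂ (rL2 (fun x => U x * heat (t - s) φ x)) (heatOp (schrodingerInv U) s f)) s := by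
  have hR := isPositive_schrodingerInv U
  have h1 := (hasDerivAt_rL2_heat h (sub_pos.2 hst)).comp_const_sub t s
  have h2 := h1.inner ℂ (hasDerivAt_heatOp_apply hR hs f)
  refine h2.congr_deriv ?_
  have h3 := inner_heat_lapl_schrodingerInv hU hg h (t - s) (genOp (schrodingerInv U) s f)
  have h4 : heatOp (schrodingerInv U) s f =
      schrodingerInv U (genOp (schrodingerInv U) s f) := by
    rw [heatOp_eq_mul_genOp hR hs]; rfl
  rw [inner_neg_right, inner_neg_left, h4, h3]
  ring

theorem continuousOn_inner_heat_heatOp (hU : IsCoercive κ U) (hg : HasExpGrowth A a U)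
    {φ : Space d → ℝ} (h : IsTest φ) (f : OneParticle d) (t : ℝ) :
    ContinuousOn (fun s => inner ℂ (rL2 (heat (t - s) φ)) (heatOp (schrodingerInv U) s f))
      (Icc 0 t) := by
  have hR := isPositive_schrodingerInv U
  refine ContinuousOn.inner ((continuous_rL2_heat h).comp (by fun_prop)).continuousOn ?_
  exact (continuousOn_heatOp_apply hR (denseRange_schrodingerInv hU hg) f).mono
    fun s hs => hs.1

theorem re_integral_smul_rL2 {f p : Space d → ℝ} (hp : MemLp p 2 volume) :
    (∫ x, f x • rL2 p x).re = ∫ x, f x * p x := by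
  have : ∫ x, f x • rL2 p x = ((∫ x, f x * p x : ℝ) : ℂ) := by
    rw [← integral_complex_ofReal]
    refine integral_congr_ae ?_
    filter_upwards [coeFn_rL2 hp] with x hx
    rw [hx, Complex.real_smul, Complex.ofReal_mul]
  rw [this, Complex.ofReal_re]

/-- The function `s ↦ e^{-κ (t - s)} ⟨e^{(t-s)Δ} φ, S_s f⟩` is decreasing because `U ≥ κ` and
`S_s f` is nonnegative. -/
theorem inner_heatOp_le (hU : IsCoercive κ U) (hg : HasExpGrowth A a U) {φ : Space d → ℝ}
    (h : IsTest φ) (h0 : ∀ x, 0 ≤ φ x) {f : OneParticle d} (hf : IsNonneg f) {t : ℝ}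
    (ht : 0 ≤ t) : (inner ℂ (rL2 φ) (heatOp (schrodingerInv U) t f)).re ≤
      Real.exp (-(κ * t)) * (inner ℂ (rL2 (heat t φ)) f).re := by
  set h' : ℝ → ℝ := fun s => Real.exp (-(κ * (t - s))) *
    (inner ℂ (rL2 (heat (t - s) φ)) (heatOp (schrodingerInv U) s f)).re with hh'
  have hderiv : ∀ s ∈ Ioo 0 t, ∃ D ≤ 0, HasDerivAt h' D s := by
    intro s hs
    have e1 : HasDerivAt (fun s => Real.exp (-(κ * (t - s))))
        (Real.exp (-(κ * (t - s))) * κ) s := by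
      have : HasDerivAt (fun s => -(κ * (t - s))) κ s := by
        have := (((hasDerivAt_id s).const_sub t).const_mul κ).neg
        simpa using! this
      exact this.exp
    have e2 := Complex.reCLM.hasFDerivAt.comp_hasDerivAt s
      (hasDerivAt_inner_heat_heatOp hU hg h f hs.1 hs.2)
    have e3 := e1.mul e2
    refine ⟨_, ?_, e3⟩
    set S := heatOp (schrodingerInv U) s f
    have hS : IsNonneg S := isNonneg_heatOp hU hf hs.1.le
    have e4 : 0 ≤ (inner ℂ
        (rL2 (fun x => U x * heat (t - s) φ x) - (κ : ℂ) • rL2 (heat (t - s) φ)) S).re := by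
      refine inner_nonneg_of_isNonneg ?_ hS
      filter_upwards [Lp.coeFn_sub (rL2 (fun x => U x * heat (t - s) φ x))
        ((κ : ℂ) • rL2 (heat (t - s) φ)), Lp.coeFn_smul (κ : ℂ) (rL2 (heat (t - s) φ)),
        coeFn_rL2 (memLp_mul_heat hg h (t - s)), coeFn_rL2 (memLp_heat h (t - s)), hU.le]
        with x x1 x2 x3 x4 x5
      rw [x1, Pi.sub_apply, x2, Pi.smul_apply, x3, x4, smul_eq_mul, ← Complex.ofReal_mul,
        ← Complex.ofReal_sub, Complex.zero_le_real, ← sub_mul]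
      exact mul_nonneg (sub_nonneg.2 x5) (heat_nonneg h0 _ _)
    rw [inner_sub_left, inner_smul_left, Complex.conj_ofReal, Complex.sub_re,
      Complex.re_ofReal_mul] at e4
    simp only [Function.comp_apply, Complex.reCLM_apply, Complex.neg_re]
    have := Real.exp_pos (-(κ * (t - s)))
    nlinarith
  have hanti : AntitoneOn h' (Icc 0 t) := by
    refine antitoneOn_of_deriv_nonpos (convex_Icc 0 t) ?_ ?_ ?_
    · refine ContinuousOn.mul (by fun_prop) ?_
      exact Complex.continuous_re.comp_continuousOn (continuousOn_inner_heat_heatOp hU hg h f t)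
    · rw [interior_Icc]
      intro s hs
      obtain ⟨D, -, hD⟩ := hderiv s hs
      exact hD.differentiableAt.differentiableWithinAt
    · rw [interior_Icc]
      intro s hs
      obtain ⟨D, hD0, hD⟩ := hderiv s hs
      rw [hD.deriv]
      exact hD0
  have := hanti (left_mem_Icc.2 ht) (right_mem_Icc.2 ht) ht
  simpa [hh', heat_zero, heatOp_zero] using this

/-- Pointwise domination `S_t φ ≤ e^{-κ t} e^{tΔ} φ`. -/
theorem norm_heatOp_apply_le (hU : IsCoercive κ U) (hg : HasExpGrowth A a U) {φ : Space d → ℝ}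
    (h : IsTest φ) (h0 : ∀ x, 0 ≤ φ x) {t : ℝ} (ht : 0 ≤ t) :
    ∀ᵐ x, ‖heatOp (schrodingerInv U) t (rL2 φ) x‖ ≤ Real.exp (-(κ * t)) * heat t φ x := by
  have hφ : IsNonneg (rL2 φ) := isNonneg_rL2 (h.memLp 2) (Eventually.of_forall h0)
  set S := heatOp (schrodingerInv U) t (rL2 φ) with hSdef
  have hS : IsNonneg S := isNonneg_heatOp hU hφ ht
  set H : Space d → ℝ := fun x => Real.exp (-(κ * t)) * heat t φ x with hH
  have hH2 : MemLp H 2 volume := (memLp_heat h t).const_mul _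
  have hn : MemLp (fun x => ‖S x‖) 2 volume := (Lp.memLp S).norm
  set q : Space d → ℝ := fun x => ‖S x‖ - H x with hq
  have hq2 : MemLp q 2 volume := hn.sub hH2
  -- test the inequality against the positive part `p` of the difference
  set p : Space d → ℝ := fun x => max (q x) 0 with hp
  have hp2 : MemLp p 2 volume := hq2.pos_part
  have hp0 : IsNonneg (rL2 p) := isNonneg_rL2 hp2 (Eventually.of_forall fun x => le_max_right _ _)
  have h1 := inner_heatOp_le hU hg h h0 hp0 ht
  rw [← inner_comm_of_isSelfAdjoint (isSelfAdjoint_heatOp _ _), ← hSdef] at h1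
  have e1 : (inner ℂ S (rL2 p)).re = ∫ x, ‖S x‖ * p x := by
    rw [re_inner_eq_integral]
    refine integral_congr_ae ?_
    filter_upwards [hS, coeFn_rL2 hp2] with x x1 x2
    rw [complex_nonneg_iff] at x1
    rw [x2, ← x1, Complex.conj_ofReal, ← Complex.ofReal_mul]
    simp
  have e2 : Real.exp (-(κ * t)) * (inner ℂ (rL2 (heat t φ)) (rL2 p)).re = ∫ x, H x * p x := by
    rw [inner_rL2 (memLp_heat h t), re_integral_smul_rL2 hp2]
    rw [← integral_const_mul]
    refine integral_congr_ae (Eventually.of_forall fun x => ?_)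
    simp only [hH]
    ring
  have i1 : Integrable (fun x => ‖S x‖ * p x) := hn.integrable_mul hp2
  have i2 : Integrable (fun x => H x * p x) := hH2.integrable_mul hp2
  rw [e1, e2, ← sub_nonpos, ← integral_sub i1 i2] at h1
  have e3 : ∀ x, ‖S x‖ * p x - H x * p x = p x * p x := by
    intro x
    rw [← sub_mul]
    rcases le_total (q x) 0 with h | h
    · simp [hp, max_eq_right h]
    · simp only [hp, max_eq_left h]; rfl
  simp only [e3] at h1
  have h2 : ∫ x, p x * p x = 0 := le_antisymm h1 (integral_nonneg fun x => mul_self_nonneg _)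
  rw [integral_eq_zero_iff_of_nonneg (fun x => mul_self_nonneg _) (hp2.integrable_mul hp2)] at h2
  filter_upwards [h2] with x hx
  have : p x = 0 := by simpa using hx
  have h3 := le_max_left (q x) 0
  change q x ≤ p x at h3
  rw [this] at h3
  exact sub_nonpos.1 h3

end

section

/-! ### Evaluation of the Schrödinger semigroup at a point -/

variable {κ A a : ℝ} {U : Space d → ℝ}

theorem gaussK_le_exp {r : ℝ} (hr : 0 < r) (b : ℝ) (y : Space d) :
    gaussK r y ≤ (4 * Real.pi * r) ^ (-(d / 2 : ℝ)) * Real.exp (b ^ 2 * r) *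
      Real.exp (-(b * ‖y‖)) := by
  rw [gaussK, mul_assoc _ (Real.exp _), ← Real.exp_add]
  refine mul_le_mul_of_nonneg_left (Real.exp_le_exp.2 ?_) (by positivity)
  have h : b ^ 2 * r + -(b * ‖y‖) - -‖y‖ ^ 2 / (4 * r) = (‖y‖ - 2 * b * r) ^ 2 / (4 * r) := by
    field_simp
    ring
  have : 0 ≤ (‖y‖ - 2 * b * r) ^ 2 / (4 * r) := by positivity
  linarith

theorem abs_mul_gaussK_le (hU : HasExpGrowth A a U) {r : ℝ} (hr : 0 < r) (x : Space d) :
    ∀ᵐ z, |U z * gaussK r (z - x)| ≤ A * (4 * Real.pi * r) ^ (-(d / 2 : ℝ)) *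
      Real.exp ((a + 1) ^ 2 * r + (a + 1) * ‖x‖) * Real.exp (-‖z‖) := by
  filter_upwards [hU.le] with z hz
  have ha := hU.nonneg
  have h1 := gaussK_le_exp hr (a + 1) (z - x)
  have h2 : Real.exp (-((a + 1) * ‖z - x‖)) ≤ Real.exp (-((a + 1) * ‖z‖) + (a + 1) * ‖x‖) := by
    refine Real.exp_le_exp.2 ?_
    have := norm_sub_norm_le z x
    nlinarith
  have h3 : gaussK r (z - x) ≤ (4 * Real.pi * r) ^ (-(d / 2 : ℝ)) * Real.exp ((a + 1) ^ 2 * r) *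
      Real.exp (-((a + 1) * ‖z‖) + (a + 1) * ‖x‖) :=
    h1.trans (mul_le_mul_of_nonneg_left h2 (by positivity))
  rw [abs_mul, abs_of_nonneg (gaussK_nonneg hr _)]
  refine (mul_le_mul hz h3 (gaussK_nonneg hr _) ((abs_nonneg _).trans hz)).trans (le_of_eq ?_)
  have e : Real.exp (a * ‖z‖) * (Real.exp ((a + 1) ^ 2 * r) *
      Real.exp (-((a + 1) * ‖z‖) + (a + 1) * ‖x‖)) =
      Real.exp ((a + 1) ^ 2 * r + (a + 1) * ‖x‖) * Real.exp (-‖z‖) := by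
    simp only [← Real.exp_add]
    congr 1
    ring
  linear_combination (A * (4 * Real.pi * r) ^ (-(d / 2 : ℝ))) * e

theorem memLp_mul_gaussK (hU : HasExpGrowth A a U) {r : ℝ} (hr : 0 < r) (x : Space d) :
    MemLp (fun z => U z * gaussK r (z - x)) 2 volume :=
  (memLp_exp_neg_norm.const_mul _).mono' (hU.meas.mul
    ((continuous_gaussK r).comp (continuous_id.sub continuous_const)).aestronglyMeasurable)
    (abs_mul_gaussK_le hU hr x)

/-- The function `z ↦ U(z) g_r(z - x)`, with `g_r` the heat kernel, in `L²`. -/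
def mulGauss (U : Space d → ℝ) (r : ℝ) (x : Space d) : OneParticle d :=
  rL2 (fun z => U z * gaussK r (z - x))

theorem continuousOn_mulGauss (hU : HasExpGrowth A a U) :
    ContinuousOn (fun p : ℝ × Space d => mulGauss U p.1 p.2) (Ioi 0 ×ˢ univ) := by
  rintro ⟨r, x⟩ ⟨hr, -⟩
  have hr : 0 < r := hr
  refine ContinuousAt.continuousWithinAt ?_
  have ha := hU.nonneg
  have hA := hU.coeff_nonneg
  set Cb : ℝ := A * (4 * Real.pi * (r / 2)) ^ (-(d / 2 : ℝ)) *
    Real.exp ((a + 1) ^ 2 * (r + 1) + (a + 1) * (‖x‖ + 1)) with hCb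
  have hb : ∀ p : ℝ × Space d, r / 2 ≤ p.1 → p.1 ≤ r + 1 → ‖p.2‖ ≤ ‖x‖ + 1 →
      ∀ᵐ z, ‖((U z * gaussK p.1 (z - p.2) : ℝ) : ℂ)‖ ≤ Cb * Real.exp (-‖z‖) := by
    intro p h1 h2 h3
    filter_upwards [abs_mul_gaussK_le hU (show 0 < p.1 by linarith) p.2] with z hz
    rw [Complex.norm_real]
    refine hz.trans (mul_le_mul_of_nonneg_right ?_ (Real.exp_pos _).le)
    rw [hCb]
    have h4 : (4 * Real.pi * p.1) ^ (-(d / 2 : ℝ)) ≤ (4 * Real.pi * (r / 2)) ^ (-(d / 2 : ℝ)) := by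
      refine Real.rpow_le_rpow_of_nonpos (by positivity) (by gcongr) ?_
      have : (0 : ℝ) ≤ d / 2 := by positivity
      linarith
    gcongr
  have hev : ∀ᶠ p : ℝ × Space d in 𝓝 (r, x), r / 2 < p.1 ∧ p.1 < r + 1 ∧ ‖p.2‖ < ‖x‖ + 1 := by
    have hc1 : ContinuousAt (fun p : ℝ × Space d => p.1) (r, x) := continuousAt_fst
    have hc2 : ContinuousAt (fun p : ℝ × Space d => ‖p.2‖) (r, x) := by fun_prop
    exact (hc1.eventually (lt_mem_nhds (show r / 2 < r by linarith))).and
      ((hc1.eventually (gt_mem_nhds (show r < r + 1 by linarith))).and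
      (hc2.eventually (gt_mem_nhds (show ‖x‖ < ‖x‖ + 1 by linarith))))
  refine tendsto_toL2 (b := fun z => Cb * Real.exp (-‖z‖)) ?_ ?_ (memLp_exp_neg_norm.const_mul Cb)
    ?_ ?_ ?_
  · filter_upwards [hev] with p hp
    exact (memLp_mul_gaussK hU (show 0 < p.1 by linarith) p.2).ofReal.1
  · exact (memLp_mul_gaussK hU hr x).ofReal.1
  · filter_upwards [hev] with p hp
    exact hb p hp.1.le hp.2.1.le hp.2.2.le
  · exact hb (r, x) (by simp only; linarith) (by simp) (by simp)
  · refine Eventually.of_forall fun z => ?_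
    have h1 : ContinuousAt (fun p : ℝ × Space d => gaussK p.1 (z - p.2)) (r, x) := by
      unfold gaussK
      refine ContinuousAt.mul (ContinuousAt.rpow_const (by fun_prop) (Or.inl (by positivity))) ?_
      refine Real.continuous_exp.continuousAt.comp (ContinuousAt.div (by fun_prop) (by fun_prop) ?_)
      simp only
      positivity
    exact Complex.continuous_ofReal.continuousAt.comp (continuousAt_const.mul h1)

/-- The singularity `r^(-d/4)` at small times is integrable for `d ≤ 3`. -/
theorem norm_mulGauss_le (hU : HasExpGrowth A a U) {r : ℝ} (hr : 0 < r) (x : Space d) :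
    ‖mulGauss U r x‖ ≤ A * Real.exp (a * ‖x‖ + 4 * a ^ 2 * r) * r ^ (-(d / 4 : ℝ)) := by
  have hA := hU.coeff_nonneg
  have ha := hU.nonneg
  refine le_of_sq_le_sq ?_ (by positivity)
  rw [norm_sq_eq_integral]
  have hI : Integrable (fun z : Space d =>
      gaussK r (z - x) * Real.exp ((2 * a) * ‖z - x‖)) :=
    (integrable_gaussK_mul_exp (d := d) hr (2 * a)).comp_sub_right x
  have h1 : ∫ z, ‖mulGauss U r x z‖ ^ 2 ≤ ∫ z, (A ^ 2 * Real.exp (2 * a * ‖x‖) *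
      (4 * Real.pi * r) ^ (-(d / 2 : ℝ))) * (gaussK r (z - x) * Real.exp ((2 * a) * ‖z - x‖)) := by
    refine integral_mono_ae (integrable_norm_sq _) (hI.const_mul _) ?_
    filter_upwards [coeFn_rL2 (memLp_mul_gaussK hU hr x), hU.le] with z hz hz2
    rw [mulGauss, hz, Complex.norm_real, Real.norm_eq_abs, abs_mul,
      abs_of_nonneg (gaussK_nonneg hr _), mul_pow]
    have h2 : |U z| ^ 2 ≤ A ^ 2 * (Real.exp (2 * a * ‖x‖) * Real.exp ((2 * a) * ‖z - x‖)) := by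
      calc |U z| ^ 2 ≤ (A * Real.exp (a * ‖z‖)) ^ 2 := by gcongr
        _ = A ^ 2 * Real.exp (2 * a * ‖z‖) := by
          rw [mul_pow, ← Real.exp_nat_mul]
          congr 2
          push_cast
          ring
        _ ≤ _ := by
          rw [← Real.exp_add]
          gcongr
          have := norm_sub_norm_le z x
          nlinarith
    have h3 : gaussK r (z - x) ^ 2 ≤ (4 * Real.pi * r) ^ (-(d / 2 : ℝ)) * gaussK r (z - x) := by
      rw [pow_two]
      exact mul_le_mul_of_nonneg_right (gaussK_le hr _) (gaussK_nonneg hr _)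
    refine (mul_le_mul h2 h3 (sq_nonneg _) (by positivity)).trans (le_of_eq ?_)
    ring
  rw [integral_const_mul, integral_sub_right_eq_self
    (fun z : Space d => gaussK r z * Real.exp (2 * a * ‖z‖)) x] at h1
  have h4 : (4 * Real.pi * r) ^ (-(d / 2 : ℝ)) * 2 ^ (d / 2 : ℝ) ≤ (r ^ (-(d / 4 : ℝ))) ^ 2 := by
    have h5 : (4 * Real.pi * r) ^ (-(d / 2 : ℝ)) ≤ (2 * r) ^ (-(d / 2 : ℝ)) := by
      refine Real.rpow_le_rpow_of_nonpos (by positivity) ?_ ?_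
      · have := Real.pi_gt_three
        nlinarith
      · have : (0 : ℝ) ≤ d / 2 := by positivity
        linarith
    refine (mul_le_mul_of_nonneg_right h5 (by positivity)).trans (le_of_eq ?_)
    rw [Real.mul_rpow (by norm_num) hr.le, Real.rpow_neg (by norm_num : (0 : ℝ) ≤ 2),
      ← Real.rpow_natCast, ← Real.rpow_mul hr.le]
    have : (0 : ℝ) < 2 ^ (d / 2 : ℝ) := by positivity
    field_simp
    congr 1
    push_cast
    ring
  refine h1.trans ((mul_le_mul_of_nonneg_left (integral_gaussK_mul_exp_le hr (2 * a))
    (by positivity)).trans ?_)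
  rw [mul_pow _ (r ^ _), mul_pow A]
  have e1 : Real.exp (a * ‖x‖ + 4 * a ^ 2 * r) ^ 2 =
      Real.exp (2 * a * ‖x‖) * Real.exp (2 * (2 * a) ^ 2 * r) := by
    rw [← Real.exp_nat_mul, ← Real.exp_add]
    congr 1
    push_cast
    ring
  rw [e1]
  calc _ = A ^ 2 * (Real.exp (2 * a * ‖x‖) * Real.exp (2 * (2 * a) ^ 2 * r)) *
        ((4 * Real.pi * r) ^ (-(d / 2 : ℝ)) * 2 ^ (d / 2 : ℝ)) := by ring
    _ ≤ _ := by gcongr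

/-- The heat flow of a test function is the superposition of translated heat kernels. -/
theorem inner_mul_heat (hU : HasExpGrowth A a U) {φ : Space d → ℝ} (h : IsTest φ) {r : ℝ}
    (hr : 0 < r) (f : OneParticle d) : inner ℂ (rL2 (fun z => U z * heat r φ z)) f =
      ∫ x, φ x • inner ℂ (mulGauss U r x) f := by
  have hA := hU.coeff_nonneg
  have ha := hU.nonneg
  set F : Space d → Space d → ℂ := fun x z => φ x • ((U z * gaussK r (z - x)) • f z) with hF
  have hm : AEStronglyMeasurable (Function.uncurry F) (volume.prod volume) := by
    have h1 : AEStronglyMeasurable (fun p : Space d × Space d => U p.2)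
      (volume.prod volume) := hU.meas.comp_snd
    have h2 : AEStronglyMeasurable (fun p : Space d × Space d => f p.2)
      (volume.prod volume) := (Lp.memLp f).1.comp_snd
    have h3 : Continuous (fun p : Space d × Space d => gaussK r (p.2 - p.1)) :=
      (continuous_gaussK r).comp (by fun_prop)
    have h4 : Continuous (fun p : Space d × Space d => φ p.1) := h.continuous.comp continuous_fst
    exact h4.aestronglyMeasurable.smul ((h1.mul h3.aestronglyMeasurable).smul h2)
  have hz : ∀ x, Integrable (fun z => (U z * gaussK r (z - x)) • f z) := by
    intro x
    refine (integrable_conj_mul (mulGauss U r x) f).congr ?_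
    filter_upwards [coeFn_rL2 (memLp_mul_gaussK hU hr x)] with z hz
    rw [mulGauss, hz, Complex.conj_ofReal, Complex.real_smul]
  have hC : ∃ K : ℝ, ∀ x, ∫ z, ‖(U z * gaussK r (z - x)) • f z‖ ≤ K * Real.exp (a * ‖x‖) := by
    refine ⟨A * Real.exp (4 * a ^ 2 * r) * r ^ (-(d / 4 : ℝ)) * ‖f‖, fun x => ?_⟩
    have h1 := norm_inner_le_norm (𝕜 := ℂ) (absL2 (mulGauss U r x)) (absL2 f)
    rw [norm_absL2, norm_absL2] at h1
    have h2 : ∫ z, ‖(U z * gaussK r (z - x)) • f z‖ ≤ ‖mulGauss U r x‖ * ‖f‖ := by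
      refine le_trans (le_of_eq ?_) ((Complex.re_le_norm _).trans h1)
      rw [re_inner_eq_integral]
      refine integral_congr_ae ?_
      filter_upwards [coeFn_absL2 f, coeFn_absL2 (mulGauss U r x),
        coeFn_rL2 (memLp_mul_gaussK hU hr x)] with z h3 h4 h5
      rw [h3, h4, mulGauss, h5, Complex.conj_ofReal, Complex.norm_real, norm_smul,
        ← Complex.ofReal_mul, Complex.ofReal_re]
    refine h2.trans ((mul_le_mul_of_nonneg_right (norm_mulGauss_le hU hr x)
      (norm_nonneg _)).trans (le_of_eq ?_))
    rw [Real.exp_add]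
    ring
  obtain ⟨K, hK⟩ := hC
  have hint : Integrable (Function.uncurry F) (volume.prod volume) := by
    rw [integrable_prod_iff hm]
    refine ⟨Eventually.of_forall fun x => (hz x).smul (φ x), ?_⟩
    have hbd : Integrable (fun x => |φ x| * (K * Real.exp (a * ‖x‖))) := by
      refine Continuous.integrable_of_hasCompactSupport ?_ ?_
      · have := h.continuous
        fun_prop
      · exact (h.2.comp_left (g := fun s : ℝ => |s|) abs_zero).mul_right
    refine hbd.mono' hm.norm.integral_prod_right' (Eventually.of_forall fun x => ?_)
    rw [Real.norm_of_nonneg (integral_nonneg fun z => norm_nonneg _)]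
    simp only [hF, Function.uncurry_apply_pair]
    simp only [norm_smul (φ x)]
    rw [integral_const_mul]
    exact mul_le_mul_of_nonneg_left (hK x) (norm_nonneg _)
  have hswap := integral_integral_swap hint
  rw [inner_rL2 (memLp_mul_heat hU h r)]
  have e1 : ∀ z, (U z * heat r φ z) • f z = ∫ x, F x z := by
    intro z
    rw [heat_eq_conv hr, ← integral_const_mul, ← integral_smul_const]
    refine integral_congr_ae (Eventually.of_forall fun x => ?_)
    simp only [hF, smul_smul]
    congr 1
    ring
  simp only [e1]
  rw [← hswap]
  refine integral_congr_ae (Eventually.of_forall fun x => ?_)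
  simp only [hF]
  rw [integral_smul, mulGauss, inner_rL2 (memLp_mul_gaussK hU hr x)]

end

section

variable {κ A a : ℝ} {U : Space d → ℝ}

/-- The vector `k` with `(S_t f)(x) = ⟨k, f⟩`, where `S_t = e^{-t(-Δ+U)}`, given by Duhamel's
formula in terms of the heat kernel. In dimension at most three the integral converges in `L²`. -/
def kerVec (U : Space d → ℝ) (t : ℝ) (x : Space d) : OneParticle d :=
  mulGauss (fun _ => 1) t x -
    ∫ r in (0 : ℝ)..t, heatOp (schrodingerInv U) (t - r) (mulGauss U r x)

theorem norm_heatOp_mulGauss_le (hg : HasExpGrowth A a U) {t r : ℝ} (hr : 0 < r) (hrt : r ≤ t)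
    (x : Space d) : ‖heatOp (schrodingerInv U) (t - r) (mulGauss U r x)‖ ≤
      A * Real.exp (a * ‖x‖ + 4 * a ^ 2 * t) * r ^ (-(d / 4 : ℝ)) := by
  have hA := hg.coeff_nonneg
  have h1 := norm_heatOp_le_one (isPositive_schrodingerInv U) (sub_nonneg.2 hrt)
  calc _ ≤ ‖heatOp (schrodingerInv U) (t - r)‖ * ‖mulGauss U r x‖ :=
        ContinuousLinearMap.le_opNorm _ _
    _ ≤ 1 * ‖mulGauss U r x‖ := by gcongr
    _ ≤ _ := by
      rw [one_mul]
      refine (norm_mulGauss_le hg hr x).trans ?_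
      gcongr

theorem continuousOn_heatOp_mulGauss (hg : HasExpGrowth A a U) (t : ℝ) :
    ContinuousOn (fun p : ℝ × Space d => heatOp (schrodingerInv U) (t - p.1) (mulGauss U p.1 p.2))
      (Ioo 0 t ×ˢ univ) := by
  refine ContinuousOn.clm_apply ?_ ((continuousOn_mulGauss hg).mono ?_)
  · rintro ⟨r, x⟩ ⟨hr, -⟩
    refine ContinuousAt.continuousWithinAt ?_
    have h1 : ContinuousAt (heatOp (schrodingerInv U)) (t - r) :=
      (hasDerivAt_heatOp (isPositive_schrodingerInv U) (sub_pos.2 hr.2)).continuousAt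
    have h2 : ContinuousAt (fun p : ℝ × Space d => t - p.1) (r, x) := by fun_prop
    exact ContinuousAt.comp (x := (r, x)) (f := fun p : ℝ × Space d => t - p.1) h1 h2
  · exact prod_mono (fun r hr => hr.1) le_rfl

theorem intervalIntegrable_rpow_neg_dim (hd : d ≤ 3) (t : ℝ) :
    IntervalIntegrable (fun r : ℝ => r ^ (-(d / 4 : ℝ))) volume 0 t := by
  refine intervalIntegral.intervalIntegrable_rpow' ?_
  have : (d : ℝ) ≤ 3 := by exact_mod_cast hd
  linarith

theorem aestronglyMeasurable_heatOp_mulGauss (hg : HasExpGrowth A a U) {t : ℝ} (ht : 0 < t)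
    (x : Space d) : AEStronglyMeasurable
      (fun r => heatOp (schrodingerInv U) (t - r) (mulGauss U r x))
      (volume.restrict (uIoc 0 t)) := by
  rw [uIoc_of_le ht.le, ← restrict_Ioo_eq_restrict_Ioc]
  refine ContinuousOn.aestronglyMeasurable ?_ measurableSet_Ioo
  exact (continuousOn_heatOp_mulGauss hg t).comp (f := fun r : ℝ => (r, x)) (by fun_prop)
    fun r hr => ⟨hr, mem_univ _⟩

theorem intervalIntegrable_heatOp_mulGauss (hd : d ≤ 3) (hg : HasExpGrowth A a U) {t : ℝ}
    (ht : 0 < t) (x : Space d) : IntervalIntegrable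
      (fun r => heatOp (schrodingerInv U) (t - r) (mulGauss U r x)) volume 0 t := by
  refine ((intervalIntegrable_rpow_neg_dim hd t).const_mul
    (A * Real.exp (a * ‖x‖ + 4 * a ^ 2 * t))).mono_fun'
    (aestronglyMeasurable_heatOp_mulGauss hg ht x) ?_
  refine (ae_restrict_iff' measurableSet_uIoc).2 (Eventually.of_forall fun r hr => ?_)
  rw [uIoc_of_le ht.le] at hr
  exact norm_heatOp_mulGauss_le hg hr.1 hr.2 x

theorem continuous_kerVec (hd : d ≤ 3) (hg : HasExpGrowth A a U) {t : ℝ}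
    (ht : 0 < t) : Continuous (kerVec U t) := by
  refine Continuous.sub ?_ ?_
  · have h1 := continuousOn_mulGauss (d := d) hasExpGrowth_one
    have h2 : ContinuousOn (fun x : Space d => mulGauss (fun _ => 1) t x) univ :=
      h1.comp (f := fun x : Space d => (t, x)) (by fun_prop) fun x _ => ⟨ht, mem_univ _⟩
    exact continuousOn_univ.1 h2
  · refine continuous_iff_continuousAt.2 fun x => ?_
    have hA := hg.coeff_nonneg
    have ha := hg.nonneg
    refine intervalIntegral.continuousAt_of_dominated_interval
      (bound := fun r => A * Real.exp (a * (‖x‖ + 1) + 4 * a ^ 2 * t) * r ^ (-(d / 4 : ℝ)))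
      (Eventually.of_forall fun y => aestronglyMeasurable_heatOp_mulGauss hg ht y) ?_
      ((intervalIntegrable_rpow_neg_dim hd t).const_mul _) ?_
    · have hc : ContinuousAt (fun y : Space d => ‖y‖) x := by fun_prop
      filter_upwards [hc.eventually (gt_mem_nhds (show ‖x‖ < ‖x‖ + 1 by linarith))] with y hy
      refine Eventually.of_forall fun r hr => ?_
      rw [uIoc_of_le ht.le] at hr
      refine (norm_heatOp_mulGauss_le hg hr.1 hr.2 y).trans ?_
      have := hr.1
      gcongr
    · have hne : ∀ᵐ r : ℝ, r ≠ t := by simp [ae_iff, measure_singleton]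
      filter_upwards [hne] with r hrt hr
      rw [uIoc_of_le ht.le] at hr
      have hr' : r ∈ Ioo 0 t := ⟨hr.1, lt_of_le_of_ne hr.2 hrt⟩
      have h1 := (continuousOn_heatOp_mulGauss hg t).comp (f := fun y : Space d => (r, y))
        (s := univ) (by fun_prop) fun y _ => ⟨hr', mem_univ _⟩
      exact (continuousOn_univ.1 h1).continuousAt

theorem inner_kerVec (hd : d ≤ 3) (hg : HasExpGrowth A a U) {t : ℝ} (ht : 0 < t) (x : Space d)
    (f : OneParticle d) : inner ℂ (kerVec U t x) f = inner ℂ (mulGauss (fun _ => 1) t x) f -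
      ∫ r in (0 : ℝ)..t, inner ℂ (mulGauss U r x) (heatOp (schrodingerInv U) (t - r) f) := by
  rw [kerVec, inner_sub_left]
  congr 1
  have h1 := ((innerSL ℂ f).restrictScalars ℝ).intervalIntegral_comp_comm
    (intervalIntegrable_heatOp_mulGauss hd hg ht x)
  change ∫ r in (0 : ℝ)..t, inner ℂ f (heatOp (schrodingerInv U) (t - r) (mulGauss U r x)) =
      inner ℂ f (∫ r in (0 : ℝ)..t, heatOp (schrodingerInv U) (t - r) (mulGauss U r x)) at h1
  rw [← inner_conj_symm, ← h1, intervalIntegral.integral_of_le ht.le,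
    intervalIntegral.integral_of_le ht.le, ← integral_conj]
  refine integral_congr_ae (Eventually.of_forall fun r => ?_)
  simp only
  rw [inner_conj_symm, inner_comm_of_isSelfAdjoint (isSelfAdjoint_heatOp _ _)]

/-- Duhamel's formula, tested against a test function. -/
theorem inner_heatOp_eq_sub (hU : IsCoercive κ U) (hg : HasExpGrowth A a U) {φ : Space d → ℝ}
    (h : IsTest φ) (f : OneParticle d) {t : ℝ} (ht : 0 < t) :
    inner ℂ (rL2 φ) (heatOp (schrodingerInv U) t f) = inner ℂ (rL2 (heat t φ)) f -
      ∫ r in (0 : ℝ)..t, inner ℂ (rL2 (fun z => U z * heat r φ z))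
        (heatOp (schrodingerInv U) (t - r) f) := by
  have hR := isPositive_schrodingerInv U
  have hcont : ContinuousOn (fun s => -inner ℂ (rL2 (fun x => U x * heat (t - s) φ x))
      (heatOp (schrodingerInv U) s f)) (uIcc 0 t) := by
    rw [uIcc_of_le ht.le]
    refine (ContinuousOn.inner ((continuous_rL2_mul_heat hg h).comp
      (by fun_prop : Continuous fun s : ℝ => t - s)).continuousOn ?_).neg
    exact (continuousOn_heatOp_apply hR (denseRange_schrodingerInv hU hg) f).mono fun s hs => hs.1
  have h1 := intervalIntegral.integral_eq_sub_of_hasDerivAt_of_le ht.le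
    (continuousOn_inner_heat_heatOp hU hg h f t)
    (fun s hs => hasDerivAt_inner_heat_heatOp hU hg h f hs.1 hs.2) hcont.intervalIntegrable
  have h2 := intervalIntegral.integral_comp_sub_left (a := 0) (b := t)
    (fun s => -inner ℂ (rL2 (fun x => U x * heat (t - s) φ x)) (heatOp (schrodingerInv U) s f)) t
  rw [sub_self, sub_zero] at h2
  simp only [sub_self, sub_zero, heat_zero, heatOp_zero] at h1
  simp only [sub_sub_cancel] at h2
  rw [h1, intervalIntegral.integral_neg] at h2
  change -_ = _ - inner ℂ (rL2 (heat t φ)) f at h2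
  rw [sub_eq_add_neg, h2]
  ring

/-- The kernel vectors represent the semigroup, after pairing with a test function: each term of
Duhamel's formula is rewritten by Fubini's theorem. -/
theorem inner_heatOp_eq_integral_kerVec (hd : d ≤ 3) (hU : IsCoercive κ U)
    (hg : HasExpGrowth A a U) {φ : Space d → ℝ} (h : IsTest φ) (f : OneParticle d) {t : ℝ}
    (ht : 0 < t) : inner ℂ (rL2 φ) (heatOp (schrodingerInv U) t f) =
      ∫ x, φ x • inner ℂ (kerVec U t x) f := by
  have hR := isPositive_schrodingerInv U
  have hA := hg.coeff_nonneg
  have hc1 : Continuous (fun x : Space d => inner ℂ (mulGauss (fun _ => 1) t x) f) := by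
    have h1 := continuousOn_mulGauss (d := d) hasExpGrowth_one
    have h2 : ContinuousOn (fun x : Space d => mulGauss (fun _ => 1) t x) univ :=
      h1.comp (f := fun x : Space d => (t, x)) (by fun_prop) fun x _ => ⟨ht, mem_univ _⟩
    exact (continuousOn_univ.1 h2).inner continuous_const
  have hi1 : Integrable (fun x : Space d => φ x • inner ℂ (mulGauss (fun _ => 1) t x) f) :=
    (h.continuous.smul hc1).integrable_of_hasCompactSupport h.2.smul_right
  have hi0 : Integrable (fun x : Space d => φ x • inner ℂ (kerVec U t x) f) :=
    (h.continuous.smul ((continuous_kerVec hd hg ht).inner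
      continuous_const)).integrable_of_hasCompactSupport h.2.smul_right
  have e0 : ∀ x, φ x • ∫ r in (0 : ℝ)..t, inner ℂ (mulGauss U r x)
      (heatOp (schrodingerInv U) (t - r) f) = φ x • inner ℂ (mulGauss (fun _ => 1) t x) f -
        φ x • inner ℂ (kerVec U t x) f := by
    intro x
    rw [inner_kerVec hd hg ht, ← smul_sub, sub_sub_cancel]
  set G : ℝ → Space d → ℂ := fun r x => φ x • inner ℂ (mulGauss U r x)
    (heatOp (schrodingerInv U) (t - r) f) with hG
  have hGc : ContinuousOn (Function.uncurry G) (Ioo 0 t ×ˢ univ) := by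
    have h1 : ContinuousOn (fun p : ℝ × Space d => φ p.2 • inner ℂ
        (heatOp (schrodingerInv U) (t - p.1) (mulGauss U p.1 p.2)) f) (Ioo 0 t ×ˢ univ) :=
      ContinuousOn.smul (h.continuous.comp continuous_snd).continuousOn
        ((continuousOn_heatOp_mulGauss hg t).inner continuousOn_const)
    refine h1.congr fun p _ => ?_
    simp only
    rw [inner_comm_of_isSelfAdjoint (isSelfAdjoint_heatOp _ _)]
    rfl
  have hint : Integrable (Function.uncurry G) ((volume.restrict (uIoc 0 t)).prod volume) := by
    have hb1 : Integrable (fun r : ℝ => r ^ (-(d / 4 : ℝ))) (volume.restrict (uIoc 0 t)) :=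
      intervalIntegrable_iff.1 (intervalIntegrable_rpow_neg_dim hd t)
    have hb2 : Integrable (fun x : Space d => |φ x| *
        (A * Real.exp (a * ‖x‖ + 4 * a ^ 2 * t) * ‖f‖)) := by
      refine Continuous.integrable_of_hasCompactSupport ?_ ?_
      · have := h.continuous
        fun_prop
      · exact (h.2.comp_left (g := fun s : ℝ => |s|) abs_zero).mul_right
    have hμ : (volume.restrict (uIoc 0 t)).prod (volume : Measure (Space d)) =
        (volume.prod volume).restrict (Ioo 0 t ×ˢ univ) := by
      rw [uIoc_of_le ht.le, ← restrict_Ioo_eq_restrict_Ioc, ← Measure.prod_restrict,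
        Measure.restrict_univ]
    have hms : MeasurableSet (Ioo 0 t ×ˢ (univ : Set (Space d))) :=
      measurableSet_Ioo.prod MeasurableSet.univ
    refine (hb1.mul_prod hb2).mono' ?_ ?_
    · rw [hμ]
      exact hGc.aestronglyMeasurable hms
    · rw [hμ]
      refine (ae_restrict_iff' hms).2 (Eventually.of_forall ?_)
      rintro ⟨r, x⟩ ⟨hr, -⟩
      simp only [Function.uncurry_apply_pair, hG]
      rw [norm_smul, ← inner_comm_of_isSelfAdjoint (isSelfAdjoint_heatOp _ _), Real.norm_eq_abs]
      have h1 := (norm_inner_le_norm (𝕜 := ℂ)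
        (heatOp (schrodingerInv U) (t - r) (mulGauss U r x)) f).trans
        (mul_le_mul_of_nonneg_right (norm_heatOp_mulGauss_le hg hr.1 hr.2.le x) (norm_nonneg f))
      refine (mul_le_mul_of_nonneg_left h1 (abs_nonneg _)).trans (le_of_eq ?_)
      ring
  have hswap := intervalIntegral_integral_swap hint
  rw [inner_heatOp_eq_sub hU hg h f ht]
  have e1 : inner ℂ (rL2 (heat t φ)) f =
      ∫ x, φ x • inner ℂ (mulGauss (fun _ => 1) t x) f := by
    have := inner_mul_heat hasExpGrowth_one h ht f
    simpa only [one_mul] using this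
  have e2 : ∫ r in (0 : ℝ)..t, inner ℂ (rL2 (fun z => U z * heat r φ z))
      (heatOp (schrodingerInv U) (t - r) f) = ∫ r in (0 : ℝ)..t, ∫ x, G r x := by
    refine intervalIntegral.integral_congr_ae (Eventually.of_forall fun r hr => ?_)
    rw [uIoc_of_le ht.le] at hr
    exact inner_mul_heat hg h hr.1 _
  rw [e1, e2, hswap]
  simp only [hG, intervalIntegral.integral_smul]
  simp only [e0]
  rw [integral_sub hi1 hi0, sub_sub_cancel]

/-- The semigroup has the kernel vectors `kerVec U t x`. -/
theorem heatOp_apply_ae_eq (hd : d ≤ 3) (hU : IsCoercive κ U) (hg : HasExpGrowth A a U)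
    (f : OneParticle d) {t : ℝ} (ht : 0 < t) :
    heatOp (schrodingerInv U) t f =ᵐ[volume] fun x => inner ℂ (kerVec U t x) f := by
  refine ae_eq_of_integral_contDiff_smul_eq ((Lp.memLp _).locallyIntegrable (by norm_num))
    ((continuous_kerVec hd hg ht).inner continuous_const).locallyIntegrable fun φ h1 h2 => ?_
  have h : IsTest φ := ⟨h1, h2⟩
  rw [← inner_heatOp_eq_integral_kerVec hd hU hg h f ht, inner_rL2 (h.memLp 2)]

/-- Semigroup property of the kernel vectors; the identity holds at every point by continuity. -/
theorem heatOp_kerVec (hd : d ≤ 3) (hU : IsCoercive κ U) (hg : HasExpGrowth A a U) {s t : ℝ}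
    (hs : 0 ≤ s) (ht : 0 < t) (x : Space d) :
    heatOp (schrodingerInv U) s (kerVec U t x) = kerVec U (t + s) x := by
  have hR := isPositive_schrodingerInv U
  refine ext_inner_right ℂ fun f => ?_
  rw [inner_comm_of_isSelfAdjoint (isSelfAdjoint_heatOp _ _)]
  have h1 := heatOp_apply_ae_eq hd hU hg (heatOp (schrodingerInv U) s f) ht
  have h2 := heatOp_apply_ae_eq hd hU hg f (show 0 < t + s by linarith)
  rw [heatOp_add hR ht.le hs] at h2
  have h3 : (fun x => inner ℂ (kerVec U t x) (heatOp (schrodingerInv U) s f)) =ᵐ[volume]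
      fun x => inner ℂ (kerVec U (t + s) x) f := h1.symm.trans h2
  exact congrFun (Continuous.ae_eq_iff_eq volume
    ((continuous_kerVec hd hg ht).inner continuous_const)
    ((continuous_kerVec hd hg (show 0 < t + s by linarith)).inner continuous_const) |>.1 h3) x

end

section

/-! ### The quantum density as a sum over the diagonal of the semigroup -/

variable {κ A a : ℝ} {U : Space d → ℝ}

/-- The kernel of `S_t B S_t` is `⟨k_x, B k_y⟩`, with `k_x` the kernel vectors of `S_t`. -/
theorem isContinuousKernel_heatOp (hd : d ≤ 3) (hU : IsCoercive κ U) (hg : HasExpGrowth A a U)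
    {t : ℝ} (ht : 0 < t) {B : OneParticle d →L[ℂ] OneParticle d} (hB : IsSelfAdjoint B) :
    IsContinuousKernel (heatOp (schrodingerInv U) t * B * heatOp (schrodingerInv U) t)
      (fun x y => inner ℂ (kerVec U t x) (B (kerVec U t y))) := by
  have hk := continuous_kerVec hd hg ht
  refine ⟨(hk.comp continuous_fst).inner (B.continuous.comp (hk.comp continuous_snd)),
    fun f => ?_⟩
  filter_upwards [heatOp_apply_ae_eq hd hU hg (B (heatOp (schrodingerInv U) t f)) ht] with x hx
  have h1 : (heatOp (schrodingerInv U) t * B * heatOp (schrodingerInv U) t) f x =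
      inner ℂ (heatOp (schrodingerInv U) t (B (kerVec U t x))) f := by
    rw [inner_comm_of_isSelfAdjoint (isSelfAdjoint_heatOp _ _), inner_comm_of_isSelfAdjoint hB]
    exact hx
  have h2 : (fun y => starRingEnd ℂ (heatOp (schrodingerInv U) t (B (kerVec U t x)) y) * f y)
      =ᵐ[volume] fun y => inner ℂ (kerVec U t x) (B (kerVec U t y)) * f y := by
    filter_upwards [heatOp_apply_ae_eq hd hU hg (B (kerVec U t x)) ht] with y hy
    rw [hy, inner_conj_symm, inner_comm_of_isSelfAdjoint hB]
  refine ⟨(integrable_conj_mul _ f).congr h2, ?_⟩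
  rw [h1, inner_eq_integral]
  exact integral_congr_ae h2

/-- A bounded operator has at most one continuous integral kernel. -/
theorem IsContinuousKernel.unique {T : OneParticle d →L[ℂ] OneParticle d}
    {K L : Space d → Space d → ℂ} (hK : IsContinuousKernel T K) (hL : IsContinuousKernel T L) :
    K = L := by
  have key : ∀ x, ∀ η : Space d → ℝ, IsTest η → ∫ y, η y • K x y = ∫ y, η y • L x y := by
    intro x η hη
    have hcont : ∀ {M : Space d → Space d → ℂ},
        Continuous (fun p : Space d × Space d => M p.1 p.2) →
        Continuous (fun x => ∫ y, η y • M x y) := by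
      intro M hM
      have h1 : Continuous (Function.uncurry fun x y => η y • M x y) :=
        (hη.continuous.comp continuous_snd).smul hM
      have h2 := continuous_parametric_integral_of_continuous (μ := (volume : Measure (Space d)))
        h1 hη.2.isCompact
      refine h2.congr fun x => ?_
      refine setIntegral_eq_integral_of_forall_compl_eq_zero fun y hy => ?_
      rw [image_eq_zero_of_notMem_tsupport hy, zero_smul]
    have hae : ∀ {M : Space d → Space d → ℂ}, IsContinuousKernel T M →
        T (rL2 η) =ᵐ[volume] fun x => ∫ y, η y • M x y := by
      intro M hM
      filter_upwards [hM.2 (rL2 η)] with x hx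
      rw [hx.2]
      refine integral_congr_ae ?_
      filter_upwards [coeFn_rL2 (hη.memLp 2)] with y hy
      rw [hy, Complex.real_smul, mul_comm]
    exact congrFun ((Continuous.ae_eq_iff_eq volume (hcont hK.1) (hcont hL.1)).1
      ((hae hK).symm.trans (hae hL))) x
  funext x
  have hc : ∀ {M : Space d → Space d → ℂ},
      Continuous (fun p : Space d × Space d => M p.1 p.2) → Continuous (M x) := fun hM =>
    hM.comp (by fun_prop : Continuous fun y : Space d => (x, y))
  refine (Continuous.ae_eq_iff_eq volume (hc hK.1) (hc hL.1)).1 ?_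
  exact ae_eq_of_integral_contDiff_smul_eq (hc hK.1).locallyIntegrable (hc hL.1).locallyIntegrable
    fun η h1 h2 => key x η ⟨h1, h2⟩

/-- The diagonal `e^{-t(-Δ+U)}(x; x)` of the heat kernel of `-Δ + U`, written as the square norm of
the kernel vector at half the time. -/
def heatDiag (U : Space d → ℝ) (t : ℝ) (x : Space d) : ℝ := ‖kerVec U (t / 2) x‖ ^ 2

/-- The quantum density `ϱ_τ^U`, the diagonal of the kernel given by the factorisation
`boseOperator_eq` of the Bose operator. -/
def density (τ : ℝ) (U : Space d → ℝ) (x : Space d) : ℝ :=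
  (inner ℂ (kerVec U (τ⁻¹ / 2) x) (boseFactor τ (schrodingerInv U) (kerVec U (τ⁻¹ / 2) x))).re

theorem inner_kerVec_heatOp (hd : d ≤ 3) (hU : IsCoercive κ U) (hg : HasExpGrowth A a U)
    {s t : ℝ} (hs : 0 ≤ s) (ht : 0 < t) (x : Space d) :
    inner ℂ (kerVec U t x) (heatOp (schrodingerInv U) s (kerVec U t x)) =
      (heatDiag U (2 * t + s) x : ℂ) := by
  have hR := isPositive_schrodingerInv U
  have e : s = s / 2 + s / 2 := by ring
  have h2 : t + s / 2 = (2 * t + s) / 2 := by ring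
  conv_lhs => rw [e, heatOp_add hR (by linarith) (by linarith)]
  change inner ℂ _ (heatOp (schrodingerInv U) (s / 2) (heatOp (schrodingerInv U) (s / 2) _)) = _
  rw [← inner_comm_of_isSelfAdjoint (isSelfAdjoint_heatOp _ _),
    heatOp_kerVec hd hU hg (by linarith) ht, inner_self_eq_norm_sq_to_K, h2, heatDiag]
  push_cast
  rfl

/-- Expanding the Bose function into a geometric series, `ϱ_τ^U` is a Riemann sum of mesh `1/τ` of
the diagonal of the heat kernel, as a function of time. -/
theorem hasSum_density (hd : d ≤ 3) (hU : IsCoercive κ U) (hg : HasExpGrowth A a U)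
    {τ : ℝ} (hτ : 0 < τ) (x : Space d) :
    HasSum (fun n : ℕ => τ⁻¹ * heatDiag U ((n + 1) * τ⁻¹) x) (density τ U x) := by
  have hR := isPositive_schrodingerInv U
  have hs := hasSum_boseFactor hR hU.pos (norm_schrodingerInv_le hU) hτ
  have hτ' : 0 < τ⁻¹ := inv_pos.2 hτ
  set k := kerVec U (τ⁻¹ / 2) x with hk
  have h1 := (Complex.reCLM.hasSum ((innerSL ℂ k).hasSum
    (((ContinuousLinearMap.apply ℂ (OneParticle d)) k).hasSum hs)))
  refine (h1.congr_fun fun n => ?_)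
  change _ = (inner ℂ k (τ⁻¹ • heatOp (schrodingerInv U) (n * τ⁻¹) k)).re
  rw [inner_smul_right_eq_smul, hk, inner_kerVec_heatOp hd hU hg (by positivity) (by positivity),
    Complex.real_smul, ← Complex.ofReal_mul, Complex.ofReal_re]
  congr 2
  ring

theorem density_eq_tsum (hd : d ≤ 3) (hU : IsCoercive κ U) (hg : HasExpGrowth A a U)
    {τ : ℝ} (hτ : 0 < τ) (x : Space d) :
    density τ U x = ∑' n : ℕ, τ⁻¹ * heatDiag U ((n + 1) * τ⁻¹) x :=
  (hasSum_density hd hU hg hτ x).tsum_eq.symm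

/-- The quantum density exists and is unique. -/
theorem isQuantumDensity_iff (hd : d ≤ 3) (hU : IsCoercive κ U) (hg : HasExpGrowth A a U)
    {τ : ℝ} (hτ : 0 < τ) {ϱ : Space d → ℝ} : IsQuantumDensity τ U ϱ ↔ ϱ = density τ U := by
  have hR := isPositive_schrodingerInv U
  have hB := isSelfAdjoint_boseFactor hR hU.pos (norm_schrodingerInv_le hU) hτ
  have hτ' : 0 < τ⁻¹ := inv_pos.2 hτ
  have hK := isContinuousKernel_heatOp hd hU hg (half_pos hτ') hB
  have hG := boseOperator_eq hR hU.pos (norm_schrodingerInv_le hU) hτ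
  rw [← hG] at hK
  have hreal : ∀ x, inner ℂ (kerVec U (τ⁻¹ / 2) x)
      (boseFactor τ (schrodingerInv U) (kerVec U (τ⁻¹ / 2) x)) = (density τ U x : ℂ) := by
    intro x
    rw [density, eq_comm]
    refine Complex.conj_eq_iff_re.1 ?_
    rw [inner_conj_symm, inner_comm_of_isSelfAdjoint hB]
  constructor
  · rintro ⟨G, K, ⟨R, hR1, -, rfl⟩, hK', hϱ⟩
    rw [hR1.eq hU] at hK'
    rw [hK'.unique hK] at hϱ
    funext x
    have h1 := hϱ x
    simp only [hreal] at h1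
    exact (Complex.ofReal_injective h1).symm
  · rintro rfl
    exact ⟨_, _, ⟨_, isSchrodingerInverse_schrodingerInv hU, isSelfAdjoint_schrodingerInv U, rfl⟩,
      hK, hreal⟩

end

section

/-! ### Estimates for the diagonal of the semigroup -/

variable {κ A a : ℝ} {U : Space d → ℝ}

/-- A smooth bump function around `x₀`, used to approximate the delta function. -/
def bump (x₀ : Space d) (n : ℕ) : ContDiffBump x₀ where
  rIn := 1 / (2 * (n + 1))
  rOut := 1 / (n + 1)
  rIn_pos := by positivity
  rIn_lt_rOut := by
    have h : (0 : ℝ) < n + 1 := by positivity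
    exact one_div_lt_one_div_of_lt h (by linarith)

/-- A sequence of nonnegative test functions converging to the delta function at `x₀`. -/
def approxDelta (x₀ : Space d) (n : ℕ) : Space d → ℝ := (bump x₀ n).normed volume

theorem isTest_approxDelta (x₀ : Space d) (n : ℕ) : IsTest (approxDelta x₀ n) :=
  ⟨(bump x₀ n).contDiff_normed, (bump x₀ n).hasCompactSupport_normed⟩

theorem approxDelta_nonneg (x₀ : Space d) (n : ℕ) (x : Space d) : 0 ≤ approxDelta x₀ n x :=
  (bump x₀ n).nonneg_normed x

theorem integral_approxDelta (x₀ : Space d) (n : ℕ) : ∫ x, approxDelta x₀ n x = 1 :=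
  (bump x₀ n).integral_normed

theorem norm_sub_lt_of_approxDelta_ne_zero {x₀ : Space d} {n : ℕ} {x : Space d}
    (h : approxDelta x₀ n x ≠ 0) : ‖x - x₀‖ < 1 / (n + 1) := by
  have h1 : x ∈ Function.support ((bump x₀ n).normed volume) := h
  rw [ContDiffBump.support_normed_eq, Metric.mem_ball, dist_eq_norm] at h1
  exact h1

/-- The kernel vector is the semigroup applied to a delta function. -/
theorem tendsto_heatOp_approxDelta (hd : d ≤ 3) (hU : IsCoercive κ U) (hg : HasExpGrowth A a U)
    {t : ℝ} (ht : 0 < t) (x₀ : Space d) :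
    Tendsto (fun n => heatOp (schrodingerInv U) t (rL2 (approxDelta x₀ n))) atTop
      (𝓝 (kerVec U t x₀)) := by
  rw [tendsto_iff_norm_sub_tendsto_zero]
  refine (Metric.tendsto_atTop.2 fun ε hε => ?_)
  have hk := (continuous_kerVec hd hg ht).continuousAt (x := x₀)
  obtain ⟨δ, hδ, hδ2⟩ := Metric.continuousAt_iff.1 hk (ε / 2) (by linarith)
  obtain ⟨N, hN⟩ := exists_nat_one_div_lt hδ
  refine ⟨N, fun n hn => ?_⟩
  rw [dist_zero_right, norm_norm]
  refine lt_of_le_of_lt ?_ (show ε / 2 < ε by linarith)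
  set v := heatOp (schrodingerInv U) t (rL2 (approxDelta x₀ n)) - kerVec U t x₀ with hv
  have hρ := isTest_approxDelta x₀ n
  -- `‖v‖²` is the average of `⟨k_x - k_{x₀}, v⟩` over points `x` close to `x₀`
  have key : ‖(inner ℂ v v : ℂ)‖ ≤ ε / 2 * ‖v‖ := by
    have e1 : inner ℂ v v = ∫ x, approxDelta x₀ n x • inner ℂ (kerVec U t x - kerVec U t x₀) v := by
      conv_lhs => rw [hv, inner_sub_left, inner_comm_of_isSelfAdjoint (isSelfAdjoint_heatOp _ _),
        inner_heatOp_eq_integral_kerVec hd hU hg hρ _ ht]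
      have e2 : inner ℂ (kerVec U t x₀) v =
          ∫ x, approxDelta x₀ n x • inner ℂ (kerVec U t x₀) v := by
        rw [integral_smul_const, integral_approxDelta, one_smul]
      rw [← hv, e2, ← integral_sub]
      · simp only [inner_sub_left, smul_sub]
      · exact (hρ.continuous.smul ((continuous_kerVec hd hg ht).inner
          continuous_const)).integrable_of_hasCompactSupport hρ.2.smul_right
      · exact hρ.integrable.smul_const _
    rw [e1]
    have hb : Integrable (fun x => approxDelta x₀ n x * (ε / 2 * ‖v‖)) :=
      hρ.integrable.mul_const _
    refine (norm_integral_le_of_norm_le hb (Eventually.of_forall fun x => ?_)).trans ?_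
    · rw [norm_smul, Real.norm_of_nonneg (approxDelta_nonneg _ _ _)]
      rcases eq_or_ne (approxDelta x₀ n x) 0 with h0 | h0
      · simp [h0]
      refine mul_le_mul_of_nonneg_left ((norm_inner_le_norm _ _).trans ?_)
        (approxDelta_nonneg _ _ _)
      refine mul_le_mul_of_nonneg_right ?_ (norm_nonneg _)
      rw [← dist_eq_norm]
      refine (hδ2 ?_).le
      rw [dist_eq_norm]
      refine (norm_sub_lt_of_approxDelta_ne_zero h0).trans (lt_of_le_of_lt ?_ hN)
      have : (N : ℝ) ≤ n := by exact_mod_cast hn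
      gcongr
    · rw [integral_mul_const, integral_approxDelta, one_mul]
  rw [inner_self_eq_norm_sq_to_K, norm_pow] at key
  simp only [Complex.coe_algebraMap, Complex.norm_real, norm_norm] at key
  by_contra! h
  have : 0 < ‖v‖ := by linarith
  nlinarith

theorem tendsto_inner_approxDelta (hd : d ≤ 3) (hU : IsCoercive κ U) (hg : HasExpGrowth A a U)
    {t : ℝ} (ht : 0 < t) (x₀ : Space d) :
    Tendsto (fun n => (inner ℂ (rL2 (approxDelta x₀ n))
      (heatOp (schrodingerInv U) t (rL2 (approxDelta x₀ n)))).re) atTop (𝓝 (heatDiag U t x₀)) := by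
  have h1 := ((tendsto_heatOp_approxDelta hd hU hg (half_pos ht) x₀).norm.pow 2)
  refine h1.congr fun n => ?_
  have hR := isPositive_schrodingerInv U
  have e : t = t / 2 + t / 2 := by ring
  conv_rhs => rw [e, heatOp_add hR (by linarith) (by linarith)]
  change _ = (inner ℂ _ (heatOp (schrodingerInv U) (t / 2)
    (heatOp (schrodingerInv U) (t / 2) _))).re
  rw [← inner_comm_of_isSelfAdjoint (isSelfAdjoint_heatOp _ _), inner_self_eq_norm_sq_to_K]
  norm_cast

theorem heatDiag_nonneg (t : ℝ) (x : Space d) : 0 ≤ heatDiag U t x := sq_nonneg _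

theorem heatDiag_add_le (hd : d ≤ 3) (hU : IsCoercive κ U) (hg : HasExpGrowth A a U)
    {s t : ℝ} (hs : 0 ≤ s) (ht : 0 < t) (x : Space d) :
    heatDiag U (t + s) x ≤ heatDiag U t x := by
  have h1 : (t + s) / 2 = t / 2 + s / 2 := by ring
  rw [heatDiag, heatDiag, h1, ← heatOp_kerVec hd hU hg (by linarith) (by linarith)]
  have h2 := ContinuousLinearMap.le_of_opNorm_le _
    (norm_heatOp_le_one (isPositive_schrodingerInv U) (show 0 ≤ s / 2 by linarith))
    (kerVec U (t / 2) x)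
  rw [one_mul] at h2
  gcongr

theorem heatDiag_antitoneOn (hd : d ≤ 3) (hU : IsCoercive κ U) (hg : HasExpGrowth A a U)
    (x : Space d) : AntitoneOn (fun t => heatDiag U t x) (Ioi 0) := by
  intro s hs t _ hst
  have := heatDiag_add_le hd hU hg (sub_nonneg.2 hst) hs x
  rwa [add_sub_cancel] at this

theorem abs_heat_approxDelta_le {t : ℝ} (ht : 0 < t) (x₀ : Space d) (n : ℕ) (x : Space d) :
    |heat t (approxDelta x₀ n) x| ≤ (4 * Real.pi * t) ^ (-(d / 2 : ℝ)) := by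
  have h := abs_heat_le ht (isTest_approxDelta x₀ n).integrable x
  simp only [abs_of_nonneg (approxDelta_nonneg x₀ n _)] at h
  rwa [integral_approxDelta, mul_one] at h

theorem heatDiag_le (hd : d ≤ 3) (hU : IsCoercive κ U) (hg : HasExpGrowth A a U)
    {t : ℝ} (ht : 0 < t) (x : Space d) :
    heatDiag U t x ≤ Real.exp (-(κ * t)) * (4 * Real.pi * t) ^ (-(d / 2 : ℝ)) := by
  refine le_of_tendsto (tendsto_inner_approxDelta hd hU hg ht x)
    (Eventually.of_forall fun n => ?_)
  have hρ := isTest_approxDelta x n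
  have hρ0 := approxDelta_nonneg x n
  refine (inner_heatOp_le hU hg hρ hρ0 (isNonneg_rL2 (hρ.memLp 2)
    (Eventually.of_forall hρ0)) ht.le).trans ?_
  refine mul_le_mul_of_nonneg_left ?_ (Real.exp_pos _).le
  rw [inner_rL2 (memLp_heat hρ t), re_integral_smul_rL2 (hρ.memLp 2)]
  refine (integral_mono_of_nonneg (Eventually.of_forall fun y => mul_nonneg
    (heat_nonneg hρ0 t y) (hρ0 y)) (hρ.integrable.const_mul _) (Eventually.of_forall fun y =>
      mul_le_mul_of_nonneg_right ((le_abs_self _).trans (abs_heat_approxDelta_le ht x n y))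
        (hρ0 y))).trans ?_
  rw [integral_const_mul, integral_approxDelta, mul_one]

theorem isCoercive_const (hκ : 0 < κ) : IsCoercive κ (fun _ : Space d => κ) :=
  ⟨hκ, aestronglyMeasurable_const, Eventually.of_forall fun _ => le_rfl⟩

theorem hasExpGrowth_const (hκ : 0 < κ) : HasExpGrowth κ 0 (fun _ : Space d => κ) :=
  ⟨le_rfl, aestronglyMeasurable_const, Eventually.of_forall fun x => by simp [abs_of_pos hκ]⟩

/-- For a constant potential the semigroup is the damped heat semigroup. -/
theorem inner_heatOp_const (hκ : 0 < κ) {φ : Space d → ℝ} (h : IsTest φ) (f : OneParticle d)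
    {t : ℝ} (ht : 0 < t) :
    inner ℂ (rL2 φ) (heatOp (schrodingerInv (fun _ : Space d => κ)) t f) =
      (Real.exp (-(κ * t)) : ℂ) * inner ℂ (rL2 (heat t φ)) f := by
  have hU := isCoercive_const (d := d) hκ
  have hg := hasExpGrowth_const (d := d) hκ
  have hc := continuousOn_inner_heat_heatOp hU hg h f t
  have hmul : ∀ s, rL2 (fun x => κ * heat s φ x) = (κ : ℂ) • rL2 (heat s φ) := by
    intro s
    refine Lp.ext ?_
    filter_upwards [coeFn_rL2 (memLp_mul_heat hg h s), coeFn_rL2 (memLp_heat h s),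
      Lp.coeFn_smul (κ : ℂ) (rL2 (heat s φ))] with x h1 h2 h3
    rw [h1, h3, Pi.smul_apply, h2, smul_eq_mul, Complex.ofReal_mul]
  have key := intervalIntegral.integral_eq_sub_of_hasDerivAt_of_le ht.le
    (f := fun s => (Real.exp (-(κ * (t - s))) : ℂ) * inner ℂ (rL2 (heat (t - s) φ))
      (heatOp (schrodingerInv (fun _ : Space d => κ)) s f)) (f' := fun _ => 0) ?_ ?_ (by simp)
  · simp only [intervalIntegral.integral_zero, sub_self, sub_zero, heat_zero, heatOp_zero,
      mul_zero, neg_zero, Real.exp_zero, Complex.ofReal_one, one_mul] at key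
    exact sub_eq_zero.1 key.symm
  · exact ContinuousOn.mul (by fun_prop) hc
  · intro s hs
    have e1 : HasDerivAt (fun s => (Real.exp (-(κ * (t - s))) : ℂ))
        ((Real.exp (-(κ * (t - s))) * κ : ℝ) : ℂ) s := by
      have : HasDerivAt (fun s => -(κ * (t - s))) κ s := by
        have := (((hasDerivAt_id s).const_sub t).const_mul κ).neg
        simpa using! this
      exact this.exp.ofReal_comp
    refine (e1.mul (hasDerivAt_inner_heat_heatOp hU hg h f hs.1 hs.2)).congr_deriv ?_
    rw [hmul, inner_smul_left, Complex.conj_ofReal]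
    push_cast
    ring

theorem kerVec_const (hd : d ≤ 3) (hκ : 0 < κ) {t : ℝ} (ht : 0 < t) (x : Space d) :
    kerVec (fun _ => κ) t x = (Real.exp (-(κ * t)) : ℂ) • mulGauss (fun _ => 1) t x := by
  have hU := isCoercive_const (d := d) hκ
  have hg := hasExpGrowth_const (d := d) hκ
  have hc1 : Continuous (fun x : Space d => mulGauss (fun _ => 1) t x) := by
    have h1 := continuousOn_mulGauss (d := d) hasExpGrowth_one
    have h2 : ContinuousOn (fun x : Space d => mulGauss (fun _ => 1) t x) univ :=
      h1.comp (f := fun x : Space d => (t, x)) (by fun_prop) fun x _ => ⟨ht, mem_univ _⟩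
    exact continuousOn_univ.1 h2
  refine ext_inner_right ℂ fun f => ?_
  have c1 := (continuous_kerVec hd hg ht).inner (𝕜 := ℂ) (continuous_const (y := f))
  have c2 := (hc1.const_smul (Real.exp (-(κ * t)) : ℂ)).inner (𝕜 := ℂ) (continuous_const (y := f))
  refine congrFun ((Continuous.ae_eq_iff_eq volume c1 c2).1 ?_) x
  refine ae_eq_of_integral_contDiff_smul_eq c1.locallyIntegrable c2.locallyIntegrable
    fun φ h1 h2 => ?_
  have h : IsTest φ := ⟨h1, h2⟩
  rw [← inner_heatOp_eq_integral_kerVec hd hU hg h f ht, inner_heatOp_const hκ h f ht]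
  have h3 := inner_mul_heat hasExpGrowth_one h ht f
  simp only [one_mul] at h3
  rw [h3, ← integral_const_mul]
  refine integral_congr_ae (Eventually.of_forall fun y => ?_)
  simp only [Pi.smul_apply, inner_smul_left, Complex.conj_ofReal, Complex.real_smul]
  ring

theorem heatDiag_const (hd : d ≤ 3) (hκ : 0 < κ) {t : ℝ} (ht : 0 < t) (x y : Space d) :
    heatDiag (fun _ => κ) t x = heatDiag (fun _ => κ) t y := by
  have h : ∀ x : Space d, ‖mulGauss (fun _ => 1) (t / 2) x‖ ^ 2 =
      ∫ z : Space d, gaussK (t / 2) z ^ 2 := by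
    intro x
    rw [norm_sq_eq_integral,
      ← integral_sub_right_eq_self (fun z : Space d => gaussK (t / 2) z ^ 2) x]
    refine integral_congr_ae ?_
    filter_upwards [coeFn_rL2 (memLp_mul_gaussK hasExpGrowth_one (half_pos ht) x)] with z hz
    rw [mulGauss, hz, Complex.norm_real, one_mul, Real.norm_eq_abs, sq_abs]
  rw [heatDiag, heatDiag, kerVec_const hd hκ (half_pos ht), kerVec_const hd hκ (half_pos ht),
    norm_smul, norm_smul, mul_pow, mul_pow, h, h]

theorem density_const (hd : d ≤ 3) (hκ : 0 < κ) {τ : ℝ} (hτ : 0 < τ) (x y : Space d) :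
    density τ (fun _ => κ) x = density τ (fun _ => κ) y := by
  have hU := isCoercive_const (d := d) hκ
  have hg := hasExpGrowth_const (d := d) hκ
  rw [density_eq_tsum hd hU hg hτ, density_eq_tsum hd hU hg hτ]
  refine tsum_congr fun n => ?_
  rw [heatDiag_const hd hκ (by positivity) x y]

end

section

variable {κ A a b A' b' : ℝ} {U U' : Space d → ℝ}

/-- Exponential moment of the heat flow of an approximate delta function, uniform in the
approximation. -/
theorem integrable_heat_approxDelta_mul_exp {s : ℝ} (hs : 0 < s) (ha : 0 ≤ a) (x₀ : Space d)
    (n : ℕ) : Integrable (fun z => heat s (approxDelta x₀ n) z * Real.exp (a * ‖z - x₀‖)) ∧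
      ∫ z, heat s (approxDelta x₀ n) z * Real.exp (a * ‖z - x₀‖) ≤
        Real.exp a * (2 ^ (d / 2 : ℝ) * Real.exp (2 * a ^ 2 * s)) := by
  set ρ := approxDelta x₀ n with hρd
  have hρ : IsTest ρ := isTest_approxDelta x₀ n
  have hρ0 : ∀ x, 0 ≤ ρ x := approxDelta_nonneg x₀ n
  set G : Space d → ℝ := fun y => gaussK s y * Real.exp (a * ‖y‖) with hG
  have hGi : Integrable G := integrable_gaussK_mul_exp hs a
  have hGc : Continuous G := (continuous_gaussK s).mul (by fun_prop)
  set c := convolution ρ G (ContinuousLinearMap.lsmul ℝ ℝ) volume with hc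
  have hci : Integrable c := hρ.integrable.integrable_convolution _ hGi
  have hle : ∀ z, heat s ρ z * Real.exp (a * ‖z - x₀‖) ≤ Real.exp a * c z := by
    intro z
    rw [heat_eq_conv hs, ← integral_mul_const, hc, convolution_def, ← integral_const_mul]
    refine integral_mono_of_nonneg (Eventually.of_forall fun y => mul_nonneg
      (mul_nonneg (gaussK_nonneg hs _) (hρ0 y)) (Real.exp_pos _).le) ?_
      (Eventually.of_forall fun y => ?_)
    · refine Integrable.const_mul ?_ _
      refine Continuous.integrable_of_hasCompactSupport ?_ ?_
      · simp only [ContinuousLinearMap.lsmul_apply]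
        exact hρ.continuous.smul (hGc.comp (by fun_prop))
      · simp only [ContinuousLinearMap.lsmul_apply]
        exact hρ.2.smul_right
    · simp only [ContinuousLinearMap.lsmul_apply, smul_eq_mul, hG]
      rcases eq_or_ne (ρ y) 0 with h0 | h0
      · simp [h0]
      have h1 : ‖y - x₀‖ ≤ 1 := by
        refine (norm_sub_lt_of_approxDelta_ne_zero h0).le.trans ?_
        rw [div_le_one (by positivity)]
        have : (0 : ℝ) ≤ n := by positivity
        linarith
      have h2 : Real.exp (a * ‖z - x₀‖) ≤ Real.exp a * Real.exp (a * ‖z - y‖) := by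
        rw [← Real.exp_add]
        refine Real.exp_le_exp.2 ?_
        have h3 := norm_add_le (z - y) (y - x₀)
        rw [sub_add_sub_cancel] at h3
        nlinarith
      have h4 : 0 ≤ gaussK s (z - y) * ρ y := mul_nonneg (gaussK_nonneg hs _) (hρ0 y)
      refine (mul_le_mul_of_nonneg_left h2 h4).trans (le_of_eq ?_)
      ring
  have hcont : Continuous (fun z => heat s ρ z * Real.exp (a * ‖z - x₀‖)) :=
    ((continuous_heat hρ).comp (by fun_prop : Continuous fun z : Space d => (s, z))).mul
      (by fun_prop)
  have hnn : ∀ z, 0 ≤ heat s ρ z * Real.exp (a * ‖z - x₀‖) := fun z =>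
    mul_nonneg (heat_nonneg hρ0 s z) (Real.exp_pos _).le
  have hint : Integrable (fun z => heat s ρ z * Real.exp (a * ‖z - x₀‖)) := by
    refine (hci.const_mul (Real.exp a)).mono' hcont.aestronglyMeasurable
      (Eventually.of_forall fun z => ?_)
    rw [Real.norm_of_nonneg (hnn z)]
    exact hle z
  refine ⟨hint, (integral_mono hint (hci.const_mul _) hle).trans ?_⟩
  rw [integral_const_mul]
  refine mul_le_mul_of_nonneg_left ?_ (Real.exp_pos _).le
  rw [hc, integral_convolution (ContinuousLinearMap.lsmul ℝ ℝ) hρ.integrable hGi, hρd,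
    integral_approxDelta, ContinuousLinearMap.lsmul_apply, one_smul]
  exact integral_gaussK_mul_exp_le hs a

/-- Bound for an integral of a product of two heat flows against an exponential weight: the flow at
the larger time `p` is bounded uniformly, the one at the smaller time `q` is integrated. -/
theorem norm_integral_le_of_heat_approxDelta {E p q : ℝ} (hE : 0 ≤ E) (ha : 0 ≤ a) (hq : 0 < q)
    (hqp : q ≤ p) {x₀ : Space d} {n : ℕ} {g : Space d → ℂ}
    (hg : ∀ᵐ z, ‖g z‖ ≤ E * Real.exp (a * ‖z - x₀‖) *
      ((Real.exp (-(κ * p)) * heat p (approxDelta x₀ n) z) *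
        (Real.exp (-(κ * q)) * heat q (approxDelta x₀ n) z))) :
    ‖∫ z, g z‖ ≤ E * Real.exp a * Real.exp (-((κ - 2 * a ^ 2) * (p + q))) *
      (p + q) ^ (-(d / 2 : ℝ)) := by
  obtain ⟨hi, hb⟩ := integrable_heat_approxDelta_mul_exp (d := d) hq ha x₀ n
  have hp : 0 < p := hq.trans_le hqp
  have hd2 : -(d / 2 : ℝ) ≤ 0 := by
    have : (0 : ℝ) ≤ d / 2 := by positivity
    linarith
  set K : ℝ := E * Real.exp (-(κ * (p + q))) * (2 * (p + q)) ^ (-(d / 2 : ℝ)) with hK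
  have hK0 : 0 ≤ K := by positivity
  refine (norm_integral_le_of_norm_le (hi.const_mul K) ?_).trans ?_
  · filter_upwards [hg] with z hz
    refine hz.trans ?_
    have h1 : heat p (approxDelta x₀ n) z ≤ (2 * (p + q)) ^ (-(d / 2 : ℝ)) := by
      refine (le_abs_self _).trans ((abs_heat_approxDelta_le hp x₀ n z).trans ?_)
      refine Real.rpow_le_rpow_of_nonpos (by positivity) ?_ hd2
      have := Real.pi_gt_three
      nlinarith
    have h2 := heat_nonneg (approxDelta_nonneg x₀ n) q z
    have h3 : Real.exp (-(κ * (p + q))) = Real.exp (-(κ * p)) * Real.exp (-(κ * q)) := by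
      rw [← Real.exp_add]
      congr 1
      ring
    rw [hK, h3]
    calc _ = E * (Real.exp (-(κ * p)) * Real.exp (-(κ * q))) * heat p (approxDelta x₀ n) z *
          (heat q (approxDelta x₀ n) z * Real.exp (a * ‖z - x₀‖)) := by ring
      _ ≤ _ := by gcongr
  · rw [integral_const_mul]
    refine (mul_le_mul_of_nonneg_left hb hK0).trans ?_
    have hpq : 0 < p + q := by linarith
    have h4 : (2 * (p + q)) ^ (-(d / 2 : ℝ)) * 2 ^ (d / 2 : ℝ) = (p + q) ^ (-(d / 2 : ℝ)) := by
      rw [Real.mul_rpow (by norm_num) hpq.le, Real.rpow_neg (by norm_num : (0 : ℝ) ≤ 2)]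
      have : (0 : ℝ) < 2 ^ (d / 2 : ℝ) := by positivity
      field_simp
    have h5 : Real.exp (-(κ * (p + q))) * Real.exp (2 * a ^ 2 * q) ≤
        Real.exp (-((κ - 2 * a ^ 2) * (p + q))) := by
      rw [← Real.exp_add]
      refine Real.exp_le_exp.2 ?_
      nlinarith [sq_nonneg a]
    calc _ = E * Real.exp a * (Real.exp (-(κ * (p + q))) * Real.exp (2 * a ^ 2 * q)) *
          ((2 * (p + q)) ^ (-(d / 2 : ℝ)) * 2 ^ (d / 2 : ℝ)) := by rw [hK]; ring
      _ ≤ _ := by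
        rw [h4]
        gcongr

/-- By domination, the semigroup of one potential maps test functions to states of finite energy for
another potential. -/
theorem finitePotentialEnergy_heatOp (hU' : IsCoercive κ U') (hg : HasExpGrowth A b U)
    (hg' : HasExpGrowth A' b' U') {φ : Space d → ℝ} (h : IsTest φ) (h0 : ∀ x, 0 ≤ φ x) {t : ℝ}
    (ht : 0 ≤ t) :
    FinitePotentialEnergy U (heatOp (schrodingerInv U') t (rL2 φ)) := by
  have h1 : Integrable (fun x => (U x * heat t φ x) * heat t φ x) :=
    (memLp_mul_heat hg h t).integrable_mul (memLp_heat h t)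
  refine (h1.norm.const_mul (Real.exp (-(κ * t)) ^ 2)).mono'
    (hg.meas.mul ((Lp.memLp _).1.norm.pow 2)) ?_
  filter_upwards [norm_heatOp_apply_le hU' hg' h h0 ht] with x hx
  rw [norm_mul, norm_pow, norm_norm]
  calc _ ≤ ‖U x‖ * (Real.exp (-(κ * t)) * heat t φ x) ^ 2 := by gcongr
    _ = _ := by
      rw [norm_mul, norm_mul, Real.norm_of_nonneg (heat_nonneg h0 t x)]
      ring

/-- The derivative of `⟨S'_{t-s} φ, S_s φ⟩` in `s`, for two Schrödinger semigroups. -/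
theorem hasDerivAt_inner_heatOp_heatOp (hU : IsCoercive κ U) (hU' : IsCoercive κ U')
    (hg : HasExpGrowth A b U) (hg' : HasExpGrowth A' b' U') {φ : Space d → ℝ} (h : IsTest φ)
    (h0 : ∀ x, 0 ≤ φ x) {s t : ℝ} (hs : 0 < s) (hst : s < t) :
    HasDerivAt (fun s => inner ℂ (heatOp (schrodingerInv U') (t - s) (rL2 φ))
        (heatOp (schrodingerInv U) s (rL2 φ)))
      (∫ x, ((U' x - U x : ℝ) : ℂ) * (starRingEnd ℂ (heatOp (schrodingerInv U') (t - s) (rL2 φ) x) *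
        heatOp (schrodingerInv U) s (rL2 φ) x)) s := by
  have hR := isPositive_schrodingerInv U
  have hR' := isPositive_schrodingerInv U'
  have hts := sub_pos.2 hst
  have h1 := (hasDerivAt_heatOp_apply hR' hts (rL2 φ)).comp_const_sub t s
  have h2 := h1.inner ℂ (hasDerivAt_heatOp_apply hR hs (rL2 φ))
  refine h2.congr_deriv ?_
  set f := heatOp (schrodingerInv U) s (rL2 φ) with hf
  set f' := heatOp (schrodingerInv U') (t - s) (rL2 φ) with hf'
  set g := genOp (schrodingerInv U) s (rL2 φ) with hgd
  set g' := genOp (schrodingerInv U') (t - s) (rL2 φ) with hgd'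
  have e1 : schrodingerInv U g = f := by rw [hf, heatOp_eq_mul_genOp hR hs]; rfl
  have e2 : schrodingerInv U' g' = f' := by rw [hf', heatOp_eq_mul_genOp hR' hts]; rfl
  obtain ⟨F, hF, hfU, hS⟩ := schrodingerEq_schrodingerInv hU g
  obtain ⟨F', hF', hfU', hS'⟩ := schrodingerEq_schrodingerInv hU' g'
  rw [e1] at hF hfU hS
  rw [e2] at hF' hfU' hS'
  -- each state is an admissible test function in the equation of the other one
  have k1 : FinitePotentialEnergy U f' := finitePotentialEnergy_heatOp hU' hg hg' h h0 hts.le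
  have k2 : FinitePotentialEnergy U' f := finitePotentialEnergy_heatOp hU hg' hg h h0 hs.le
  have hI : ∀ {W : Space d → ℝ} (hW : AEStronglyMeasurable W volume)
      (hWn : ∀ᵐ x, 0 ≤ W x) (_ : FinitePotentialEnergy W f) (_ : FinitePotentialEnergy W f'),
      Integrable (fun x => (W x : ℂ) * (starRingEnd ℂ (f' x) * f x)) := by
    intro W hW hWn i1 i2
    have hm : AEStronglyMeasurable (fun x => starRingEnd ℂ (f' x) * f x) volume :=
      (integrable_conj_mul f' f).1
    refine (i1.add i2).mono' ((Complex.continuous_ofReal.comp_aestronglyMeasurable hW).mul hm) ?_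
    filter_upwards [hWn] with x hx
    rw [norm_mul, Complex.norm_real, Real.norm_of_nonneg hx, norm_mul, RCLike.norm_conj,
      Pi.add_apply, ← mul_add]
    refine mul_le_mul_of_nonneg_left ?_ hx
    nlinarith [sq_nonneg (‖f x‖ - ‖f' x‖), sq_nonneg (‖f x‖), sq_nonneg (‖f' x‖)]
  have I1 := hI hU.meas (hU.le.mono fun x hx => hU.pos.le.trans hx) hfU k1
  have I2 := hI hU'.meas (hU'.le.mono fun x hx => hU'.pos.le.trans hx) k2 hfU'
  have q1 := hS f' F' hF' k1
  have q2 := congrArg (starRingEnd ℂ) (hS' f F hF k2)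
  rw [map_add, inner_conj_symm, map_sum, ← integral_conj] at q2
  simp only [inner_conj_symm, map_mul, Complex.conj_ofReal, Complex.conj_conj] at q2
  rw [inner_neg_right, neg_neg, ← q1, ← q2]
  have e3 : ∫ x, ((U' x - U x : ℝ) : ℂ) * (starRingEnd ℂ (f' x) * f x) =
      ∫ x, ((U' x : ℂ) * (starRingEnd ℂ (f' x) * f x) -
        (U x : ℂ) * (starRingEnd ℂ (f' x) * f x)) := by
    refine integral_congr_ae (Eventually.of_forall fun x => ?_)
    simp only
    push_cast
    ring
  rw [e3, integral_sub I2 I1]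
  have e4 : ∫ x, (U' x : ℂ) * (f x * starRingEnd ℂ (f' x)) =
      ∫ x, (U' x : ℂ) * (starRingEnd ℂ (f' x) * f x) := by
    refine integral_congr_ae (Eventually.of_forall fun x => ?_)
    simp only
    ring
  rw [e4]
  ring

/-- Lipschitz dependence of the diagonal of the semigroup on the potential: the mean value theorem
for `s ↦ ⟨S'_{t-s} ρ, S_s ρ⟩`, with `ρ` an approximate delta function, and domination of both
semigroups by the heat semigroup. -/
theorem abs_heatDiag_sub_le (hd : d ≤ 3) (hU : IsCoercive κ U) (hU' : IsCoercive κ U')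
    (hg : HasExpGrowth A b U) (hg' : HasExpGrowth A' b' U') {E : ℝ} (hE : 0 ≤ E) (ha : 0 ≤ a)
    {x₀ : Space d} (hUU' : ∀ᵐ z, |U' z - U z| ≤ E * Real.exp (a * ‖z - x₀‖)) {t : ℝ}
    (ht : 0 < t) : |heatDiag U t x₀ - heatDiag U' t x₀| ≤
      E * Real.exp a * Real.exp (-((κ - 2 * a ^ 2) * t)) * t ^ (-(d / 2 : ℝ)) * t := by
  have hR := isPositive_schrodingerInv U
  have hR' := isPositive_schrodingerInv U'
  refine le_of_tendsto ((tendsto_inner_approxDelta hd hU hg ht x₀).sub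
    (tendsto_inner_approxDelta hd hU' hg' ht x₀)).abs (Eventually.of_forall fun n => ?_)
  have h : IsTest (approxDelta x₀ n) := isTest_approxDelta x₀ n
  have h0 : ∀ x, 0 ≤ approxDelta x₀ n x := approxDelta_nonneg x₀ n
  set ρ := approxDelta x₀ n with hρ
  set D : ℝ → ℂ := fun s => ∫ x, ((U' x - U x : ℝ) : ℂ) *
    (starRingEnd ℂ (heatOp (schrodingerInv U') (t - s) (rL2 ρ) x) *
        heatOp (schrodingerInv U) s (rL2 ρ) x) with hD
  have hcont : ContinuousOn (fun s => (inner ℂ (heatOp (schrodingerInv U') (t - s) (rL2 ρ))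
      (heatOp (schrodingerInv U) s (rL2 ρ))).re) (Icc 0 t) := by
    refine Complex.continuous_re.comp_continuousOn (ContinuousOn.inner ?_ ?_)
    · exact (continuousOn_heatOp_apply hR' (denseRange_schrodingerInv hU' hg') (rL2 ρ)).comp
        (by fun_prop) fun s hs => sub_nonneg.2 hs.2
    · exact (continuousOn_heatOp_apply hR (denseRange_schrodingerInv hU hg) (rL2 ρ)).mono
        fun s hs => hs.1
  have hder : ∀ s ∈ Ioo 0 t, HasDerivAt (fun s => (inner ℂ (heatOp (schrodingerInv U') (t - s)
      (rL2 ρ)) (heatOp (schrodingerInv U) s (rL2 ρ))).re) (D s).re s := fun s hs =>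
    Complex.reCLM.hasFDerivAt.comp_hasDerivAt s
      (hasDerivAt_inner_heatOp_heatOp hU hU' hg hg' h h0 hs.1 hs.2)
  obtain ⟨s, hs, hslope⟩ := exists_hasDerivAt_eq_slope _ (fun s => (D s).re) ht hcont hder
  simp only [sub_self, sub_zero, heatOp_zero] at hslope
  rw [inner_comm_of_isSelfAdjoint (isSelfAdjoint_heatOp _ _)] at hslope
  rw [eq_div_iff ht.ne'] at hslope
  change |(inner ℂ (rL2 ρ) (heatOp (schrodingerInv U) t (rL2 ρ))).re -
    (inner ℂ (rL2 ρ) (heatOp (schrodingerInv U') t (rL2 ρ))).re| ≤ _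
  have e : (inner ℂ (rL2 ρ) (heatOp (schrodingerInv U) t (rL2 ρ))).re -
    (inner ℂ (rL2 ρ) (heatOp (schrodingerInv U') t (rL2 ρ))).re = (D s).re * t := hslope.symm
  rw [e, abs_mul, abs_of_pos ht]
  refine mul_le_mul_of_nonneg_right ((Complex.abs_re_le_norm _).trans ?_) ht.le
  have n1 := norm_heatOp_apply_le hU' hg' h h0 (sub_pos.2 hs.2).le
  have n2 := norm_heatOp_apply_le hU hg h h0 hs.1.le
  -- the larger of the two times `s` and `t - s` is at least `t / 2`
  rcases le_total s (t - s) with hle | hle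
  · have := norm_integral_le_of_heat_approxDelta (κ := κ) (p := t - s) (q := s) hE ha hs.1 hle
      (x₀ := x₀) (n := n) (g := fun x => ((U' x - U x : ℝ) : ℂ) *
        (starRingEnd ℂ (heatOp (schrodingerInv U') (t - s) (rL2 ρ) x) *
          heatOp (schrodingerInv U) s (rL2 ρ) x)) ?_
    · rwa [sub_add_cancel] at this
    · filter_upwards [n1, n2, hUU'] with x x1 x2 x3
      rw [norm_mul, norm_mul, RCLike.norm_conj, Complex.norm_real, Real.norm_eq_abs]
      have := heat_nonneg h0 (t - s) x
      have := heat_nonneg h0 s x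
      gcongr ?_ * (?_ * ?_)
  · have := norm_integral_le_of_heat_approxDelta (κ := κ) (p := s) (q := t - s) hE ha
      (sub_pos.2 hs.2) hle
      (x₀ := x₀) (n := n) (g := fun x => ((U' x - U x : ℝ) : ℂ) *
        (starRingEnd ℂ (heatOp (schrodingerInv U') (t - s) (rL2 ρ) x) *
          heatOp (schrodingerInv U) s (rL2 ρ) x)) ?_
    · rwa [add_sub_cancel] at this
    · filter_upwards [n1, n2, hUU'] with x x1 x2 x3
      rw [norm_mul, norm_mul, RCLike.norm_conj, Complex.norm_real, Real.norm_eq_abs,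
        mul_comm ‖heatOp (schrodingerInv U') (t - s) (rL2 ρ) x‖]
      have := heat_nonneg h0 (t - s) x
      have := heat_nonneg h0 s x
      gcongr ?_ * (?_ * ?_)

end

section

/-! ### The Hilbert–Schmidt norm -/

section HilbertSchmidt

variable {𝓗 : Type*} [NormedAddCommGroup 𝓗] [InnerProductSpace ℂ 𝓗]
  {ι ι' : Type*}

theorem enorm_sq_eq_ofReal {E : Type*} [NormedAddCommGroup E] (x : E) :
    ‖x‖ₑ ^ 2 = ENNReal.ofReal (‖x‖ ^ 2) := by
  rw [← ofReal_norm, ENNReal.ofReal_pow (norm_nonneg _)]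

theorem tsum_enorm_inner_sq (b : HilbertBasis ι ℂ 𝓗) (x : 𝓗) :
    ∑' i, ‖(inner ℂ (b i) x : ℂ)‖ₑ ^ 2 = ‖x‖ₑ ^ 2 := by
  have h1 := Complex.reCLM.hasSum (b.hasSum_inner_mul_inner x x)
  have h2 : HasSum (fun i => ‖(inner ℂ (b i) x : ℂ)‖ ^ 2) (‖x‖ ^ 2) := by
    convert h1 using 1
    · funext i
      rw [Complex.reCLM_apply, ← inner_conj_symm x (b i), ← Complex.normSq_eq_conj_mul_self,
        Complex.normSq_eq_norm_sq, Complex.ofReal_re]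
    · rw [inner_self_eq_norm_sq_to_K]
      norm_cast
  simp only [enorm_sq_eq_ofReal]
  rw [← ENNReal.ofReal_tsum_of_nonneg (fun i => sq_nonneg _) h2.summable, h2.tsum_eq]

theorem tsum_enorm_inner_sq_le {v : ι → 𝓗} (hv : Orthonormal ℂ v) (x : 𝓗) :
    ∑' i, ‖(inner ℂ (v i) x : ℂ)‖ₑ ^ 2 ≤ ‖x‖ₑ ^ 2 := by
  simp only [enorm_sq_eq_ofReal]
  rw [← ENNReal.ofReal_tsum_of_nonneg (fun i => sq_nonneg _) (hv.inner_products_summable (x := x))]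
  exact ENNReal.ofReal_le_ofReal (hv.tsum_inner_products_le (x := x))

theorem tsum_enorm_apply_sq_eq (b : HilbertBasis ι ℂ 𝓗) (T : 𝓗 →L[ℂ] 𝓗) (v : ι' → 𝓗) :
    ∑' j, ‖T (v j)‖ₑ ^ 2 = ∑' i, ∑' j, ‖(inner ℂ (b i) (T (v j)) : ℂ)‖ₑ ^ 2 := by
  rw [ENNReal.tsum_comm]
  simp only [tsum_enorm_inner_sq]

theorem enorm_inner_symm (x y : 𝓗) : ‖(inner ℂ x y : ℂ)‖ₑ = ‖(inner ℂ y x : ℂ)‖ₑ := by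
  rw [← ofReal_norm, ← ofReal_norm, norm_inner_symm]

theorem tsum_enorm_adjoint_sq [CompleteSpace 𝓗] (b : HilbertBasis ι ℂ 𝓗) (T : 𝓗 →L[ℂ] 𝓗) :
    ∑' i, ‖ContinuousLinearMap.adjoint T (b i)‖ₑ ^ 2 = ∑' i, ‖T (b i)‖ₑ ^ 2 := by
  rw [tsum_enorm_apply_sq_eq b T b]
  refine tsum_congr fun i => ?_
  rw [← tsum_enorm_inner_sq b]
  refine tsum_congr fun j => ?_
  rw [ContinuousLinearMap.adjoint_inner_right, enorm_inner_symm]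

theorem tsum_enorm_orthonormal_sq_le [CompleteSpace 𝓗] (b : HilbertBasis ι ℂ 𝓗)
    {T : 𝓗 →L[ℂ] 𝓗} {v : ι' → 𝓗} (hv : Orthonormal ℂ v) :
    ∑' j, ‖T (v j)‖ₑ ^ 2 ≤ ∑' i, ‖T (b i)‖ₑ ^ 2 := by
  rw [tsum_enorm_apply_sq_eq b T v, ← tsum_enorm_adjoint_sq b T]
  refine ENNReal.tsum_le_tsum fun i => ?_
  refine le_trans (le_of_eq (tsum_congr fun j => ?_)) (tsum_enorm_inner_sq_le hv _)
  rw [ContinuousLinearMap.adjoint_inner_right, enorm_inner_symm]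

theorem exists_sqrt [CompleteSpace 𝓗] {T : 𝓗 →L[ℂ] 𝓗} (hT : T.IsPositive) :
    ∃ S : 𝓗 →L[ℂ] 𝓗, IsSelfAdjoint S ∧ S * S = T := by
  have h0 : 0 ≤ T := (ContinuousLinearMap.nonneg_iff_isPositive T).2 hT
  exact ⟨CFC.sqrt T, (CFC.sqrt_nonneg T).isSelfAdjoint, CFC.sqrt_mul_sqrt_self T h0⟩

/-- The Hilbert–Schmidt norm is monotone on positive operators: with `s` and `t` the square roots of
`S ≤ T`, one has `‖s s‖ ≤ ‖t s‖ = ‖s t‖ ≤ ‖t t‖` for the Hilbert–Schmidt norms. -/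
theorem tsum_enorm_sq_le_of_le [CompleteSpace 𝓗] (b : HilbertBasis ι ℂ 𝓗) {S T : 𝓗 →L[ℂ] 𝓗}
    (hS : S.IsPositive) (hT : T.IsPositive)
    (hle : ∀ x, (inner ℂ x (S x)).re ≤ (inner ℂ x (T x)).re) :
    ∑' i, ‖S (b i)‖ₑ ^ 2 ≤ ∑' i, ‖T (b i)‖ₑ ^ 2 := by
  obtain ⟨s, hs, rfl⟩ := exists_sqrt hS
  obtain ⟨t, ht, rfl⟩ := exists_sqrt hT
  have hsym : ∀ {u : 𝓗 →L[ℂ] 𝓗}, IsSelfAdjoint u → ∀ x y, inner ℂ (u x) y = inner ℂ x (u y) :=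
    fun hu x y => inner_comm_of_isSelfAdjoint hu x y
  have hadj : ∀ x, (ContinuousLinearMap.adjoint (t * s)) x = (s * t) x := by
    intro x
    refine ext_inner_left ℂ fun y => ?_
    rw [ContinuousLinearMap.adjoint_inner_right]
    change inner ℂ (t (s y)) x = inner ℂ y (s (t x))
    rw [hsym ht, hsym hs]
  have key : ∀ (p q : 𝓗 →L[ℂ] 𝓗), IsSelfAdjoint p → IsSelfAdjoint q →
      ∀ y, (inner ℂ (p y) ((q * q) (p y))).re = ‖(q * p) y‖ ^ 2 := by
    intro p q hp hq y
    change (inner ℂ (p y) (q (q (p y)))).re = ‖q (p y)‖ ^ 2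
    rw [← hsym hq, inner_self_eq_norm_sq_to_K]
    norm_cast
  have h1 : ∀ y, ‖(s * s) y‖ₑ ^ 2 ≤ ‖(t * s) y‖ₑ ^ 2 := by
    intro y
    rw [enorm_sq_eq_ofReal, enorm_sq_eq_ofReal, ← key s s hs hs, ← key s t hs ht]
    exact ENNReal.ofReal_le_ofReal (hle _)
  have h2 : ∀ y, ‖(s * t) y‖ₑ ^ 2 ≤ ‖(t * t) y‖ₑ ^ 2 := by
    intro y
    rw [enorm_sq_eq_ofReal, enorm_sq_eq_ofReal, ← key t s ht hs, ← key t t ht ht]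
    exact ENNReal.ofReal_le_ofReal (hle _)
  refine (ENNReal.tsum_le_tsum fun i => h1 (b i)).trans ?_
  rw [← tsum_enorm_adjoint_sq b]
  simp only [hadj]
  exact ENNReal.tsum_le_tsum fun i => h2 (b i)

theorem isPositive_of_re_inner_nonneg [CompleteSpace 𝓗] {T : 𝓗 →L[ℂ] 𝓗} (hT : IsSelfAdjoint T)
    (h : ∀ x, 0 ≤ (inner ℂ x (T x)).re) : T.IsPositive := by
  rw [ContinuousLinearMap.isPositive_iff]
  refine ⟨hT.isSymmetric, fun x => ?_⟩
  rw [inner_comm_of_isSelfAdjoint hT]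
  have h1 : starRingEnd ℂ (inner ℂ x (T x)) = inner ℂ x (T x) := by
    rw [inner_conj_symm, inner_comm_of_isSelfAdjoint hT]
  rw [← Complex.conj_eq_iff_re.1 h1]
  exact Complex.zero_le_real.2 (h x)

/-- If `-δ T ≤ T' - T ≤ δ T` then the Hilbert–Schmidt norm of `T' - T` is at most a multiple of
`δ` times that of `T`. -/
theorem tsum_enorm_sub_sq_le [CompleteSpace 𝓗] (b : HilbertBasis ι ℂ 𝓗) {T T' : 𝓗 →L[ℂ] 𝓗}
    (hT : T.IsPositive) (hT' : IsSelfAdjoint T') {δ : ℝ} (hδ : 0 ≤ δ)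
    (h1 : ∀ x, (inner ℂ x (T' x)).re ≤ (1 + δ) * (inner ℂ x (T x)).re)
    (h2 : ∀ x, (1 - δ) * (inner ℂ x (T x)).re ≤ (inner ℂ x (T' x)).re) :
    ∑' i, ‖(T' - T) (b i)‖ₑ ^ 2 ≤ ENNReal.ofReal (10 * δ ^ 2) * ∑' i, ‖T (b i)‖ₑ ^ 2 := by
  -- `T' - T = P - δ T` with `0 ≤ P ≤ 2 δ T`
  set P : 𝓗 →L[ℂ] 𝓗 := T' - ((1 - δ : ℝ) : ℂ) • T with hP
  have hTs : IsSelfAdjoint T := hT.isSelfAdjoint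
  have hsm : ∀ c : ℝ, IsSelfAdjoint ((c : ℂ) • T) := fun c =>
    IsSelfAdjoint.smul (by rw [isSelfAdjoint_iff, RCLike.star_def, Complex.conj_ofReal]) hTs
  have hre : ∀ (c : ℝ) x, (inner ℂ x (((c : ℂ) • T) x)).re = c * (inner ℂ x (T x)).re := by
    intro c x
    rw [smul_apply, inner_smul_right, Complex.re_ofReal_mul]
  have hPs : IsSelfAdjoint P := hT'.sub (hsm _)
  have hPre : ∀ x, (inner ℂ x (P x)).re =
      (inner ℂ x (T' x)).re - (1 - δ) * (inner ℂ x (T x)).re := by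
    intro x
    rw [hP, _root_.sub_apply, inner_sub_right, Complex.sub_re, hre]
  have hTn : ∀ x, 0 ≤ (inner ℂ x (T x)).re := fun x => hT.re_inner_nonneg_right x
  have hPp : P.IsPositive := isPositive_of_re_inner_nonneg hPs fun x => by
    rw [hPre]; linarith [h2 x]
  have hQ : (((2 * δ : ℝ) : ℂ) • T).IsPositive :=
    isPositive_of_re_inner_nonneg (hsm _) fun x => by
      rw [hre]; exact mul_nonneg (by linarith) (hTn x)
  have h3 := tsum_enorm_sq_le_of_le b hPp hQ fun x => by
    rw [hPre, hre]; linarith [h1 x]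
  have h4 : ∀ i, ‖(T' - T) (b i)‖ₑ ^ 2 ≤
      2 * ‖P (b i)‖ₑ ^ 2 + ENNReal.ofReal (2 * δ ^ 2) * ‖T (b i)‖ₑ ^ 2 := by
    intro i
    have e : (T' - T) (b i) = P (b i) - (δ : ℂ) • T (b i) := by
      simp only [hP, _root_.sub_apply, smul_apply]
      push_cast
      module
    rw [e, enorm_sq_eq_ofReal, enorm_sq_eq_ofReal, enorm_sq_eq_ofReal,
      ← ENNReal.ofReal_mul (by positivity), show (2 : ℝ≥0∞) = ENNReal.ofReal 2 by simp,
      ← ENNReal.ofReal_mul (by norm_num), ← ENNReal.ofReal_add (by positivity) (by positivity)]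
    refine ENNReal.ofReal_le_ofReal ?_
    have h5 := norm_sub_le (P (b i)) ((δ : ℂ) • T (b i))
    rw [norm_smul, Complex.norm_real, Real.norm_of_nonneg hδ] at h5
    have h6 := pow_le_pow_left₀ (norm_nonneg _) h5 2
    nlinarith [sq_nonneg (‖P (b i)‖ - δ * ‖T (b i)‖)]
  refine (ENNReal.tsum_le_tsum h4).trans ?_
  rw [ENNReal.tsum_add, ENNReal.tsum_mul_left, ENNReal.tsum_mul_left]
  have h7 : ∀ i, ‖(((2 * δ : ℝ) : ℂ) • T) (b i)‖ₑ ^ 2 =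
      ENNReal.ofReal (4 * δ ^ 2) * ‖T (b i)‖ₑ ^ 2 := by
    intro i
    rw [enorm_sq_eq_ofReal, enorm_sq_eq_ofReal, ← ENNReal.ofReal_mul (by positivity), smul_apply,
      norm_smul, Complex.norm_real, Real.norm_of_nonneg (by linarith)]
    congr 1
    ring
  simp only [h7, ENNReal.tsum_mul_left] at h3
  refine (add_le_add_left (mul_le_mul_right h3 2) _).trans (le_of_eq ?_)
  rw [← mul_assoc, ← add_mul, show (2 : ℝ≥0∞) = ENNReal.ofReal 2 by simp,
    ← ENNReal.ofReal_mul (by norm_num), ← ENNReal.ofReal_add (by positivity) (by positivity)]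
  congr 2
  ring

end HilbertSchmidt

/-- A Hilbert basis of `L²` computing the Hilbert–Schmidt norm. -/
theorem exists_basis_hsNorm (d : ℕ) :
    ∃ (w : Set (OneParticle d)) (b : HilbertBasis w ℂ (OneParticle d)),
    ∀ T : OneParticle d →L[ℂ] OneParticle d,
      hsNorm T = (∑' i, ‖T (b i)‖ₑ ^ 2) ^ (1 / 2 : ℝ) := by
  have hb := (exists_hilbertBasis ℂ (OneParticle d)).choose_spec
  obtain ⟨b, hb⟩ := hb
  refine ⟨_, b, fun T => ?_⟩
  rw [hsNorm]
  simp only [hb]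

end

section

/-! ### Growth and positivity of submultiplicative potentials -/

variable {V : Space d → ℝ} {C : ℝ}

theorem MemLinftyLoc.aestronglyMeasurable {f : Space d → ℝ} (h : MemLinftyLoc f) :
    AEStronglyMeasurable f volume := by
  have h1 : AEStronglyMeasurable f
      ((volume : Measure (Space d)).restrict (⋃ n : ℕ, Metric.closedBall (0 : Space d) n)) := by
    rw [aestronglyMeasurable_iUnion_iff]
    intro n
    exact (h _ (isCompact_closedBall 0 (n : ℝ))).1
  rwa [Metric.iUnion_closedBall_nat, Measure.restrict_univ] at h1

theorem MemLinftyLoc.exists_bound {f : Space d → ℝ} (h : MemLinftyLoc f) (r : ℝ) :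
    ∃ M : ℝ, 0 ≤ M ∧ ∀ᵐ x, ‖x‖ ≤ r → |f x| ≤ M := by
  have h1 := h _ (isCompact_closedBall (0 : Space d) r)
  refine ⟨(eLpNorm f ∞ (volume.restrict (Metric.closedBall 0 r))).toReal, ENNReal.toReal_nonneg, ?_⟩
  have h2 := ae_le_eLpNormEssSup (f := f) (μ := volume.restrict (Metric.closedBall (0 : Space d) r))
  rw [ae_restrict_iff' Metric.isClosed_closedBall.measurableSet] at h2
  filter_upwards [h2] with x hx hxr
  have h3 := hx (by simpa using hxr)
  rw [← eLpNorm_exponent_top] at h3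
  rw [← Real.norm_eq_abs, ← toReal_enorm]
  exact ENNReal.toReal_mono h1.2.ne h3

/-- A locally bounded submultiplicative function is bounded on the unit ball, everywhere. -/
theorem exists_bound_of_submultiplicative (hV : MemLinftyLoc V) (h0 : ∀ x, 0 ≤ V x) (hC : 0 < C)
    (hmul : ∀ x y, V (x + y) ≤ C * V x * V y) : ∃ M : ℝ, 0 ≤ M ∧ ∀ x, ‖x‖ ≤ 1 → V x ≤ M := by
  obtain ⟨M, hM0, hM⟩ := hV.exists_bound 2
  refine ⟨C * M * M, by positivity, fun x hx => ?_⟩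
  have hM' : ∀ᵐ y, ‖x - y‖ ≤ 2 → |V (x - y)| ≤ M :=
    (Measure.measurePreserving_sub_left volume x).quasiMeasurePreserving.ae hM
  have hball : ∃ᵐ y : Space d, y ∈ Metric.ball (0 : Space d) 1 := by
    rw [frequently_ae_mem_iff]
    exact (Metric.measure_ball_pos volume 0 one_pos).ne'
  obtain ⟨y, hy, h1, h2⟩ := (hball.and_eventually (hM.and hM')).exists
  rw [mem_ball_zero_iff] at hy
  have h3 := h1 (by linarith)
  have h4 := h2 ((norm_sub_le x y).trans (by linarith))
  rw [abs_of_nonneg (h0 _)] at h3 h4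
  have h5 := hmul (x - y) y
  rw [sub_add_cancel] at h5
  refine h5.trans ?_
  have := h0 y
  have := h0 (x - y)
  gcongr

/-- Iterate submultiplicativity along a ray, in steps of length at most `1`. -/
theorem exists_exp_bound_of_submultiplicative (hV : MemLinftyLoc V) (h0 : ∀ x, 0 ≤ V x)
    (hC : 0 < C) (hmul : ∀ x y, V (x + y) ≤ C * V x * V y) :
    ∃ A a : ℝ, 0 ≤ A ∧ 0 ≤ a ∧ ∀ x, V x ≤ A * Real.exp (a * ‖x‖) := by
  obtain ⟨M, hM0, hM⟩ := exists_bound_of_submultiplicative hV h0 hC hmul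
  set L : ℝ := max 1 (C * M) with hL
  have hL1 : 1 ≤ L := le_max_left _ _
  have key : ∀ n : ℕ, ∀ x, ‖x‖ ≤ n + 1 → V x ≤ M * L ^ n := by
    intro n
    induction n with
    | zero => intro x hx; simpa using! hM x (by simpa using hx)
    | succ n ih =>
      intro x hx
      push_cast at hx
      have hn : (0 : ℝ) < n + 1 + 1 := by positivity
      have hx1 : x = ((n + 1) / (n + 1 + 1) : ℝ) • x + (1 / (n + 1 + 1) : ℝ) • x := by
        rw [← add_smul, ← add_div, div_self hn.ne', one_smul]
      have h1 := ih (((n + 1) / (n + 1 + 1) : ℝ) • x) (by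
        rw [norm_smul, Real.norm_of_nonneg (by positivity), div_mul_eq_mul_div, div_le_iff₀ hn]
        gcongr)
      have h2 := hM ((1 / (n + 1 + 1) : ℝ) • x) (by
        rw [norm_smul, Real.norm_of_nonneg (by positivity), div_mul_eq_mul_div, div_le_iff₀ hn]
        linarith)
      have h3 := hmul (((n + 1) / (n + 1 + 1) : ℝ) • x) ((1 / (n + 1 + 1) : ℝ) • x)
      rw [← hx1] at h3
      have h4 := h0 (((n + 1) / (n + 1 + 1) : ℝ) • x)
      have h5 := h0 ((1 / (n + 1 + 1) : ℝ) • x)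
      calc V x ≤ C * (M * L ^ n) * M := h3.trans (by gcongr)
        _ = M * (L ^ n * (C * M)) := by ring
        _ ≤ M * (L ^ n * L) := by
          gcongr
          exact le_max_right _ _
        _ = _ := by rw [pow_succ]
  refine ⟨M, Real.log L, hM0, Real.log_nonneg hL1, fun x => ?_⟩
  refine (key ⌊‖x‖⌋₊ x (Nat.lt_floor_add_one _).le).trans ?_
  refine mul_le_mul_of_nonneg_left ?_ hM0
  rw [← Real.rpow_natCast, Real.rpow_def_of_pos (by linarith)]
  refine Real.exp_le_exp.2 (mul_le_mul_of_nonneg_left (Nat.floor_le (norm_nonneg x))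
    (Real.log_nonneg hL1))

theorem norm_sq_formEmbed_le {U : Space d → ℝ} (z : FormDomain U) :
    ‖formEmbed U z‖ ^ 2 ≤ ‖z‖ * ‖ContinuousLinearMap.adjoint (formEmbed U) (formEmbed U z)‖ := by
  have h1 := norm_inner_le_norm (𝕜 := ℂ) z
    (ContinuousLinearMap.adjoint (formEmbed U) (formEmbed U z))
  rw [ContinuousLinearMap.adjoint_inner_right, inner_self_eq_norm_sq_to_K] at h1
  simpa using! h1

theorem norm_sq_adjoint_le {U : Space d → ℝ} (f : OneParticle d) :
    ‖ContinuousLinearMap.adjoint (formEmbed U) f‖ ^ 2 ≤ ‖f‖ * ‖schrodingerInv U f‖ := by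
  have h1 := norm_inner_le_norm (𝕜 := ℂ) f (schrodingerInv U f)
  rw [inner_schrodingerInv, inner_self_eq_norm_sq_to_K] at h1
  simpa using! h1

/-- If `V` is small at one point, it is small on a large sphere around it, by
submultiplicativity. -/
theorem exists_far_point (hV : MemLinftyLoc V) (h0 : ∀ x, 0 ≤ V x) (hC : 0 < C)
    (hmul : ∀ x y, V (x + y) ≤ C * V x * V y) (hd : 0 < d)
    (hinf : ∀ c : ℝ, 0 < c → ∃ x, V x < c) (s : Finset (Space d)) :
    ∃ x, V x < 1 ∧ ∀ y ∈ s, 2 ≤ ‖x - y‖ := by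
  obtain ⟨A, a, hA, ha, hexp⟩ := exists_exp_bound_of_submultiplicative hV h0 hC hmul
  obtain ⟨r, hr⟩ : ∃ r : ℝ, ∀ y ∈ s, ‖y‖ ≤ r := by
    obtain ⟨r, hr⟩ := (s.finite_toSet.image norm).bddAbove
    exact ⟨r, fun y hy => hr ⟨y, hy, rfl⟩⟩
  set N : ℝ := |r| + 2 with hN
  -- a point `x₀` with tiny `V x₀`, moved by a vector of length `N` away from the given points
  obtain ⟨x₀, hx₀⟩ := hinf (1 / (C * (A * Real.exp (a * N)) + 1)) (by positivity)
  obtain ⟨e, he⟩ : ∃ e : Space d, ‖e‖ = 1 := ⟨basisVec ⟨0, hd⟩, by simp⟩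
  have hVm : ∀ y : Space d, ‖y‖ = N → V (x₀ + y) < 1 := by
    intro y hy
    have h1 := hmul x₀ y
    have h2 := hexp y
    rw [hy] at h2
    have h3 : C * V x₀ * V y ≤ V x₀ * (C * (A * Real.exp (a * N))) := by
      have := h0 x₀
      calc C * V x₀ * V y = V x₀ * (C * V y) := by ring
        _ ≤ _ := by gcongr
    have hpos : 0 < C * (A * Real.exp (a * N)) + 1 := by positivity
    rw [lt_div_iff₀ hpos] at hx₀
    have := h0 x₀
    nlinarith
  -- one of the points `x₀ ± N e` has norm at least `N`
  have hfar : ∀ x : Space d, N ≤ ‖x‖ → ∀ y ∈ s, 2 ≤ ‖x - y‖ := by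
    intro x hx y hy
    have h1 := norm_sub_norm_le x y
    have h2 := hr y hy
    have h3 := le_abs_self r
    linarith
  have hN0 : 0 ≤ N := by positivity
  rcases le_total N ‖x₀ + N • e‖ with h1 | h1
  · exact ⟨_, hVm _ (by rw [norm_smul, he, Real.norm_of_nonneg hN0, mul_one]), hfar _ h1⟩
  · refine ⟨x₀ + -(N • e),
      hVm _ (by rw [norm_neg, norm_smul, he, Real.norm_of_nonneg hN0, mul_one]), hfar _ ?_⟩
    have h2 : (2 * N) • e = (x₀ + N • e) - (x₀ + -(N • e)) := by module
    have h3 := norm_sub_le (x₀ + N • e) (x₀ + -(N • e))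
    rw [← h2, norm_smul, he, Real.norm_of_nonneg (by linarith), mul_one] at h3
    linarith

/-- Translates of a fixed bump to points where `V < 1` have bounded energy, so that the resolvent
does not make them small. -/
theorem exists_le_norm_schrodingerInv_bump (hV : MemLinftyLoc V) (h0 : ∀ x, 0 ≤ V x) (hC : 0 < C)
    (hmul : ∀ x y, V (x + y) ≤ C * V x * V y) {κ₁ : ℝ} (hκ₁ : 0 < κ₁) {η : Space d → ℝ}
    (hη : IsTest η) (hsupp : ∀ y, η y ≠ 0 → ‖y‖ < 1) (hη0 : 0 < ‖rL2 η‖) :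
    ∃ c : ℝ, 0 < c ∧ ∀ x, V x < 1 →
      c ≤ ‖schrodingerInv (fun x => κ₁ + V x) (rL2 (fun z => η (z - x)))‖ := by
  obtain ⟨M, hM0, hM⟩ := exists_bound_of_submultiplicative hV h0 hC hmul
  have hU : IsCoercive κ₁ (fun x => κ₁ + V x) := ⟨hκ₁,
    aestronglyMeasurable_const.add hV.aestronglyMeasurable,
    Eventually.of_forall fun x => by linarith [h0 x]⟩
  generalize hUdef : (fun x => κ₁ + V x) = U at hU ⊢
  generalize hm : ‖rL2 η‖ = m at hη0
  have hEb0 : 0 < ∑ i, ‖rL2 (partialDeriv i η)‖ ^ 2 + (κ₁ + C * M) * m ^ 2 := by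
    have : 0 < (κ₁ + C * M) * m ^ 2 := by positivity
    have : 0 ≤ ∑ i, ‖rL2 (partialDeriv i η)‖ ^ 2 := Finset.sum_nonneg fun i _ => sq_nonneg _
    linarith
  generalize hEb : ∑ i, ‖rL2 (partialDeriv i η)‖ ^ 2 + (κ₁ + C * M) * m ^ 2 = Eb at hEb0
  refine ⟨m ^ 3 / Eb, by positivity, fun x hx => ?_⟩
  have hφt : IsTest (fun z => η (z - x)) := hη.comp_sub x
  have hφn : ‖rL2 (fun z => η (z - x))‖ = m := (norm_rL2_comp_sub hη x).trans hm
  have hgrad : ∀ i, ‖rL2 (partialDeriv i (fun z => η (z - x)))‖ = ‖rL2 (partialDeriv i η)‖ := by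
    intro i
    rw [← norm_rL2_comp_sub (hη.partialDeriv i) x]
    congr 2
    funext y
    simp only [sub_eq_add_neg]
    exact partialDeriv_comp_add η (-x) i y
  have hVle : ∀ z, η (z - x) ≠ 0 → U z ≤ κ₁ + C * M := by
    intro z hz
    have h1 := hmul x (z - x)
    rw [add_sub_cancel] at h1
    have h2 := hM (z - x) (hsupp _ hz).le
    have h3 : C * V x * V (z - x) ≤ C * 1 * M := by
      have := h0 (z - x)
      gcongr
    rw [← hUdef]
    linarith
  have hn := coeFn_rL2 (hφt.memLp 2)
  have hdom : ∀ᵐ z, ‖U z * ‖rL2 (fun z => η (z - x)) z‖ ^ 2‖ ≤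
      (κ₁ + C * M) * ‖rL2 (fun z => η (z - x)) z‖ ^ 2 := by
    filter_upwards [hn, hU.le] with z hz hUz
    rw [Real.norm_of_nonneg (mul_nonneg (hκ₁.le.trans hUz) (sq_nonneg _)), hz, Complex.norm_real]
    rcases eq_or_ne (η (z - x)) 0 with h | h
    · simp [h]
    · exact mul_le_mul_of_nonneg_right (hVle z h) (sq_nonneg _)
  generalize (fun z => η (z - x)) = φ at hφt hφn hgrad hdom ⊢
  have hfin : FinitePotentialEnergy U (rL2 φ) :=
    ((integrable_norm_sq (rL2 φ)).const_mul (κ₁ + C * M)).mono'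
      (hU.meas.mul ((Lp.memLp _).1.norm.pow 2)) hdom
  obtain ⟨z, hz1, hz2⟩ := exists_formDomain hU hφt.hasWeakGradient hfin
  have hz3 : ‖z‖ ^ 2 ≤ Eb := by
    rw [norm_sq_form_eq hU, hz1, ← hEb]
    refine add_le_add (le_of_eq (Finset.sum_congr rfl fun i _ => ?_)) ?_
    · rw [hz2, hgrad]
    · rw [← hφn, norm_sq_eq_integral, ← integral_const_mul]
      refine integral_mono_ae hfin ((integrable_norm_sq _).const_mul _) ?_
      filter_upwards [hdom] with y hy
      exact (le_abs_self _).trans hy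
  -- `m⁴ ≤ ‖z‖² q² ≤ Eb m p`, where `p` is the norm to be bounded below
  have h1 := norm_sq_formEmbed_le z
  have h2 := norm_sq_adjoint_le (U := U) (rL2 φ)
  rw [hz1, hφn] at h1
  rw [hφn] at h2
  generalize ‖ContinuousLinearMap.adjoint (formEmbed U) (rL2 φ)‖ = q at h1 h2
  generalize ‖schrodingerInv U (rL2 φ)‖ = p at h2 ⊢
  have h3 : (m ^ 2) ^ 2 ≤ (‖z‖ * q) ^ 2 := by gcongr
  rw [mul_pow] at h3
  have h4 : ‖z‖ ^ 2 * q ^ 2 ≤ Eb * (m * p) := by gcongr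
  rw [div_le_iff₀ hEb0]
  have h5 : m * m ^ 3 ≤ m * (p * Eb) := by linarith
  exact le_of_mul_le_mul_left h5 hη0

/-- A potential whose resolvent is Hilbert–Schmidt is bounded below by a positive constant:
otherwise there would be infinitely many disjoint bumps of the same bounded energy. -/
theorem exists_pos_le_of_hsNorm_lt_top (hV : MemLinftyLoc V) (h0 : ∀ x, 0 ≤ V x) (hC : 0 < C)
    (hmul : ∀ x y, V (x + y) ≤ C * V x * V y) (hd : 0 < d) {κ₁ : ℝ} (hκ₁ : 0 < κ₁)
    (hHS : hsNorm (schrodingerInv (fun x => κ₁ + V x)) < ∞) : ∃ c : ℝ, 0 < c ∧ ∀ x, c ≤ V x := by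
  by_contra! hinf
  have : Std.Symm (fun x y : Space d => 2 ≤ ‖x - y‖) := ⟨fun x y h => by rwa [norm_sub_rev]⟩
  obtain ⟨x, hx1, hx2⟩ := exists_seq_of_forall_finset_exists' (fun x : Space d => V x < 1)
    (fun x y => 2 ≤ ‖x - y‖) (by
      intro s _
      obtain ⟨x, hx1, hx2⟩ := exists_far_point hV h0 hC hmul hd hinf s
      exact ⟨x, hx1, fun y hy => by rw [norm_sub_rev]; exact hx2 y hy⟩)
  have hη : IsTest (approxDelta (0 : Space d) 0) := isTest_approxDelta 0 0
  have hsupp : ∀ y, approxDelta (0 : Space d) 0 y ≠ 0 → ‖y‖ < 1 := by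
    intro y hy
    have := norm_sub_lt_of_approxDelta_ne_zero hy
    simpa using this
  have hm0 : 0 < ‖rL2 (approxDelta (0 : Space d) 0)‖ := by
    refine (norm_nonneg _).lt_of_ne' fun h => ?_
    have h1 := norm_eq_zero.1 h
    have h2 : approxDelta (0 : Space d) 0 =ᵐ[volume] fun _ => 0 := by
      filter_upwards [coeFn_rL2 (hη.memLp 2), Lp.coeFn_zero ℂ 2 (volume : Measure (Space d))]
        with y h3 h4
      rw [h1, h4] at h3
      exact Complex.ofReal_eq_zero.1 h3.symm
    have h3 := integral_approxDelta (0 : Space d) 0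
    rw [integral_congr_ae h2, integral_zero] at h3
    exact zero_ne_one h3
  generalize approxDelta (0 : Space d) 0 = η at hη hsupp hm0
  obtain ⟨c, hc, hlow⟩ := exists_le_norm_schrodingerInv_bump hV h0 hC hmul hκ₁ hη hsupp hm0
  have hφt : ∀ j, IsTest (fun z => η (z - x j)) := fun j => hη.comp_sub (x j)
  have hφn : ∀ j, ‖rL2 (fun z => η (z - x j))‖ = ‖rL2 η‖ := fun j => norm_rL2_comp_sub hη (x j)
  generalize ‖rL2 η‖ = m at hm0 hφn
  -- the bumps have disjoint supports, as their centres have distance at least `2`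
  have horth : Orthonormal ℂ (fun j => ((m⁻¹ : ℝ) : ℂ) • rL2 (fun z => η (z - x j))) := by
    constructor
    · intro j
      rw [norm_smul, Complex.norm_real, hφn, Real.norm_of_nonneg (by positivity),
        inv_mul_cancel₀ hm0.ne']
    · intro i j hij
      rw [inner_smul_left, inner_smul_right]
      have h1 : inner ℂ (rL2 (fun z => η (z - x i))) (rL2 (fun z => η (z - x j))) = 0 := by
        rw [inner_rL2 ((hφt i).memLp 2)]
        refine (integral_congr_ae ?_).trans (integral_zero _ _)
        filter_upwards [coeFn_rL2 ((hφt j).memLp 2)] with z hz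
        rw [hz]
        by_cases h1 : η (z - x i) = 0
        · rw [h1, zero_smul]
        by_cases h2 : η (z - x j) = 0
        · rw [h2, Complex.ofReal_zero, smul_zero]
        exfalso
        have h3 := hsupp _ h1
        have h4 := hsupp _ h2
        have h5 : (2 : ℝ) ≤ ‖x i - x j‖ := hx2 hij
        have h6 := norm_sub_le (z - x j) (z - x i)
        rw [sub_sub_sub_cancel_left] at h6
        linarith
      rw [h1, mul_zero, mul_zero]
  obtain ⟨w, b, hb⟩ := exists_basis_hsNorm d
  have hle := tsum_enorm_orthonormal_sq_le b (T := schrodingerInv (fun x => κ₁ + V x)) horth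
  have htop : ∑' j : ℕ, ‖schrodingerInv (fun x => κ₁ + V x)
      (((m⁻¹ : ℝ) : ℂ) • rL2 (fun z => η (z - x j)))‖ₑ ^ 2 = ∞ := by
    have hc0 : ENNReal.ofReal ((m⁻¹ * c) ^ 2) ≠ 0 := by
      rw [Ne, ENNReal.ofReal_eq_zero, not_le]
      positivity
    refine top_le_iff.1 ?_
    rw [← ENNReal.tsum_const_eq_top_of_ne_zero (α := ℕ) hc0]
    refine ENNReal.tsum_le_tsum fun j => ?_
    rw [enorm_sq_eq_ofReal, map_smul, norm_smul, Complex.norm_real,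
      Real.norm_of_nonneg (by positivity)]
    refine ENNReal.ofReal_le_ofReal ?_
    have := hlow (x j) (hx1 j)
    gcongr
  rw [htop, top_le_iff] at hle
  rw [hb, hle, ENNReal.top_rpow_of_pos (by norm_num)] at hHS
  exact lt_irrefl _ hHS

end

section

/-! ### Riemann sums of monotone functions -/

section Riemann

variable {p q f : ℝ → ℝ} {c h : ℝ}

theorem intervalIntegrable_of_integrableOn_Ioi (hi : IntegrableOn f (Ioi c)) {x y : ℝ}
    (hx : c ≤ x) (hxy : x ≤ y) : IntervalIntegrable f volume x y :=
  (intervalIntegrable_iff_integrableOn_Ioc_of_le hxy).2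
    (hi.mono_set fun _ ht => lt_of_le_of_lt hx ht.1)

theorem mul_le_integral_of_antitoneOn (hf : AntitoneOn f (Ioi c)) (hi : IntegrableOn f (Ioi c))
    (hh : 0 < h) {x : ℝ} (hx : c ≤ x) : h * f (x + h) ≤ ∫ t in x..x + h, f t := by
  have h1 : ∫ t in x..x + h, f (x + h) = h * f (x + h) := by simp
  rw [← h1]
  refine intervalIntegral.integral_mono_on_of_le_Ioo (by linarith) (by simp)
    (intervalIntegrable_of_integrableOn_Ioi hi hx (by linarith)) fun t ht => ?_
  exact hf (lt_of_le_of_lt hx ht.1) (show c < x + h by linarith) ht.2.le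

theorem integral_le_mul_of_antitoneOn (hf : AntitoneOn f (Ici c)) (hi : IntegrableOn f (Ioi c))
    (hh : 0 < h) {x : ℝ} (hx : c ≤ x) : ∫ t in x..x + h, f t ≤ h * f x := by
  have h1 : ∫ t in x..x + h, f x = h * f x := by simp
  rw [← h1]
  refine intervalIntegral.integral_mono_on_of_le_Ioo (by linarith)
    (intervalIntegrable_of_integrableOn_Ioi hi hx (by linarith)) (by simp) fun t ht => ?_
  exact hf hx (hx.trans ht.1.le) ht.1.le

theorem sum_range_integral_eq (hi : IntegrableOn f (Ioi c)) (hh : 0 < h) (N : ℕ) :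
    ∑ n ∈ Finset.range N, ∫ t in (c + n * h)..(c + n * h + h), f t = ∫ t in c..c + N * h, f t := by
  have h1 := intervalIntegral.sum_integral_adjacent_intervals (f := f) (μ := volume)
    (a := fun n : ℕ => c + n * h) (n := N) (fun k _ => by
      refine intervalIntegrable_of_integrableOn_Ioi hi ?_ ?_
      · have : 0 ≤ (k : ℝ) * h := by positivity
        linarith
      · push_cast
        nlinarith)
  simp only [Nat.cast_zero, zero_mul, add_zero] at h1
  rw [← h1]
  refine Finset.sum_congr rfl fun n _ => ?_
  congr 1
  push_cast
  ring

theorem sum_range_le_integral (hf : AntitoneOn f (Ioi c)) (hi : IntegrableOn f (Ioi c))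
    (hh : 0 < h) (N : ℕ) :
    ∑ n ∈ Finset.range N, h * f (c + (n + 1) * h) ≤ ∫ t in c..c + N * h, f t := by
  rw [← sum_range_integral_eq hi hh N]
  refine Finset.sum_le_sum fun n _ => ?_
  rw [show c + n * h + h = c + (n + 1) * h by ring]
  have h1 := mul_le_integral_of_antitoneOn hf hi hh (x := c + n * h) (by
    have : 0 ≤ (n : ℝ) * h := by positivity
    linarith)
  rwa [show c + n * h + h = c + (n + 1) * h by ring] at h1

theorem integral_le_setIntegral_Ioi (hi : IntegrableOn f (Ioi c)) (h0 : ∀ t, c < t → 0 ≤ f t)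
    {x : ℝ} (hx : c ≤ x) : ∫ t in c..x, f t ≤ ∫ t in Ioi c, f t := by
  rw [intervalIntegral.integral_of_le hx]
  exact setIntegral_mono_set hi ((ae_restrict_iff' measurableSet_Ioi).2
    (Eventually.of_forall fun t ht => h0 t ht)) Ioc_subset_Ioi_self.eventuallyLE

theorem summable_riemann (hf : AntitoneOn f (Ioi c)) (hi : IntegrableOn f (Ioi c))
    (h0 : ∀ t, c < t → 0 ≤ f t) (hh : 0 < h) :
    Summable (fun n : ℕ => h * f (c + (n + 1) * h)) ∧
      ∑' n : ℕ, h * f (c + (n + 1) * h) ≤ ∫ t in Ioi c, f t := by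
  have hnn : ∀ n : ℕ, 0 ≤ h * f (c + (n + 1) * h) := fun n => by
    refine mul_nonneg hh.le (h0 _ ?_)
    have : 0 < ((n : ℝ) + 1) * h := by positivity
    linarith
  have hle : ∀ N, ∑ n ∈ Finset.range N, h * f (c + (n + 1) * h) ≤ ∫ t in Ioi c, f t := fun N =>
    (sum_range_le_integral hf hi hh N).trans (integral_le_setIntegral_Ioi hi h0 (by
      have : 0 ≤ (N : ℝ) * h := by positivity
      linarith))
  exact ⟨summable_of_sum_range_le hnn hle, Real.tsum_le_of_sum_range_le hnn hle⟩

theorem integral_Ioi_le_tsum (hf : AntitoneOn f (Ici c)) (hi : IntegrableOn f (Ioi c))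
    (h0 : ∀ t, c ≤ t → 0 ≤ f t) (hh : 0 < h) :
    ∫ t in Ioi c, f t ≤ h * f c + ∑' n : ℕ, h * f (c + (n + 1) * h) := by
  have hs := (summable_riemann (hf.mono Ioi_subset_Ici_self) hi (fun t ht => h0 t ht.le) hh).1
  have hs' : Summable (fun n : ℕ => h * f (c + n * h)) := by
    rw [← summable_nat_add_iff 1]
    refine hs.congr fun n => ?_
    push_cast
    rfl
  have e : ∑' n : ℕ, h * f (c + n * h) = h * f c + ∑' n : ℕ, h * f (c + (n + 1) * h) := by
    rw [hs'.tsum_eq_zero_add]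
    simp
  rw [← e]
  have hlim := intervalIntegral_tendsto_integral_Ioi c hi
    (tendsto_atTop_add_const_left atTop c (tendsto_natCast_atTop_atTop.atTop_mul_const hh))
  refine le_of_tendsto hlim (Eventually.of_forall fun N => ?_)
  rw [← sum_range_integral_eq hi hh N]
  refine (Finset.sum_le_sum fun n _ => ?_).trans (hs'.sum_le_tsum (Finset.range N) fun n _ => ?_)
  · refine integral_le_mul_of_antitoneOn hf hi hh ?_
    have : 0 ≤ (n : ℝ) * h := by positivity
    linarith
  · refine mul_nonneg hh.le (h0 _ ?_)
    have : 0 ≤ (n : ℝ) * h := by positivity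
    linarith

/-- Comparison of a Riemann sum of a difference of two decreasing functions with its integral: near
the origin a common bound for the difference is used, elsewhere monotonicity. -/
theorem abs_tsum_sub_integral_le (hp : AntitoneOn p (Ioi 0)) (hq : AntitoneOn q (Ioi 0))
    (hp0 : ∀ t, 0 < t → 0 ≤ p t) (hq0 : ∀ t, 0 < t → 0 ≤ q t)
    (hpi : ∀ c, 0 < c → IntegrableOn p (Ioi c)) (hqi : ∀ c, 0 < c → IntegrableOn q (Ioi c))
    (hf : AntitoneOn f (Ioi 0)) (hfi : IntegrableOn f (Ioi 0))
    (hpq : ∀ t, 0 < t → |p t - q t| ≤ f t) (hh : 0 < h) {N : ℕ} (hN : 0 < N) :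
    |(∑' n : ℕ, h * (p ((n + 1) * h) - q ((n + 1) * h))) - ∫ t in Ioi 0, (p t - q t)| ≤
      2 * (∫ t in (0 : ℝ)..N * h, f t) + h * p (N * h) + h * q (N * h) := by
  have hc : 0 < N * h := by positivity
  have hf0 : ∀ t, 0 < t → 0 ≤ f t := fun t ht => (abs_nonneg _).trans (hpq t ht)
  have hIci : Ici ((N : ℝ) * h) ⊆ Ioi 0 := fun t ht => hc.trans_le ht
  have hIoi : Ioi ((N : ℝ) * h) ⊆ Ioi 0 := fun t ht => hc.trans ht
  have tail : ∀ {g : ℝ → ℝ}, AntitoneOn g (Ioi 0) → (∀ t, 0 < t → 0 ≤ g t) →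
      (∀ c, 0 < c → IntegrableOn g (Ioi c)) →
      Summable (fun n : ℕ => h * g (N * h + (n + 1) * h)) ∧
      ∑' n : ℕ, h * g (N * h + (n + 1) * h) ≤ ∫ t in Ioi (N * h), g t ∧
      ∫ t in Ioi (N * h), g t ≤ h * g (N * h) + ∑' n : ℕ, h * g (N * h + (n + 1) * h) := by
    intro g hg hg0 hgi
    obtain ⟨h1, h2⟩ := summable_riemann (hg.mono hIoi) (hgi _ hc) (fun t ht => hg0 t (hIoi ht)) hh
    exact ⟨h1, h2, integral_Ioi_le_tsum (hg.mono hIci) (hgi _ hc) (fun t ht => hg0 t (hIci ht)) hh⟩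
  obtain ⟨p1, p2, p3⟩ := tail hp hp0 hpi
  obtain ⟨q1, q2, q3⟩ := tail hq hq0 hqi
  have hmeas : AEStronglyMeasurable (fun t => p t - q t) (volume.restrict (Ioi 0)) :=
    ((aemeasurable_restrict_of_antitoneOn measurableSet_Ioi hp).sub
      (aemeasurable_restrict_of_antitoneOn measurableSet_Ioi hq)).aestronglyMeasurable
  have hri : IntegrableOn (fun t => p t - q t) (Ioi 0) := by
    refine Integrable.mono' hfi hmeas ((ae_restrict_iff' measurableSet_Ioi).2
      (Eventually.of_forall fun t ht => hpq t ht))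
  have hsum : Summable (fun n : ℕ => h * (p ((n + 1) * h) - q ((n + 1) * h))) := by
    have h1 := (summable_riemann (c := 0) hf hfi hf0 hh).1
    refine Summable.of_norm_bounded h1 fun n => ?_
    rw [zero_add, norm_mul, Real.norm_of_nonneg hh.le]
    exact mul_le_mul_of_nonneg_left (hpq _ (by positivity)) hh.le
  -- the terms up to `N` and beyond `N` are compared separately with the integral
  have hsplit := hsum.sum_add_tsum_nat_add N
  have e1 : ∑' n : ℕ, h * (p (((n + N : ℕ) + 1) * h) - q (((n + N : ℕ) + 1) * h)) =
      ∑' n : ℕ, h * p (N * h + (n + 1) * h) - ∑' n : ℕ, h * q (N * h + (n + 1) * h) := by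
    rw [← p1.tsum_sub q1]
    refine tsum_congr fun n => ?_
    rw [show (((n + N : ℕ) : ℝ) + 1) * h = N * h + (n + 1) * h by push_cast; ring]
    ring
  rw [e1] at hsplit
  have e2 : ∫ t in Ioi 0, (p t - q t) = (∫ t in (0 : ℝ)..N * h, (p t - q t)) +
      ((∫ t in Ioi (N * h), p t) - ∫ t in Ioi (N * h), q t) := by
    rw [← integral_sub (hpi _ hc) (hqi _ hc)]
    exact (intervalIntegral.integral_interval_add_Ioi hri (hri.mono_set hIoi)).symm
  have b1 : |∑ n ∈ Finset.range N, h * (p ((n + 1) * h) - q ((n + 1) * h))| ≤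
      ∫ t in (0 : ℝ)..N * h, f t := by
    refine (Finset.abs_sum_le_sum_abs _ _).trans ?_
    have h1 := sum_range_le_integral hf hfi hh N
    simp only [zero_add] at h1
    refine (Finset.sum_le_sum fun n _ => ?_).trans h1
    rw [abs_mul, abs_of_pos hh]
    exact mul_le_mul_of_nonneg_left (hpq _ (by positivity)) hh.le
  have b2 : |∫ t in (0 : ℝ)..N * h, (p t - q t)| ≤ ∫ t in (0 : ℝ)..N * h, f t := by
    rw [← Real.norm_eq_abs]
    refine intervalIntegral.norm_integral_le_of_norm_le hc.le (Eventually.of_forall fun t ht =>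
      hpq t ht.1) (intervalIntegrable_of_integrableOn_Ioi hfi le_rfl hc.le)
  rw [← hsplit, e2]
  rw [abs_le] at b1 b2 ⊢
  have := mul_nonneg hh.le (hp0 _ hc)
  have := mul_nonneg hh.le (hq0 _ hc)
  constructor <;> linarith [b1.1, b1.2, b2.1, b2.2]

end Riemann

end

section

/-! ### Dependence of the density on the potential and on the temperature -/

/-- A submultiplicative weight bounded below by a positive constant and growing at most
exponentially. -/
structure IsWeight (C A a c : ℝ) (V : Space d → ℝ) : Prop where
  meas : AEStronglyMeasurable V volume
  mul_pos : 0 < C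
  rate_nonneg : 0 ≤ a
  low_pos : 0 < c
  low_le : ∀ x, c ≤ V x
  le_exp : ∀ x, V x ≤ A * Real.exp (a * ‖x‖)
  mul_le : ∀ x y, V (x + y) ≤ C * V x * V y

/-- The potentials `u` with `|u - V| ≤ r V` almost everywhere. -/
structure InBall (V : Space d → ℝ) (r : ℝ) (u : Space d → ℝ) : Prop where
  meas : AEStronglyMeasurable u volume
  le : ∀ᵐ x, |u x - V x| ≤ r * V x

variable {C A a c r κ : ℝ} {V u u' : Space d → ℝ}

theorem IsWeight.pos (hV : IsWeight C A a c V) (x : Space d) : 0 < V x :=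
  hV.low_pos.trans_le (hV.low_le x)

theorem IsWeight.coeff_pos (hV : IsWeight C A a c V) : 0 < A := by
  have h1 := (hV.pos 0).trans_le (hV.le_exp 0)
  simpa using h1

theorem InBall.bounds (hV : IsWeight C A a c V) (hr1 : r < 1) (hu : InBall V r u) :
    ∀ᵐ x, 0 ≤ u x ∧ u x ≤ 2 * V x := by
  filter_upwards [hu.le] with x hx
  rw [abs_le] at hx
  have := hV.pos x
  constructor <;> nlinarith

theorem InBall.isCoercive (hV : IsWeight C A a c V) (hr1 : r < 1) (hu : InBall V r u)
    (hκ : 0 < κ) : IsCoercive κ (fun x => κ + u x) := by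
  refine ⟨hκ, aestronglyMeasurable_const.add hu.meas, ?_⟩
  filter_upwards [hu.bounds hV hr1] with x hx
  linarith [hx.1]

theorem InBall.hasExpGrowth (hV : IsWeight C A a c V) (hr1 : r < 1) (hu : InBall V r u)
    (hκ : 0 < κ) : HasExpGrowth (κ + 2 * A) a (fun x => κ + u x) := by
  refine ⟨hV.rate_nonneg, aestronglyMeasurable_const.add hu.meas, ?_⟩
  filter_upwards [hu.bounds hV hr1] with x hx
  have h1 := hV.le_exp x
  have h2 : 1 ≤ Real.exp (a * ‖x‖) :=
    Real.one_le_exp (mul_nonneg hV.rate_nonneg (norm_nonneg x))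
  rw [abs_of_nonneg (by linarith [hx.1])]
  nlinarith [hx.2]

/-- The function `t^(1 - d/2) e^{-β t}` governing differences of heat kernels. -/
def decayFn (d : ℕ) (β t : ℝ) : ℝ := Real.exp (-(β * t)) * t ^ (-(d / 2 : ℝ)) * t

/-- The integral of `decayFn d β` over the half line. -/
def decayIntegral (d : ℕ) (β : ℝ) : ℝ := (1 / β) ^ (2 - d / 2 : ℝ) * Real.Gamma (2 - d / 2)

theorem decayFn_eq {β t : ℝ} (ht : 0 < t) :
    decayFn d β t = t ^ ((2 - d / 2 : ℝ) - 1) * Real.exp (-(β * t)) := by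
  rw [decayFn, mul_assoc, mul_comm, ← Real.rpow_add_one ht.ne']
  congr 2
  ring

theorem decayFn_nonneg {β t : ℝ} (ht : 0 < t) : 0 ≤ decayFn d β t := by
  rw [decayFn]
  positivity

theorem antitoneOn_decayFn (hd : 2 ≤ d) {β : ℝ} (hβ : 0 ≤ β) :
    AntitoneOn (decayFn d β) (Ioi 0) := by
  intro s hs t ht hst
  have hs : 0 < s := hs
  have ht : 0 < t := ht
  rw [decayFn_eq hs, decayFn_eq ht]
  have hd' : (2 : ℝ) ≤ d := by exact_mod_cast hd
  have h1 : t ^ ((2 - d / 2 : ℝ) - 1) ≤ s ^ ((2 - d / 2 : ℝ) - 1) :=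
    Real.rpow_le_rpow_of_nonpos hs hst (by linarith)
  gcongr

theorem integral_decayFn (hd : d ≤ 3) {β : ℝ} (hβ : 0 < β) :
    ∫ t in Ioi 0, decayFn d β t = decayIntegral d β := by
  have hd' : (d : ℝ) ≤ 3 := by exact_mod_cast hd
  rw [decayIntegral, ← Real.integral_rpow_mul_exp_neg_mul_Ioi (by linarith) hβ]
  exact setIntegral_congr_fun measurableSet_Ioi fun t ht => decayFn_eq ht

theorem integrableOn_decayFn (hd : d ≤ 3) {β : ℝ} (hβ : 0 < β) :
    IntegrableOn (decayFn d β) (Ioi 0) := by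
  have hd' : (d : ℝ) ≤ 3 := by exact_mod_cast hd
  by_contra h
  have h1 := integral_undef h
  rw [integral_decayFn hd hβ, decayIntegral] at h1
  have h2 : 0 < Real.Gamma (2 - d / 2) := Real.Gamma_pos_of_pos (by linarith)
  have h3 : 0 < (1 / β) ^ (2 - d / 2 : ℝ) := by positivity
  exact (mul_pos h3 h2).ne' h1

theorem decayIntegral_nonneg (hd : d ≤ 3) {β : ℝ} (hβ : 0 < β) : 0 ≤ decayIntegral d β := by
  rw [← integral_decayFn hd hβ]
  exact setIntegral_nonneg measurableSet_Ioi fun t ht => decayFn_nonneg ht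

theorem tendsto_decayIntegral (hd : d ≤ 3) : Tendsto (decayIntegral d) atTop (𝓝 0) := by
  have hd' : (d : ℝ) ≤ 3 := by exact_mod_cast hd
  have h1 : Tendsto (fun β : ℝ => (1 / β) ^ (2 - d / 2 : ℝ)) atTop (𝓝 0) := by
    have h2 : Tendsto (fun β : ℝ => 1 / β) atTop (𝓝 0) := by
      simpa only [one_div] using tendsto_inv_atTop_zero
    have h3 := h2.rpow_const (p := (2 - d / 2 : ℝ)) (Or.inr (by linarith))
    rwa [Real.zero_rpow (by linarith)] at h3
  have h4 := h1.mul_const (Real.Gamma (2 - d / 2))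
  rwa [zero_mul] at h4

theorem abs_heatDiag_sub_le_weight (hd : d ≤ 3) (hV : IsWeight C A a c V) {U U' : Space d → ℝ}
    {A₁ b₁ A₂ b₂ : ℝ} (hU : IsCoercive κ U) (hU' : IsCoercive κ U') (hg : HasExpGrowth A₁ b₁ U)
    (hg' : HasExpGrowth A₂ b₂ U') {D : ℝ} (hD : 0 ≤ D) (hUU' : ∀ᵐ z, |U' z - U z| ≤ D * V z)
    (x : Space d) {t : ℝ} (ht : 0 < t) : |heatDiag U t x - heatDiag U' t x| ≤
      D * (C * A * Real.exp a) * V x * decayFn d (κ - 2 * a ^ 2) t := by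
  have hA := hV.coeff_pos
  have hC := hV.mul_pos
  have hx := hV.pos x
  have h1 : ∀ᵐ z, |U' z - U z| ≤ (D * (C * A) * V x) * Real.exp (a * ‖z - x‖) := by
    filter_upwards [hUU'] with z hz
    refine hz.trans ?_
    have h2 := hV.mul_le x (z - x)
    rw [add_sub_cancel] at h2
    have h3 := hV.le_exp (z - x)
    calc D * V z ≤ D * (C * V x * (A * Real.exp (a * ‖z - x‖))) := by
          refine mul_le_mul_of_nonneg_left (h2.trans ?_) hD
          gcongr
      _ = _ := by ring
  refine (abs_heatDiag_sub_le hd hU hU' hg hg' (by positivity) hV.rate_nonneg h1 ht).trans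
    (le_of_eq ?_)
  rw [decayFn]
  ring

theorem heatDiag_le_rpow (hd : d ≤ 3) {U : Space d → ℝ} {A₁ b₁ : ℝ} (hU : IsCoercive κ U)
    (hg : HasExpGrowth A₁ b₁ U) {t : ℝ} (ht : 0 < t) (x : Space d) :
    heatDiag U t x ≤ Real.exp (-(κ * t)) * t ^ (-(d / 2 : ℝ)) := by
  refine (heatDiag_le hd hU hg ht x).trans ?_
  refine mul_le_mul_of_nonneg_left ?_ (Real.exp_pos _).le
  refine Real.rpow_le_rpow_of_nonpos ht ?_ ?_
  · have := Real.pi_gt_three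
    nlinarith
  · have : (0 : ℝ) ≤ d / 2 := by positivity
    linarith

theorem abs_density_sub_le (hd2 : 2 ≤ d) (hd : d ≤ 3) (hV : IsWeight C A a c V)
    {U U' : Space d → ℝ}
    {A₁ b₁ A₂ b₂ : ℝ} (hU : IsCoercive κ U) (hU' : IsCoercive κ U') (hg : HasExpGrowth A₁ b₁ U)
    (hg' : HasExpGrowth A₂ b₂ U') {D : ℝ} (hD : 0 ≤ D) (hUU' : ∀ᵐ z, |U' z - U z| ≤ D * V z)
    (hκ : 2 * a ^ 2 < κ) {τ : ℝ} (hτ : 0 < τ) (x : Space d) :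
    |density τ U x - density τ U' x| ≤
      D * (C * A * Real.exp a) * V x * decayIntegral d (κ - 2 * a ^ 2) := by
  have hA := hV.coeff_pos
  have hC := hV.mul_pos
  have hx := hV.pos x
  have hβ : 0 < κ - 2 * a ^ 2 := by linarith
  have h1 := hasSum_density hd hU hg hτ x
  have h2 := hasSum_density hd hU' hg' hτ x
  have hτ' : 0 < τ⁻¹ := inv_pos.2 hτ
  obtain ⟨h3, h4⟩ := summable_riemann (c := 0) (antitoneOn_decayFn hd2 hβ.le)
    (integrableOn_decayFn hd hβ) (fun t ht => decayFn_nonneg ht) hτ'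
  rw [integral_decayFn hd hβ] at h4
  simp only [zero_add] at h3 h4
  rw [← (h1.sub h2).tsum_eq, ← Real.norm_eq_abs]
  have h5 := (h3.mul_left (D * (C * A * Real.exp a) * V x)).hasSum
  rw [tsum_mul_left] at h5
  refine (tsum_of_norm_bounded h5 fun n => ?_).trans (mul_le_mul_of_nonneg_left h4 (by positivity))
  have h6 := abs_heatDiag_sub_le_weight hd hV hU hU' hg hg' hD hUU' x
    (t := (n + 1) * τ⁻¹) (by positivity)
  rw [← mul_sub, norm_mul, Real.norm_of_nonneg hτ'.le, Real.norm_eq_abs]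
  calc _ ≤ τ⁻¹ * (D * (C * A * Real.exp a) * V x *
        decayFn d (κ - 2 * a ^ 2) ((n + 1) * τ⁻¹)) := by gcongr
    _ = _ := by ring

theorem integrableOn_heatDiag (hd : d ≤ 3) {U : Space d → ℝ} {A₁ b₁ : ℝ} (hU : IsCoercive κ U)
    (hg : HasExpGrowth A₁ b₁ U) (x : Space d) {s : ℝ} (hs : 0 < s) :
    IntegrableOn (fun t => heatDiag U t x) (Ioi s) := by
  have h1 : IntegrableOn (fun t => Real.exp (-κ * t)) (Ioi s) := exp_neg_integrableOn_Ioi s hU.pos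
  refine Integrable.mono' (h1.mul_const (s ^ (-(d / 2 : ℝ)))) (aemeasurable_restrict_of_antitoneOn
    measurableSet_Ioi ((heatDiag_antitoneOn hd hU hg x).mono fun t ht =>
      hs.trans ht)).aestronglyMeasurable ((ae_restrict_iff' measurableSet_Ioi).2
      (Eventually.of_forall fun t ht => ?_))
  have ht : s < t := ht
  rw [Real.norm_of_nonneg (heatDiag_nonneg t x)]
  refine (heatDiag_le_rpow hd hU hg (hs.trans ht) x).trans ?_
  rw [neg_mul]
  refine mul_le_mul_of_nonneg_left ?_ (Real.exp_pos _).le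
  refine Real.rpow_le_rpow_of_nonpos hs ht.le ?_
  have : (0 : ℝ) ≤ d / 2 := by positivity
  linarith

/-- As `τ → ∞` the difference of densities converges, uniformly in the potential and relative to
the weight. -/
theorem exists_abs_density_sub_integral_le (hd2 : 2 ≤ d) (hd : d ≤ 3) (hV : IsWeight C A a c V)
    (hr1 : r < 1) (hκ : 2 * a ^ 2 < κ) {η : ℝ} (hη : 0 < η) :
    ∃ τ₀ : ℝ, 0 < τ₀ ∧ ∀ τ, τ₀ ≤ τ → ∀ u, InBall V r u → ∀ x,
      |density τ (fun x => κ + u x) x - density τ (fun _ => κ) x -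
        ∫ t in Ioi 0, (heatDiag (fun x => κ + u x) t x - heatDiag (fun _ => κ) t x)| ≤
          η * V x := by
  have hA := hV.coeff_pos
  have hC := hV.mul_pos
  have hc := hV.low_pos
  have hκ0 : 0 < κ := by nlinarith [sq_nonneg a]
  set β := κ - 2 * a ^ 2 with hβd
  have hβ : 0 < β := by linarith
  set L : ℝ := 2 * (C * A * Real.exp a) with hL
  have hL0 : 0 < L := by positivity
  have hfi := integrableOn_decayFn hd hβ
  -- the cut-off `ε` between the two regimes of the Riemann sum
  obtain ⟨ε, hε, hε2⟩ : ∃ ε : ℝ, 0 < ε ∧ 2 * (L * ∫ t in (0 : ℝ)..ε, decayFn d β t) ≤ η / 2 := by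
    have h1 := intervalIntegral.continuousOn_primitive_interval' (a := 0)
      (intervalIntegrable_of_integrableOn_Ioi hfi le_rfl zero_le_one) (by simp)
    have h2 := (h1 0 (by simp)).const_mul L |>.const_mul 2
    simp only [ContinuousWithinAt, intervalIntegral.integral_same, mul_zero] at h2
    have h3 := h2.eventually (gt_mem_nhds (half_pos hη))
    rw [uIcc_of_le zero_le_one] at h3
    have h4 : ∀ᶠ s in 𝓝[>] (0 : ℝ), 2 * (L * ∫ t in (0 : ℝ)..s, decayFn d β t) < η / 2 := by
      have h5 : 𝓝[>] (0 : ℝ) ≤ 𝓝[Icc 0 1] 0 := by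
        rw [← nhdsWithin_Ioo_eq_nhdsGT (zero_lt_one' ℝ)]
        exact nhdsWithin_mono _ Ioo_subset_Icc_self
      exact h5 h3
    obtain ⟨s, hs1, hs2⟩ := (h4.and self_mem_nhdsWithin).exists
    exact ⟨s, hs2, hs1.le⟩
  set G : ℝ := (ε / 2) ^ (-(d / 2 : ℝ)) with hG
  have hG0 : 0 < G := by positivity
  refine ⟨max (2 / ε) (4 * G / (η * c)), by positivity, fun τ hτ u hu x => ?_⟩
  have hτ1 := (le_max_left _ _).trans hτ
  have hτ2 := (le_max_right _ _).trans hτ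
  have hτ0 : 0 < τ := lt_of_lt_of_le (by positivity) hτ1
  have hx := hV.pos x
  have hU := hu.isCoercive hV hr1 hκ0
  have hg := hu.hasExpGrowth hV hr1 hκ0
  have hU' := isCoercive_const (d := d) hκ0
  have hg' := hasExpGrowth_const (d := d) hκ0
  have hτ' : 0 < τ⁻¹ := inv_pos.2 hτ0
  rw [div_le_iff₀ hε] at hτ1
  set N := ⌊ε * τ⌋₊ with hN
  have hN1 : (N : ℝ) * τ⁻¹ ≤ ε := by
    rw [← div_eq_mul_inv, div_le_iff₀ hτ0]
    exact Nat.floor_le (by positivity)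
  have hN2 : ε / 2 ≤ N * τ⁻¹ := by
    rw [← div_eq_mul_inv, le_div_iff₀ hτ0]
    have := (Nat.lt_floor_add_one (ε * τ)).le
    rw [← hN] at this
    nlinarith
  have hN0 : 0 < N := by
    have h1 : 0 < (N : ℝ) * τ⁻¹ := lt_of_lt_of_le (by positivity) hN2
    have h2 : (0 : ℝ) < N := by
      by_contra! h
      nlinarith
    exact_mod_cast h2
  have hpq : ∀ t, 0 < t → |heatDiag (fun x => κ + u x) t x - heatDiag (fun _ => κ) t x| ≤
      (L * V x) * decayFn d β t := by
    intro t ht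
    refine abs_heatDiag_sub_le_weight hd hV hU hU' hg hg' (by norm_num : (0 : ℝ) ≤ 2) ?_ x ht
    filter_upwards [hu.bounds hV hr1] with z hz
    rw [abs_le]
    constructor <;> linarith [hz.1, hz.2, hV.pos z]
  have key := abs_tsum_sub_integral_le (heatDiag_antitoneOn hd hU hg x)
    (heatDiag_antitoneOn hd hU' hg' x) (fun t _ => heatDiag_nonneg t x)
    (fun t _ => heatDiag_nonneg t x) (fun s hs => integrableOn_heatDiag hd hU hg x hs)
    (fun s hs => integrableOn_heatDiag hd hU' hg' x hs)
    (f := fun t => (L * V x) * decayFn d β t)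
    (fun s hs t ht hst => mul_le_mul_of_nonneg_left (antitoneOn_decayFn hd2 hβ.le hs ht hst)
      (by positivity)) (hfi.const_mul _) hpq hτ' hN0
  have e1 : density τ (fun x => κ + u x) x - density τ (fun _ => κ) x =
      ∑' n : ℕ, τ⁻¹ * (heatDiag (fun x => κ + u x) ((n + 1) * τ⁻¹) x -
        heatDiag (fun _ => κ) ((n + 1) * τ⁻¹) x) := by
    rw [← ((hasSum_density hd hU hg hτ0 x).sub (hasSum_density hd hU' hg' hτ0 x)).tsum_eq]
    refine tsum_congr fun n => ?_
    ring
  rw [← e1] at key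
  refine key.trans ?_
  have hNpos : 0 < (N : ℝ) * τ⁻¹ := by positivity
  have b1 : ∫ t in (0 : ℝ)..N * τ⁻¹, (L * V x) * decayFn d β t ≤
      V x * (L * ∫ t in (0 : ℝ)..ε, decayFn d β t) := by
    rw [intervalIntegral.integral_const_mul]
    have : ∫ t in (0 : ℝ)..N * τ⁻¹, decayFn d β t ≤ ∫ t in (0 : ℝ)..ε, decayFn d β t := by
      refine intervalIntegral.integral_mono_interval le_rfl hNpos.le hN1 ?_
        (intervalIntegrable_of_integrableOn_Ioi hfi le_rfl hε.le)
      exact (ae_restrict_iff' measurableSet_Ioc).2 (Eventually.of_forall fun t ht =>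
        decayFn_nonneg ht.1)
    calc _ ≤ (L * V x) * ∫ t in (0 : ℝ)..ε, decayFn d β t := by gcongr
      _ = _ := by ring
  have b2 : ∀ {U : Space d → ℝ} {A₁ b₁ : ℝ}, IsCoercive κ U → HasExpGrowth A₁ b₁ U →
      τ⁻¹ * heatDiag U (N * τ⁻¹) x ≤ (η / 4) * V x := by
    intro U A₁ b₁ hU hg
    have h1 : heatDiag U (N * τ⁻¹) x ≤ G := by
      refine (heatDiag_le_rpow hd hU hg hNpos x).trans ?_
      have h2 : Real.exp (-(κ * (N * τ⁻¹))) ≤ 1 := by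
        rw [Real.exp_le_one_iff]
        have : 0 ≤ κ * (N * τ⁻¹) := by positivity
        linarith
      have h3 : ((N : ℝ) * τ⁻¹) ^ (-(d / 2 : ℝ)) ≤ G := by
        refine Real.rpow_le_rpow_of_nonpos (by positivity) hN2 ?_
        have : (0 : ℝ) ≤ d / 2 := by positivity
        linarith
      calc _ ≤ 1 * G := by gcongr
        _ = G := one_mul G
    have h4 : τ⁻¹ * G ≤ η / 4 * c := by
      rw [div_le_iff₀ (by positivity)] at hτ2
      rw [inv_mul_le_iff₀ hτ0]
      linarith
    calc _ ≤ τ⁻¹ * G := by gcongr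
      _ ≤ η / 4 * c := h4
      _ ≤ _ := by
        have := hV.low_le x
        gcongr
  have b3 := b2 hU hg
  have b4 := b2 hU' hg'
  nlinarith

end

section

/-! ### The counterterm map -/

variable {C A a c r κ τ W : ℝ} {V w u u' : Space d → ℝ}

theorem continuous_density (hd : d ≤ 3) {U : Space d → ℝ} {A₁ b₁ : ℝ}
    (hg : HasExpGrowth A₁ b₁ U) (hτ : 0 < τ) : Continuous (density τ U) := by
  have hk := continuous_kerVec hd hg (half_pos (inv_pos.2 hτ))
  exact Complex.continuous_re.comp (hk.inner ((boseFactor τ (schrodingerInv U)).continuous.comp hk))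

/-- The convolution kernel `w` has weighted mass `W`. -/
structure HasMass (W : ℝ) (V w : Space d → ℝ) : Prop where
  meas : AEStronglyMeasurable w volume
  integrable : Integrable (fun z => |w z| * V (-z))
  eq : ∫ z, |w z| * V (-z) = W

theorem HasMass.nonneg (hw : HasMass W V w) (hV : IsWeight C A a c V) : 0 ≤ W := by
  rw [← hw.eq]
  exact integral_nonneg fun z => mul_nonneg (abs_nonneg _) (hV.pos _).le

/-- Convolution with `w` preserves the bound by a multiple of `V`, by submultiplicativity. -/
theorem integrable_conv (hV : IsWeight C A a c V) (hw : HasMass W V w) {P : Space d → ℝ}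
    (hP : AEStronglyMeasurable P volume) {B : ℝ} (hB : ∀ y, |P y| ≤ B * V y) (x : Space d) :
    Integrable (fun y => w (x - y) * P y) ∧
      |∫ y, w (x - y) * P y| ≤ B * (C * W) * V x := by
  have hx := hV.pos x
  have hB0 : 0 ≤ B := by
    have := (abs_nonneg _).trans (hB x)
    exact nonneg_of_mul_nonneg_left this hx
  have hi : Integrable (fun y => |w (x - y)| * V (-(x - y))) := hw.integrable.comp_sub_left x
  have hle : ∀ y, ‖w (x - y) * P y‖ ≤ (B * C * V x) * (|w (x - y)| * V (-(x - y))) := by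
    intro y
    rw [norm_mul, Real.norm_eq_abs, Real.norm_eq_abs]
    have h1 := hV.mul_le x (-(x - y))
    rw [show x + -(x - y) = y by abel] at h1
    calc _ ≤ |w (x - y)| * (B * (C * V x * V (-(x - y)))) := by
          refine mul_le_mul_of_nonneg_left ((hB y).trans ?_) (abs_nonneg _)
          gcongr
      _ = _ := by ring
  have hm : AEStronglyMeasurable (fun y => w (x - y)) volume :=
    hw.meas.comp_quasiMeasurePreserving
      (Measure.measurePreserving_sub_left volume x).quasiMeasurePreserving
  refine ⟨(hi.const_mul _).mono' (hm.mul hP) (Eventually.of_forall hle), ?_⟩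
  rw [← Real.norm_eq_abs]
  refine (norm_integral_le_of_norm_le (hi.const_mul _) (Eventually.of_forall hle)).trans ?_
  rw [integral_const_mul, integral_sub_left_eq_self (fun z => |w z| * V (-z)) volume x, hw.eq]
  exact le_of_eq (by ring)

/-- The excess density `ϱ_τ^{κ+u} - ϱ_τ^κ`. -/
def excess (τ κ : ℝ) (u : Space d → ℝ) (y : Space d) : ℝ :=
  density τ (fun x => κ + u x) y - density τ (fun _ => κ) y

/-- The map `u ↦ V + w * (ϱ_τ^{κ+u} - ϱ_τ^κ)` whose fixed points solve the counterterm problem. -/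
def counterMap (V w : Space d → ℝ) (τ κ : ℝ) (u : Space d → ℝ) (x : Space d) : ℝ :=
  V x + ∫ y, w (x - y) * excess τ κ u y

theorem kappa_pos (hκ : 2 * a ^ 2 < κ) : 0 < κ := by nlinarith [sq_nonneg a]

theorem continuous_excess (hd : d ≤ 3) (hV : IsWeight C A a c V) (hr1 : r < 1) (hκ : 0 < κ)
    (hu : InBall V r u) (hτ : 0 < τ) : Continuous (excess τ κ u) :=
  (continuous_density hd (hu.hasExpGrowth hV hr1 hκ) hτ).sub
    (continuous_density hd (hasExpGrowth_const hκ) hτ)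

theorem abs_excess_le (hd2 : 2 ≤ d) (hd : d ≤ 3) (hV : IsWeight C A a c V) (hr1 : r < 1)
    (hκ : 2 * a ^ 2 < κ) (hu : InBall V r u) (hτ : 0 < τ) (y : Space d) :
    |excess τ κ u y| ≤ 2 * (C * A * Real.exp a * decayIntegral d (κ - 2 * a ^ 2)) * V y := by
  have hκ0 := kappa_pos hκ
  refine (abs_density_sub_le hd2 hd hV (hu.isCoercive hV hr1 hκ0) (isCoercive_const hκ0)
    (hu.hasExpGrowth hV hr1 hκ0) (hasExpGrowth_const hκ0) zero_le_two ?_ hκ hτ y).trans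
    (le_of_eq (by ring))
  filter_upwards [hu.bounds hV hr1] with z hz
  rw [abs_le]
  constructor <;> linarith [hz.1, hz.2, hV.pos z]

theorem abs_excess_sub_le (hd2 : 2 ≤ d) (hd : d ≤ 3) (hV : IsWeight C A a c V) (hr1 : r < 1)
    (hκ : 2 * a ^ 2 < κ) (hu : InBall V r u) (hu' : InBall V r u') {D : ℝ} (hD : 0 ≤ D)
    (huu' : ∀ᵐ x, |u x - u' x| ≤ D * V x) (hτ : 0 < τ) (y : Space d) :
    |excess τ κ u y - excess τ κ u' y| ≤
      (C * A * Real.exp a * decayIntegral d (κ - 2 * a ^ 2)) * D * V y := by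
  have hκ0 := kappa_pos hκ
  rw [excess, excess, sub_sub_sub_cancel_right]
  refine (abs_density_sub_le hd2 hd hV (hu.isCoercive hV hr1 hκ0) (hu'.isCoercive hV hr1 hκ0)
    (hu.hasExpGrowth hV hr1 hκ0) (hu'.hasExpGrowth hV hr1 hκ0) hD ?_ hκ hτ y).trans
    (le_of_eq (by ring))
  filter_upwards [huu'] with z hz
  rwa [add_sub_add_left_eq_sub, abs_sub_comm]

theorem aestronglyMeasurable_counterMap (hV : AEStronglyMeasurable V volume)
    (hw : AEStronglyMeasurable w volume) (he : AEStronglyMeasurable (excess τ κ u) volume) :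
    AEStronglyMeasurable (counterMap V w τ κ u) volume := by
  refine hV.add ?_
  have h1 : AEStronglyMeasurable (fun p : Space d × Space d => w (p.1 - p.2) * excess τ κ u p.2)
      (volume.prod volume) :=
    (hw.comp_quasiMeasurePreserving
      (quasiMeasurePreserving_sub_of_right_invariant volume volume)).mul he.comp_snd
  exact h1.integral_prod_right'

/-- The Lipschitz constant of the counterterm map. -/
def contractionConst (d : ℕ) (C A a W κ : ℝ) : ℝ :=
  (C * A * Real.exp a * decayIntegral d (κ - 2 * a ^ 2)) * (C * W)

theorem contractionConst_nonneg (hd : d ≤ 3) (hV : IsWeight C A a c V) (hw : HasMass W V w)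
    (hκ : 2 * a ^ 2 < κ) : 0 ≤ contractionConst d C A a W κ := by
  have h1 := hV.mul_pos
  have h2 := hV.coeff_pos
  have h3 := hw.nonneg hV
  have h4 := decayIntegral_nonneg hd (β := κ - 2 * a ^ 2) (by linarith)
  rw [contractionConst]
  positivity

theorem tendsto_contractionConst (hd : d ≤ 3) (C A a W : ℝ) :
    Tendsto (contractionConst d C A a W) atTop (𝓝 0) := by
  have h1 := (tendsto_decayIntegral hd).comp
    (tendsto_atTop_add_const_right atTop (-(2 * a ^ 2)) tendsto_id)
  have h2 := (h1.const_mul (C * A * Real.exp a)).mul_const (C * W)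
  rw [mul_zero, zero_mul] at h2
  exact h2

theorem inBall_counterMap (hd2 : 2 ≤ d) (hd : d ≤ 3) (hV : IsWeight C A a c V)
    (hw : HasMass W V w) (hr1 : r < 1) (hκ : 2 * a ^ 2 < κ)
    (hq : 2 * contractionConst d C A a W κ ≤ r) (hu : InBall V r u) (hτ : 0 < τ) :
    InBall V r (counterMap V w τ κ u) ∧ ∀ x, |counterMap V w τ κ u x - V x| ≤ r * V x := by
  have he := (continuous_excess hd hV hr1 (kappa_pos hκ) hu hτ).aestronglyMeasurable (μ := volume)
  have h1 : ∀ x, |counterMap V w τ κ u x - V x| ≤ r * V x := by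
    intro x
    have h2 := (integrable_conv hV hw he (abs_excess_le hd2 hd hV hr1 hκ hu hτ) x).2
    rw [counterMap, add_sub_cancel_left]
    refine h2.trans (mul_le_mul_of_nonneg_right (le_trans (le_of_eq ?_) hq) (hV.pos x).le)
    rw [contractionConst]
    ring
  exact ⟨⟨aestronglyMeasurable_counterMap hV.meas hw.meas he, Eventually.of_forall h1⟩, h1⟩

theorem abs_counterMap_sub_le_of_excess (hV : IsWeight C A a c V) (hw : HasMass W V w) {τ' : ℝ}
    (h1 : AEStronglyMeasurable (excess τ κ u) volume)
    (h2 : AEStronglyMeasurable (excess τ' κ u') volume) {B B₁ B₂ : ℝ}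
    (hB1 : ∀ y, |excess τ κ u y| ≤ B₁ * V y) (hB2 : ∀ y, |excess τ' κ u' y| ≤ B₂ * V y)
    (hB : ∀ y, |excess τ κ u y - excess τ' κ u' y| ≤ B * V y) (x : Space d) :
    |counterMap V w τ κ u x - counterMap V w τ' κ u' x| ≤ B * (C * W) * V x := by
  have i1 := (integrable_conv hV hw h1 hB1 x).1
  have i2 := (integrable_conv hV hw h2 hB2 x).1
  rw [counterMap, counterMap, add_sub_add_left_eq_sub, ← integral_sub i1 i2]
  simp only [← mul_sub]
  exact (integrable_conv hV hw (h1.sub h2) hB x).2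

theorem abs_counterMap_sub_le (hd2 : 2 ≤ d) (hd : d ≤ 3) (hV : IsWeight C A a c V)
    (hw : HasMass W V w) (hr1 : r < 1) (hκ : 2 * a ^ 2 < κ) (hu : InBall V r u)
    (hu' : InBall V r u') {D : ℝ} (hD : 0 ≤ D) (huu' : ∀ᵐ x, |u x - u' x| ≤ D * V x)
    (hτ : 0 < τ) (x : Space d) : |counterMap V w τ κ u x - counterMap V w τ κ u' x| ≤
      contractionConst d C A a W κ * D * V x := by
  refine (abs_counterMap_sub_le_of_excess hV hw
    (continuous_excess hd hV hr1 (kappa_pos hκ) hu hτ).aestronglyMeasurable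
    (continuous_excess hd hV hr1 (kappa_pos hκ) hu' hτ).aestronglyMeasurable
    (abs_excess_le hd2 hd hV hr1 hκ hu hτ) (abs_excess_le hd2 hd hV hr1 hκ hu' hτ)
    (abs_excess_sub_le hd2 hd hV hr1 hκ hu hu' hD huu' hτ) x).trans (le_of_eq ?_)
  rw [contractionConst]
  ring

/-! ### Solution of the counterterm problem -/

theorem inBall_self (hV : IsWeight C A a c V) (hr : 0 ≤ r) : InBall V r V :=
  ⟨hV.meas, Eventually.of_forall fun x => by
    rw [sub_self, abs_zero]
    exact mul_nonneg hr (hV.pos x).le⟩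

theorem exists_fixedPoint (hd2 : 2 ≤ d) (hd : d ≤ 3) (hV : IsWeight C A a c V)
    (hw : HasMass W V w) (hr : 0 ≤ r) (hr1 : r < 1) (hκ : 2 * a ^ 2 < κ)
    (hq : 2 * contractionConst d C A a W κ ≤ r) (hτ : 0 < τ) :
    ∃ u, InBall V r u ∧ ∀ x, u x = counterMap V w τ κ u x := by
  set q := contractionConst d C A a W κ with hqd
  have hq0 : 0 ≤ q := contractionConst_nonneg hd hV hw hκ
  have hq1 : q < 1 := by linarith
  set Φ := counterMap V w τ κ with hΦ
  -- Picard iteration starting from `V`; successive differences are bounded at every point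
  set s : ℕ → Space d → ℝ := fun n => Φ^[n] V with hs
  have hs1 : ∀ n, s (n + 1) = Φ (s n) := fun n => Function.iterate_succ_apply' Φ n V
  have hball : ∀ n, InBall V r (s n) := by
    intro n
    induction n with
    | zero => exact inBall_self hV hr
    | succ n ih =>
      rw [hs1]
      exact (inBall_counterMap hd2 hd hV hw hr1 hκ hq ih hτ).1
  have hstep : ∀ n x, |s n x - s (n + 1) x| ≤ (r * V x) * q ^ n := by
    intro n
    induction n with
    | zero =>
      intro x
      rw [pow_zero, mul_one, abs_sub_comm]
      exact (inBall_counterMap hd2 hd hV hw hr1 hκ hq (inBall_self hV hr) hτ).2 x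
    | succ n ih =>
      intro x
      rw [hs1 (n + 1), hs1 n]
      have h1 := abs_counterMap_sub_le hd2 hd hV hw hr1 hκ (hball n) (hball (n + 1))
        (D := r * q ^ n) (by positivity) (Eventually.of_forall fun y =>
          (ih y).trans (le_of_eq (by ring))) hτ x
      rw [hs1 n] at h1
      refine h1.trans (le_of_eq ?_)
      rw [pow_succ]
      ring
  have hcauchy : ∀ x, CauchySeq (fun n => s n x) := fun x =>
    cauchySeq_of_le_geometric q (r * V x) hq1 fun n => hstep n x
  choose u hu using fun x => cauchySeq_tendsto_of_complete (hcauchy x)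
  have hdist : ∀ n x, |s n x - u x| ≤ r * q ^ n / (1 - q) * V x := by
    intro n x
    have := dist_le_of_le_geometric_of_tendsto q (r * V x) hq1 (fun n => hstep n x) (hu x) n
    rw [Real.dist_eq] at this
    refine this.trans (le_of_eq ?_)
    ring
  have huball : InBall V r u := by
    refine ⟨aestronglyMeasurable_of_tendsto_ae atTop (fun n => (hball n).meas)
      (Eventually.of_forall hu), ?_⟩
    have hall : ∀ᵐ x, ∀ n, |s n x - V x| ≤ r * V x := ae_all_iff.2 fun n => (hball n).le
    filter_upwards [hall] with x hx
    exact le_of_tendsto ((hu x).sub_const (V x)).abs (Eventually.of_forall hx)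
  refine ⟨u, huball, fun x => ?_⟩
  have hlim : Tendsto (fun n => s (n + 1) x) atTop (𝓝 (Φ u x)) := by
    rw [tendsto_iff_dist_tendsto_zero]
    have h1 : Tendsto (fun n : ℕ => q * (r * q ^ n / (1 - q)) * V x) atTop (𝓝 0) := by
      have h2 := tendsto_pow_atTop_nhds_zero_of_lt_one hq0 hq1
      have h3 := (((h2.const_mul r).div_const (1 - q)).const_mul q).mul_const (V x)
      simpa using h3
    refine squeeze_zero (fun n => dist_nonneg) (fun n => ?_) h1
    rw [hs1, Real.dist_eq]
    have h1q : 0 < 1 - q := by linarith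
    exact abs_counterMap_sub_le hd2 hd hV hw hr1 hκ (hball n) huball (by positivity)
      (Eventually.of_forall fun y => hdist n y) hτ x
  exact tendsto_nhds_unique ((hu x).comp (tendsto_add_atTop_nat 1)) hlim

/-- An approximate contraction estimate forces closeness. The a priori bound `|u - u'| ≤ 2 V` starts
an iteration, since no finite best constant need be available in advance. -/
theorem abs_sub_le_of_forall_contraction (hV : IsWeight C A a c V) (hr1 : r < 1)
    (hu : InBall V r u) (hu' : InBall V r u') {q η : ℝ} (hq0 : 0 ≤ q) (hq : q ≤ 1 / 2)
    (hη : 0 ≤ η)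
    (hstep : ∀ D, 0 ≤ D → (∀ᵐ x, |u x - u' x| ≤ D * V x) →
      ∀ᵐ x, |u x - u' x| ≤ (q * D + η) * V x) :
    ∀ᵐ x, |u x - u' x| ≤ 2 * η * V x := by
  have h0 : ∀ n : ℕ, ∀ᵐ x, |u x - u' x| ≤ (2 * q ^ n + 2 * η) * V x := by
    intro n
    induction n with
    | zero =>
      filter_upwards [hu.bounds hV hr1, hu'.bounds hV hr1] with x h1 h2
      have := hV.pos x
      rw [abs_le]
      constructor <;> nlinarith [h1.1, h1.2, h2.1, h2.2, mul_nonneg hη this.le]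
    | succ n ih =>
      filter_upwards [hstep _ (by positivity) ih] with x hx
      refine hx.trans (mul_le_mul_of_nonneg_right ?_ (hV.pos x).le)
      rw [pow_succ]
      nlinarith
  filter_upwards [ae_all_iff.2 h0] with x hx
  have h2 := ((tendsto_pow_atTop_nhds_zero_of_lt_one hq0 (by linarith : q < 1)).const_mul 2
    |>.add_const (2 * η)).mul_const (V x)
  rw [mul_zero, zero_add] at h2
  exact ge_of_tendsto h2 (Eventually.of_forall hx)

theorem fixedPoint_unique (hd2 : 2 ≤ d) (hd : d ≤ 3) (hV : IsWeight C A a c V)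
    (hw : HasMass W V w) (hr1 : r < 1) (hκ : 2 * a ^ 2 < κ)
    (hq : 2 * contractionConst d C A a W κ ≤ r) (hτ : 0 < τ) (hu : InBall V r u)
    (hu' : InBall V r u') (h1 : u =ᵐ[volume] counterMap V w τ κ u)
    (h2 : u' =ᵐ[volume] counterMap V w τ κ u') : u =ᵐ[volume] u' := by
  have hq0 := contractionConst_nonneg hd hV hw hκ
  have h3 := abs_sub_le_of_forall_contraction hV hr1 hu hu' hq0 (by linarith) le_rfl
    fun D hD hae => by
      filter_upwards [h1, h2] with x x1 x2
      rw [x1, x2, add_zero]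
      exact abs_counterMap_sub_le hd2 hd hV hw hr1 hκ hu hu' hD hae hτ x
  filter_upwards [h3] with x hx
  rw [mul_zero, zero_mul] at hx
  exact sub_eq_zero.1 (abs_nonpos_iff.1 hx)

/-- Solutions at large temperatures are close to each other. -/
theorem exists_abs_fixedPoint_sub_le (hd2 : 2 ≤ d) (hd : d ≤ 3) (hV : IsWeight C A a c V)
    (hw : HasMass W V w) (hr1 : r < 1) (hκ : 2 * a ^ 2 < κ)
    (hq : 2 * contractionConst d C A a W κ ≤ r) {η : ℝ} (hη : 0 < η) :
    ∃ τ₀ : ℝ, 0 < τ₀ ∧ ∀ τ τ', τ₀ ≤ τ → τ₀ ≤ τ' → ∀ u u', InBall V r u → InBall V r u' →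
      u =ᵐ[volume] counterMap V w τ κ u → u' =ᵐ[volume] counterMap V w τ' κ u' →
        ∀ᵐ x, |u x - u' x| ≤ η * V x := by
  have hC := hV.mul_pos
  have hW := hw.nonneg hV
  have hκ0 := kappa_pos hκ
  set η' : ℝ := η / (4 * (C * W + 1)) with hη'
  have hη'0 : 0 < η' := by positivity
  obtain ⟨τ₀, hτ₀, hτ₀2⟩ := exists_abs_density_sub_integral_le hd2 hd hV hr1 hκ hη'0
  refine ⟨τ₀, hτ₀, fun τ τ' hτ hτ' u u' hu hu' h1 h2 => ?_⟩
  have hτp := hτ₀.trans_le hτ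
  have hτp' := hτ₀.trans_le hτ'
  have hq0 := contractionConst_nonneg hd hV hw hκ
  -- both excess densities are close to the same integral over time
  have hdiff : ∀ y, |excess τ κ u' y - excess τ' κ u' y| ≤ (2 * η') * V y := by
    intro y
    have e1 := hτ₀2 τ hτ u' hu' y
    have e2 := hτ₀2 τ' hτ' u' hu' y
    rw [excess, excess]
    rw [abs_le] at *
    constructor <;> linarith [e1.1, e1.2, e2.1, e2.2]
  have hmap : ∀ x, |counterMap V w τ κ u' x - counterMap V w τ' κ u' x| ≤ (η / 2) * V x := by
    intro x
    refine (abs_counterMap_sub_le_of_excess hV hw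
      (continuous_excess hd hV hr1 hκ0 hu' hτp).aestronglyMeasurable
      (continuous_excess hd hV hr1 hκ0 hu' hτp').aestronglyMeasurable
      (abs_excess_le hd2 hd hV hr1 hκ hu' hτp) (abs_excess_le hd2 hd hV hr1 hκ hu' hτp')
      hdiff x).trans (mul_le_mul_of_nonneg_right ?_ (hV.pos x).le)
    have h5 : η' * (4 * (C * W + 1)) = η := div_mul_cancel₀ _ (by positivity)
    nlinarith
  have h3 := abs_sub_le_of_forall_contraction hV hr1 hu hu' hq0 (by linarith) (half_pos hη).le
    fun D hD hae => by
      filter_upwards [h1, h2] with x x1 x2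
      rw [x1, x2, add_mul]
      have e1 := abs_counterMap_sub_le hd2 hd hV hw hr1 hκ hu hu' hD hae hτp x
      have e2 := hmap x
      refine (abs_sub_le _ (counterMap V w τ κ u' x) _).trans (add_le_add e1 e2)
  filter_upwards [h3] with x hx
  linarith

end

section

/-! ### The weighted norm and the counterterm problem -/

variable {C A a c r κ τ W : ℝ} {V w u v : Space d → ℝ}

theorem weightedNorm_le_iff (hV : ∀ x, 0 < V x) {f : Space d → ℝ} {η : ℝ} (hη : 0 ≤ η) :
    weightedNorm V f ≤ ENNReal.ofReal η ↔ ∀ᵐ x, |f x| ≤ η * V x := by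
  have h0 : ∀ x, ‖f x / V x‖ ≤ η ↔ |f x| ≤ η * V x := fun x => by
    rw [norm_div, Real.norm_eq_abs, Real.norm_of_nonneg (hV x).le, div_le_iff₀ (hV x)]
  rw [weightedNorm, eLpNorm_exponent_top]
  constructor
  · intro h
    filter_upwards [ae_le_eLpNormEssSup (f := fun x => f x / V x)] with x hx
    have h1 := hx.trans h
    rw [← ofReal_norm, ENNReal.ofReal_le_ofReal_iff hη] at h1
    exact (h0 x).1 h1
  · intro h
    refine eLpNormEssSup_le_of_ae_bound ?_
    filter_upwards [h] with x hx
    exact (h0 x).2 hx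

theorem memBall_iff (hV : IsWeight C A a c V) (hV_loc : MemLinftyLoc V) (hr : 0 ≤ r)
    (hr1 : r < 1) : MemBall V r u ↔ InBall V r u := by
  constructor
  · intro h
    exact ⟨h.1.aestronglyMeasurable, (weightedNorm_le_iff hV.pos hr).1 h.2⟩
  · intro h
    refine ⟨fun K hK => ?_, (weightedNorm_le_iff hV.pos hr).2 h.le⟩
    refine MemLp.of_le_mul (c := 2) (hV_loc K hK) h.meas.restrict (ae_restrict_of_ae ?_)
    filter_upwards [h.bounds hV hr1] with x hx
    rw [Real.norm_of_nonneg hx.1, Real.norm_of_nonneg (hV.pos x).le]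
    exact hx.2

/-- Since the densities are unique, the counterterm problem is a fixed point problem. -/
theorem solvesCounterterm_iff (hd2 : 2 ≤ d) (hd : d ≤ 3) (hV : IsWeight C A a c V)
    (hV_loc : MemLinftyLoc V) (hw : HasMass W V w) (hr : 0 ≤ r) (hr1 : r < 1)
    (hκ : 2 * a ^ 2 < κ) (hτ : 0 < τ) :
    SolvesCounterterm V w κ r τ u ↔ InBall V r u ∧ u =ᵐ[volume] counterMap V w τ κ u := by
  have hκ0 := kappa_pos hκ
  rw [SolvesCounterterm, memBall_iff hV hV_loc hr hr1]
  refine and_congr_right fun hu => ?_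
  have hU := hu.isCoercive hV hr1 hκ0
  have hg := hu.hasExpGrowth hV hr1 hκ0
  constructor
  · rintro ⟨ϱ, ϱbar, h1, h2, h3⟩
    rw [isQuantumDensity_iff hd hU hg hτ] at h1
    rw [isQuantumDensity_iff hd (isCoercive_const hκ0) (hasExpGrowth_const hκ0) hτ] at h2
    filter_upwards [h3] with x hx
    rw [hx.2, counterMap]
    congr 1
    refine integral_congr_ae (Eventually.of_forall fun y => ?_)
    change w (x - y) * (ϱ y - ϱbar) = w (x - y) * excess τ κ u y
    rw [excess, ← h1, ← congrFun h2 y]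
  · intro h
    have h2 : (fun _ : Space d => density τ (fun _ : Space d => κ) 0) =
        density τ (fun _ : Space d => κ) := funext fun y => density_const hd hκ0 hτ 0 y
    refine ⟨density τ (fun x => κ + u x), density τ (fun _ : Space d => κ) 0,
      (isQuantumDensity_iff hd hU hg hτ).2 rfl,
      (isQuantumDensity_iff hd (isCoercive_const hκ0) (hasExpGrowth_const hκ0) hτ).2 h2, ?_⟩
    have he : ∀ y, density τ (fun x => κ + u x) y - density τ (fun _ : Space d => κ) 0 =
        excess τ κ u y := fun y => by rw [excess, ← congrFun h2 y]
    simp only [he]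
    filter_upwards [h] with x hx
    exact ⟨(integrable_conv hV hw
      (continuous_excess hd hV hr1 hκ0 hu hτ).aestronglyMeasurable
      (abs_excess_le hd2 hd hV hr1 hκ hu hτ) x).1, hx⟩

theorem hasMass_of_even (hw : AEStronglyMeasurable w volume) (hV : ∀ x, 0 ≤ V x)
    (hVm : AEStronglyMeasurable V volume) (hw_even : ∀ᵐ x, w (-x) = w x)
    (hw_int : Integrable (fun y => |w y| * (1 + V y ^ 2))) :
    HasMass (∫ z, |w z| * V (-z)) V w := by
  refine ⟨hw, ?_, rfl⟩
  have h1 : Integrable (fun y => |w y| * V y) := by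
    refine hw_int.mono' (hw.norm.mul hVm) (Eventually.of_forall fun y => ?_)
    rw [Real.norm_of_nonneg (mul_nonneg (abs_nonneg _) (hV y))]
    refine mul_le_mul_of_nonneg_left ?_ (abs_nonneg _)
    nlinarith [sq_nonneg (V y - 1), hV y]
  refine h1.comp_neg.congr ?_
  filter_upwards [hw_even] with z hz
  rw [hz]

/-! ### The limit of infinite temperature -/

/-- A family in the ball that is Cauchy for the weighted norm converges. -/
theorem exists_inBall_limit {f : ℝ → Space d → ℝ} (hf : ∀ τ, 0 < τ → InBall V r (f τ))
    (hV : ∀ x, 0 < V x)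
    (hc : ∀ η : ℝ, 0 < η → ∃ τ₀ : ℝ, 0 < τ₀ ∧ ∀ τ τ', τ₀ ≤ τ → τ₀ ≤ τ' →
      ∀ᵐ x, |f τ x - f τ' x| ≤ η * V x) :
    ∃ v, InBall V r v ∧ ∀ η : ℝ, 0 < η → ∃ τ₀ : ℝ, 0 < τ₀ ∧ ∀ τ, τ₀ ≤ τ →
      ∀ᵐ x, |f τ x - v x| ≤ η * V x := by
  -- the limit is taken along integers, so that countably many null sets are involved
  set s : ℕ → Space d → ℝ := fun n => f (n + 1) with hs
  have hball : ∀ n, InBall V r (s n) := fun n => hf _ (by positivity)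
  have hlim : ∀ᵐ x, ∃ l, Tendsto (fun n => s n x) atTop (𝓝 l) := by
    have h1 : ∀ k : ℕ, ∀ᵐ x, ∃ N, ∀ m ≥ N, ∀ n ≥ N,
        |s m x - s n x| ≤ 1 / ((k : ℝ) + 1) * V x := by
      intro k
      obtain ⟨τ₀, -, h⟩ := hc (1 / ((k : ℝ) + 1)) (by positivity)
      obtain ⟨N, hN⟩ := exists_nat_ge τ₀
      have h2 : ∀ n : ℕ, n ≥ N → τ₀ ≤ (n : ℝ) + 1 := fun n hn => by
        have : (N : ℝ) ≤ n := by exact_mod_cast hn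
        linarith
      have h3 : ∀ᵐ x, ∀ m n : ℕ, m ≥ N → n ≥ N →
          |s m x - s n x| ≤ 1 / ((k : ℝ) + 1) * V x := by
        simp only [ae_all_iff]
        exact fun m n hm hn => h _ _ (h2 m hm) (h2 n hn)
      filter_upwards [h3] with x hx
      exact ⟨N, fun m hm n hn => hx m n hm hn⟩
    filter_upwards [ae_all_iff.2 h1] with x hx
    refine cauchySeq_tendsto_of_complete (Metric.cauchySeq_iff.2 fun ε hε => ?_)
    obtain ⟨k, hk⟩ := exists_nat_one_div_lt (div_pos hε (hV x))
    obtain ⟨N, hN⟩ := hx k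
    refine ⟨N, fun m hm n hn => ?_⟩
    rw [Real.dist_eq]
    refine (hN m hm n hn).trans_lt ?_
    rwa [lt_div_iff₀ (hV x)] at hk
  obtain ⟨v, hvm, hv⟩ := measurable_limit_of_tendsto_metrizable_ae
    (fun n => (hball n).meas.aemeasurable) hlim
  refine ⟨v, ⟨hvm.aestronglyMeasurable, ?_⟩, fun η hη => ?_⟩
  · filter_upwards [hv, ae_all_iff.2 fun n => (hball n).le] with x hx h
    exact le_of_tendsto (hx.sub_const (V x)).abs (Eventually.of_forall h)
  · obtain ⟨τ₀, hτ₀, h⟩ := hc η hη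
    refine ⟨τ₀, hτ₀, fun τ hτ => ?_⟩
    obtain ⟨N, hN⟩ := exists_nat_ge τ₀
    have h2 : ∀ᵐ x, ∀ n : ℕ, n ≥ N → |f τ x - s n x| ≤ η * V x := by
      simp only [ae_all_iff]
      intro n hn
      refine h _ _ hτ ?_
      have : (N : ℝ) ≤ n := by exact_mod_cast hn
      linarith
    filter_upwards [hv, h2] with x hx hx2
    exact le_of_tendsto (hx.const_sub (f τ x)).abs ((eventually_ge_atTop N).mono hx2)

theorem tendsto_weightedNorm (hV : ∀ x, 0 < V x) {f : ℝ → Space d → ℝ}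
    (h : ∀ η : ℝ, 0 < η → ∃ τ₀ : ℝ, 0 < τ₀ ∧ ∀ τ, τ₀ ≤ τ → ∀ᵐ x, |f τ x| ≤ η * V x) :
    Tendsto (fun τ => weightedNorm V (f τ)) atTop (𝓝 0) := by
  rw [ENNReal.tendsto_nhds_zero]
  intro ε hε
  obtain ⟨η, hη, hηε⟩ := ENNReal.lt_iff_exists_nnreal_btwn.1 hε
  obtain ⟨τ₀, -, h1⟩ := h η (by exact_mod_cast hη)
  filter_upwards [eventually_ge_atTop τ₀] with τ hτ
  refine le_trans ?_ hηε.le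
  rw [← ENNReal.ofReal_coe_nnreal]
  exact (weightedNorm_le_iff hV η.2).2 (h1 τ hτ)

/-! ### Convergence of the resolvents in Hilbert–Schmidt norm -/

/-- Potentials that are close relative to the weight have relatively close inverses, as quadratic
forms and hence in Hilbert–Schmidt norm. -/
theorem hsNorm_schrodingerInv_sub_le (hV : IsWeight C A a c V) (hr1 : r < 1) (hκ : 0 < κ)
    (hu : InBall V r u) (hv : InBall V r v) {ε : ℝ} (hε : 0 ≤ ε)
    (huv : ∀ᵐ x, |u x - v x| ≤ ε * V x) :
    hsNorm (schrodingerInv (fun x => κ + u x) - schrodingerInv (fun x => κ + v x)) ≤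
      ENNReal.ofReal (4 * (ε / (1 - r))) * hsNorm (schrodingerInv (fun x => κ + v x)) := by
  have hU := hu.isCoercive hV hr1 hκ
  have hU' := hv.isCoercive hV hr1 hκ
  have h1r : 0 < 1 - r := by linarith
  obtain ⟨δ, hδd⟩ : ∃ δ, δ = ε / (1 - r) := ⟨_, rfl⟩
  have hδ : 0 ≤ δ := hδd ▸ by positivity
  have hεδ : ε = δ * (1 - r) := by rw [hδd, div_mul_cancel₀ _ h1r.ne']
  rw [← hδd]
  -- relative to `κ + v ≥ (1 - r) V`, the difference of the potentials is small
  have hdiff : ∀ {u v : Space d → ℝ}, InBall V r v → (∀ᵐ x, |u x - v x| ≤ ε * V x) →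
      ∀ᵐ x, κ + u x ≤ (1 + δ) * (κ + v x) := by
    intro u v hv huv
    filter_upwards [huv, hv.le] with x hx1 hx2
    rw [abs_le] at hx1 hx2
    have h2 : (1 - r) * V x ≤ v x := by linarith [hx2.1]
    have h3 : δ * ((1 - r) * V x) ≤ δ * v x := mul_le_mul_of_nonneg_left h2 hδ
    have h4 := mul_nonneg hδ hκ.le
    rw [hεδ] at hx1
    linarith [hx1.2]
  have huv' : ∀ᵐ x, |v x - u x| ≤ ε * V x := by
    filter_upwards [huv] with x hx
    rwa [abs_sub_comm]
  have e1 := inner_schrodingerInv_le hU hU' (by linarith : 1 ≤ 1 + δ) (hdiff hv huv)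
  have e2 := inner_schrodingerInv_le hU' hU (by linarith : 1 ≤ 1 + δ) (hdiff hu huv')
  have hpos := isPositive_schrodingerInv (fun x => κ + v x)
  have e3 : ∀ g, (1 - δ) * (inner ℂ g (schrodingerInv (fun x => κ + v x) g)).re ≤
      (inner ℂ g (schrodingerInv (fun x => κ + u x) g)).re := by
    intro g
    have p1 : 0 ≤ (inner ℂ g (schrodingerInv (fun x => κ + v x) g)).re :=
      hpos.re_inner_nonneg_right g
    have p2 : 0 ≤ (inner ℂ g (schrodingerInv (fun x => κ + u x) g)).re :=
      (isPositive_schrodingerInv (fun x => κ + u x)).re_inner_nonneg_right g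
    rcases le_total 1 δ with h | h
    · nlinarith
    · have := mul_le_mul_of_nonneg_left (e1 g) (by linarith : 0 ≤ 1 - δ)
      nlinarith [mul_nonneg (sq_nonneg δ) p2]
  obtain ⟨I, b, hb⟩ := exists_basis_hsNorm d
  have key := tsum_enorm_sub_sq_le b hpos
    (isSelfAdjoint_schrodingerInv (fun x => κ + u x)) hδ e2 e3
  rw [hb, hb]
  have h10 : ENNReal.ofReal (10 * δ ^ 2) ≤ ENNReal.ofReal (4 * δ) ^ (2 : ℝ) := by
    rw [ENNReal.rpow_two, ← ENNReal.ofReal_pow (by positivity)]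
    refine ENNReal.ofReal_le_ofReal ?_
    nlinarith [sq_nonneg δ]
  refine (ENNReal.rpow_le_rpow (key.trans (mul_le_mul_left h10 _)) (by norm_num)).trans
    (le_of_eq ?_)
  rw [ENNReal.mul_rpow_of_nonneg _ _ (by norm_num), ← ENNReal.rpow_mul]
  norm_num

theorem hsNorm_schrodingerInv_lt_top (hV : IsWeight C A a c V) (hr1 : r < 1) (hκ : 0 < κ)
    (hv : InBall V r v) {κ₁ : ℝ} (hκ₁ : 0 < κ₁)
    (hHS : hsNorm (schrodingerInv (fun x => κ₁ + V x)) < ∞) :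
    hsNorm (schrodingerInv (fun x => κ + v x)) < ∞ := by
  have h1r : 0 < 1 - r := by linarith
  have hU := hv.isCoercive hV hr1 hκ
  have hU' : IsCoercive κ₁ (fun x => κ₁ + V x) :=
    ⟨hκ₁, aestronglyMeasurable_const.add hV.meas,
      Eventually.of_forall fun x => by linarith [hV.pos x]⟩
  -- `κ₁ + V ≤ k (κ + v)`, as `V ≤ v / (1 - r)`
  obtain ⟨k, hk⟩ : ∃ k, k = 1 + κ₁ / κ + 1 / (1 - r) := ⟨_, rfl⟩
  have hk1 : 1 ≤ k := by
    rw [hk]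
    have : 0 ≤ κ₁ / κ + 1 / (1 - r) := by positivity
    linarith
  have hle : ∀ᵐ x, κ₁ + V x ≤ k * (κ + v x) := by
    filter_upwards [hv.le] with x hx
    rw [abs_le] at hx
    have h2 : (1 - r) * V x ≤ v x := by linarith [hx.1]
    have hx0 := hV.pos x
    have hv0 : 0 ≤ v x := le_trans (by positivity) h2
    have h3 : κ₁ ≤ k * κ := by
      have : κ₁ / κ ≤ k := by
        rw [hk]
        have : 0 ≤ 1 / (1 - r) := by positivity
        linarith
      rwa [div_le_iff₀ hκ] at this
    have h4 : V x ≤ k * v x := by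
      have h5 : 1 / (1 - r) ≤ k := by
        rw [hk]
        have : 0 ≤ κ₁ / κ := by positivity
        linarith
      calc V x ≤ 1 / (1 - r) * v x := by rw [one_div, le_inv_mul_iff₀ h1r]; exact h2
        _ ≤ k * v x := by gcongr
    linarith
  have e1 := inner_schrodingerInv_le hU' hU hk1 hle
  have hT : ((k : ℂ) • schrodingerInv (fun x => κ₁ + V x)).IsPositive := by
    refine isPositive_of_re_inner_nonneg ?_ fun x => ?_
    · exact IsSelfAdjoint.smul (by simp [IsSelfAdjoint]) (isSelfAdjoint_schrodingerInv _)
    · rw [_root_.smul_apply, inner_smul_right, Complex.re_ofReal_mul]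
      exact mul_nonneg (by linarith) ((isPositive_schrodingerInv _).re_inner_nonneg_right x)
  obtain ⟨I, b, hb⟩ := exists_basis_hsNorm d
  have key := tsum_enorm_sq_le_of_le b (isPositive_schrodingerInv (fun x => κ + v x)) hT
    fun x => by
      rw [_root_.smul_apply, inner_smul_right, Complex.re_ofReal_mul]
      exact e1 x
  rw [hb, ENNReal.rpow_lt_top_iff_of_pos (by norm_num)] at hHS ⊢
  refine key.trans_lt ?_
  simp only [_root_.smul_apply, enorm_smul, mul_pow]
  rw [ENNReal.tsum_mul_left]
  exact ENNReal.mul_lt_top (by simp) hHS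

theorem tendsto_hsNorm_schrodingerInv_sub (hV : IsWeight C A a c V) (hr1 : r < 1) (hκ : 0 < κ)
    {f : ℝ → Space d → ℝ} (hf : ∀ τ, 0 < τ → InBall V r (f τ)) (hv : InBall V r v)
    (hHS : hsNorm (schrodingerInv (fun x => κ + v x)) < ∞)
    (h : ∀ η : ℝ, 0 < η → ∃ τ₀ : ℝ, 0 < τ₀ ∧ ∀ τ, τ₀ ≤ τ →
      ∀ᵐ x, |f τ x - v x| ≤ η * V x) :
    Tendsto (fun τ => hsNorm (schrodingerInv (fun x => κ + f τ x) -
      schrodingerInv (fun x => κ + v x))) atTop (𝓝 0) := by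
  rw [ENNReal.tendsto_nhds_zero]
  intro ε hε
  have h1 : Tendsto (fun η : ℝ => ENNReal.ofReal (4 * (η / (1 - r))) *
      hsNorm (schrodingerInv (fun x => κ + v x))) (𝓝[>] 0) (𝓝 0) := by
    have h2 : Tendsto (fun η : ℝ => 4 * (η / (1 - r))) (𝓝[>] 0) (𝓝 0) := by
      have h3 : Continuous fun η : ℝ => 4 * (η / (1 - r)) := by fun_prop
      have h4 := h3.tendsto 0
      simp only [zero_div, mul_zero] at h4
      exact h4.mono_left nhdsWithin_le_nhds
    have h5 := ENNReal.Tendsto.mul_const (ENNReal.tendsto_ofReal h2) (Or.inr hHS.ne)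
    rwa [ENNReal.ofReal_zero, zero_mul] at h5
  obtain ⟨η, hη, hη0⟩ := ((ENNReal.tendsto_nhds_zero.1 h1 ε hε).and self_mem_nhdsWithin).exists
  have hη0 : 0 < η := hη0
  obtain ⟨τ₀, hτ₀, h6⟩ := h η hη0
  filter_upwards [eventually_ge_atTop τ₀] with τ hτ
  exact (hsNorm_schrodingerInv_sub_le hV hr1 hκ (hf τ (hτ₀.trans_le hτ)) hv hη0.le
    (h6 τ hτ)).trans hη

/-- The hypotheses on the potential make it a weight. -/
theorem exists_isWeight (hd : 0 < d) (hV_loc : MemLinftyLoc V) (hV_nonneg : ∀ x, 0 ≤ V x)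
    {κ₁ : ℝ} (hκ₁ : 0 < κ₁) (hHS : hsNorm (schrodingerInv (fun x => κ₁ + V x)) < ∞)
    (hC : 0 < C) (hmul : ∀ x y, V (x + y) ≤ C * V x * V y) :
    ∃ A a c, IsWeight C A a c V := by
  obtain ⟨A, a, -, ha, hA⟩ := exists_exp_bound_of_submultiplicative hV_loc hV_nonneg hC hmul
  obtain ⟨c, hc, hcV⟩ := exists_pos_le_of_hsNorm_lt_top hV_loc hV_nonneg hC hmul hd hκ₁ hHS
  exact ⟨A, a, c, hV_loc.aestronglyMeasurable, hC, ha, hc, hcV, hA, hmul⟩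

end

end Counterterm

end

open Counterterm
theorem theorem5p2 (d : ℕ) (hd : d = 2 ∨ d = 3) (V w : Space d → ℝ)
    (hV_loc : MemLinftyLoc V) (hV_nonneg : ∀ x, 0 ≤ V x)
    (hV_HS : ∃ κ₁ : ℝ, 0 < κ₁ ∧ ∃ R : OneParticle d →L[ℂ] OneParticle d,
      IsSchrodingerInverse (fun x => κ₁ + V x) R ∧ hsNorm R < ∞)
    (hV_mul : ∃ C : ℝ, 0 < C ∧ ∀ x y, V (x + y) ≤ C * V x * V y)
    (hw_bdd : MemLp w ∞ volume) (hw_even : ∀ᵐ x, w (-x) = w x)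
    (hw_int : Integrable (fun y => |w y| * (1 + V y ^ 2))) :
    ∀ r : ℝ, 0 < r → r < 1 → ∃ κ₀ : ℝ, 0 < κ₀ ∧ ∀ κ : ℝ, κ₀ < κ →
      ∃ (vτ : ℝ → Space d → ℝ) (v : Space d → ℝ),
        (∀ τ : ℝ, 0 < τ → SolvesCounterterm V w κ r τ (vτ τ) ∧
          ∀ u : Space d → ℝ, SolvesCounterterm V w κ r τ u → u =ᵐ[volume] vτ τ) ∧
        MemBall V r v ∧
        Tendsto (fun τ => weightedNorm V (fun x => vτ τ x - v x)) atTop (𝓝 0) ∧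
        (ContDiff ℝ 1 V → weightedNorm V (fun x => ‖gradient V x‖) < ∞ →
          ∃ (Rτ : ℝ → OneParticle d →L[ℂ] OneParticle d)
            (R : OneParticle d →L[ℂ] OneParticle d),
            (∀ τ : ℝ, 0 < τ → IsSchrodingerInverse (fun x => κ + vτ τ x) (Rτ τ)) ∧
            IsSchrodingerInverse (fun x => κ + v x) R ∧
            Tendsto (fun τ => hsNorm (Rτ τ - R)) atTop (𝓝 0)) := by
  have hd2 : 2 ≤ d := by omega
  have hd3 : d ≤ 3 := by omega
  obtain ⟨κ₁, hκ₁, R₁, hR₁, hHS⟩ := hV_HS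
  obtain ⟨C, hC, hmul⟩ := hV_mul
  have hcoer : IsCoercive κ₁ (fun x => κ₁ + V x) :=
    ⟨hκ₁, aestronglyMeasurable_const.add hV_loc.aestronglyMeasurable,
      Eventually.of_forall fun x => by linarith [hV_nonneg x]⟩
  rw [hR₁.eq hcoer] at hHS
  obtain ⟨A, a, c, hV⟩ :=
    exists_isWeight (by omega) hV_loc hV_nonneg hκ₁ hHS hC hmul
  have hw := hasMass_of_even hw_bdd.1 hV_nonneg hV.meas hw_even hw_int
  generalize ∫ z, |w z| * V (-z) = W at hw
  intro r hr hr1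
  -- `κ₀` is such that the counterterm map is a contraction of the ball for `κ > κ₀`
  obtain ⟨κ₂, hκ₂⟩ := eventually_atTop.1 ((tendsto_contractionConst hd3 C A a W).eventually
    (gt_mem_nhds (half_pos hr)))
  refine ⟨max 1 (max (2 * a ^ 2) κ₂), lt_max_of_lt_left one_pos, fun κ hκ => ?_⟩
  simp only [max_lt_iff] at hκ
  obtain ⟨hκ1, hκa, hκ3⟩ := hκ
  have hκ0 : 0 < κ := by linarith
  have hq : 2 * contractionConst d C A a W κ ≤ r := by linarith [hκ₂ κ hκ3.le]
  -- for `τ ≤ 0` the value of `vτ` is irrelevant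
  have hfix : ∀ τ : ℝ, ∃ u, 0 < τ → InBall V r u ∧ ∀ x, u x = counterMap V w τ κ u x := by
    intro τ
    by_cases hτ : 0 < τ
    · obtain ⟨u, hu⟩ := exists_fixedPoint hd2 hd3 hV hw hr.le hr1 hκa hq hτ
      exact ⟨u, fun _ => hu⟩
    · exact ⟨V, fun h => absurd h hτ⟩
  choose vτ hvτ using hfix
  have hball : ∀ τ, 0 < τ → InBall V r (vτ τ) := fun τ hτ => (hvτ τ hτ).1
  have heq : ∀ τ, 0 < τ → vτ τ =ᵐ[volume] counterMap V w τ κ (vτ τ) := fun τ hτ =>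
    Eventually.of_forall (hvτ τ hτ).2
  obtain ⟨v, hv, hlim⟩ := exists_inBall_limit hball hV.pos fun η hη => by
    obtain ⟨τ₀, hτ₀, h⟩ := exists_abs_fixedPoint_sub_le hd2 hd3 hV hw hr1 hκa hq hη
    exact ⟨τ₀, hτ₀, fun τ τ' hτ hτ' => h τ τ' hτ hτ' _ _ (hball τ (hτ₀.trans_le hτ))
      (hball τ' (hτ₀.trans_le hτ')) (heq τ (hτ₀.trans_le hτ)) (heq τ' (hτ₀.trans_le hτ'))⟩
  refine ⟨vτ, v, fun τ hτ => ⟨?_, fun u hu => ?_⟩, (memBall_iff hV hV_loc hr.le hr1).2 hv,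
    tendsto_weightedNorm hV.pos hlim, fun _ _ => ?_⟩
  · exact (solvesCounterterm_iff hd2 hd3 hV hV_loc hw hr.le hr1 hκa hτ).2 ⟨hball τ hτ, heq τ hτ⟩
  · obtain ⟨h1, h2⟩ := (solvesCounterterm_iff hd2 hd3 hV hV_loc hw hr.le hr1 hκa hτ).1 hu
    exact fixedPoint_unique hd2 hd3 hV hw hr1 hκa hq hτ h1 (hball τ hτ) h2 (heq τ hτ)
  · exact ⟨fun τ => schrodingerInv (fun x => κ + vτ τ x), schrodingerInv (fun x => κ + v x),
      fun τ hτ => isSchrodingerInverse_schrodingerInv ((hball τ hτ).isCoercive hV hr1 hκ0),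
      isSchrodingerInverse_schrodingerInv (hv.isCoercive hV hr1 hκ0),
      tendsto_hsNorm_schrodingerInv_sub hV hr1 hκ0 hball hv
        (hsNorm_schrodingerInv_lt_top hV hr1 hκ0 hv hκ₁ hHS) hlim⟩
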